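/- **Notions.** Let $V\to M$ be a smooth vector bundle of rank $r$ over a smooth $d$-dimensional manifold (Hausdorff, second countable). A *Lie algebroid structure* $A$ on $V$ is a bundle map $\varrho:V\to TM$ (the anchor) and a Lie bracket on $\Gamma(V)$ with $[X,fY]=f[X,Y]+(\varrho(X)\cdot f)\,Y$. Its *leaves* are the sets of points that can be joined to a given point by finitely many smooth paths $a:[0,1]\to V$ over $\gamma:[0,1]\to M$ with $\gamma'=\varrho(a)$; a leaf $L$ has tangent space $T_yL=\varrho(V_y)$ at $y\in L$, and dimension $\dim \varrho(V_y)$. A leaf $S$ is *singular* if every neighborhood of $S$ meets a leaf of higher dimension. Let $\Pi_A$ be the fiber-wise linear Poisson bivector field on the total space of $V^*$ corresponding to $A$: in fibered coordinates $(x,y)$, where $y_1,\dots,y_r$ is the fiber-wise linear coordinate system given by a local frame $e_1,\dots,e_r$ of $V$, $$\{y_i,y_j\}=\sum_s f_{ij}^s(x)\,y_s,\qquad \{y_i,x_j\}=g_{ij}(x),\qquad \{x_i,x_j\}=0,$$ with $[e_i,e_j]=\sum_s f_{ij}^s e_s$ and $\varrho(e_i)=\sum_j g_{ij}\,\partial_{x_j}$.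 The $C^s$-topology on the set of Lie algebroid structures on $V$ is that of uniform convergence of $\Pi_A$ and of its derivatives up to order $s$ on compact subsets of the total space of $V^*$. For $k\ge 1$, a point $m$ of $M$ is a *singularity of order $k$* of $A$ if the $(k-1)$-jet of $\Pi_A$ at the origin $0_m$ of $V^*_m$ vanishes but its $k$-jet does not. It is a *$k$-stable singularity* of $A$ if it is a singularity of order $k$ and, for every neighborhood $\Omega$ of $m$ in $M$, every Lie algebroid structure on $V$ close enough to $A$ in the $C^{2k}$-topology has a singularity of order $k$ in $\Omega$. Let $m$ be a point of a leaf $S$ of $A$, and let $N\subset M$ be a transversal disc to $S$ at $m$: an embedded submanifold diffeomorphic to some $\mathbb R^q$, with $m\in N$, $T_mM=T_mS\oplus T_mN$, and $\varrho(V_z)+T_zN=T_zM$ for all $z\in N$. The *transversal Lie algebroid structure along $S$* at $m$ is the Lie algebroid structure on the bundle $\varrho^{-1}(TN)\subset V|_N$ over $N$ whose anchor and bracket are the restrictions of those of $A$. A leaf $S$ of dimension $n$ of $A$ is *stable* (for the $C^{2k}$-topology) if, for every neighborhood $U$ of $S$ in $M$, every Lie algebroid structure on $V$ close enough to $A$ in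 the $C^{2k}$-topology has a leaf of dimension $n$ that meets $U$. **Proposition 4.2.** Let $S$ be a singular leaf of a Lie algebroid structure $A$ on $V\to M$, and suppose that $S$ is an embedded submanifold of $M$. Let $k\ge1$. If a point $m\in S$ is a $k$-stable singularity of the transversal Lie algebroid structure along $S$ at $m$ (on some transversal disc $N$), then $S$ is stable for the $C^{2k}$-topology. -/

import Mathlib

open Bundle Manifold Filter Topology
open scoped ContDiff

noncomputable section

namespace AlgebroidStability

/-- The model space `ℝ^d`. -/
abbrev Euc (d : ℕ) : Type := EuclideanSpace ℝ (Fin d)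

/-- The standard basis of `ℝ^r`. -/
abbrev stdBasis (r : ℕ) : Module.Basis (Fin r) ℝ (Euc r) :=
  (EuclideanSpace.basisFun (Fin r) ℝ).toBasis

section Definitions

variable {d r : ℕ} {M : Type*} [TopologicalSpace M] [ChartedSpace (Euc d) M]
  {V : M → Type*} [TopologicalSpace (TotalSpace (Euc r) V)]
  [∀ x, AddCommGroup (V x)] [∀ x, Module ℝ (V x)] [∀ x, TopologicalSpace (V x)]
  [FiberBundle (Euc r) V] [VectorBundle ℝ (Euc r) V]

/-- The product `f X` of a smooth function and a smooth section. -/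
def smulSection (f : C^∞⟮𝓡 d, M; 𝓘(ℝ, ℝ), ℝ⟯) (X : Cₛ^∞⟮𝓡 d; Euc r, V⟯) :
    Cₛ^∞⟮𝓡 d; Euc r, V⟯ :=
  ⟨fun x ↦ f x • X x, f.contMDiff.smul_section X.contMDiff⟩

/-- The derivative `v · f` of a function `f` on `M` along a tangent vector `v` at `x`. -/
def dirDeriv (f : M → ℝ) (x : M) (v : TangentSpace (𝓡 d) x) : ℝ :=
  mfderiv (𝓡 d) 𝓘(ℝ, ℝ) f x v

variable (d r M V) in
/-- A Lie algebroid structure on the smooth vector bundle `V` of rank `r` over the `d`-dimensional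
manifold `M`: a bundle map `V → TM` (the anchor) and a Lie bracket on the space of smooth sections
which satisfies the Leibniz rule `[X, f Y] = f [X, Y] + (anchor(X) · f) Y`. -/
structure LieAlgebroid [IsManifold (𝓡 d) ∞ M] [ContMDiffVectorBundle ∞ (Euc r) V (𝓡 d)] where
  anchor : ∀ x : M, V x →ₗ[ℝ] TangentSpace (𝓡 d) x
  contMDiff_anchor : ContMDiff ((𝓡 d).prod 𝓘(ℝ, Euc r)) (𝓡 d).tangent ∞
    (fun v : TotalSpace (Euc r) V ↦ (⟨v.proj, anchor v.proj v.snd⟩ : TangentBundle (𝓡 d) M))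
  bracket : Cₛ^∞⟮𝓡 d; Euc r, V⟯ →ₗ[ℝ] Cₛ^∞⟮𝓡 d; Euc r, V⟯ →ₗ[ℝ] Cₛ^∞⟮𝓡 d; Euc r, V⟯
  bracket_self : ∀ X, bracket X X = 0
  jacobi : ∀ X Y Z,
    bracket X (bracket Y Z) + bracket Y (bracket Z X) + bracket Z (bracket X Y) = 0
  leibniz : ∀ (X Y : Cₛ^∞⟮𝓡 d; Euc r, V⟯) (f : C^∞⟮𝓡 d, M; 𝓘(ℝ, ℝ), ℝ⟯) (x : M),
    bracket X (smulSection f Y) x =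
      f x • bracket X Y x + dirDeriv f x (anchor x (X x)) • Y x

/-- Near every point of the domain of a local trivialization, a section of the corresponding local
frame coincides with a global smooth section. -/
theorem exists_section_eventuallyEq [T2Space M] [IsManifold (𝓡 d) ∞ M]
    [ContMDiffVectorBundle ∞ (Euc r) V (𝓡 d)] (x₀ x : M)
    (hx : x ∈ (trivializationAt (Euc r) V x₀).baseSet) (i : Fin r) :
    ∃ X : Cₛ^∞⟮𝓡 d; Euc r, V⟯,
      ∀ᶠ y in 𝓝 x, X y = (trivializationAt (Euc r) V x₀).localFrame (stdBasis r) i y := by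
  set e := trivializationAt (Euc r) V x₀
  obtain ⟨f, hf, -⟩ := (SmoothBumpFunction.nhds_basis_support (I := 𝓡 d)
    (e.open_baseSet.mem_nhds hx)).mem_iff.1 Filter.univ_mem
  have hs := e.contMDiffOn_localFrame_baseSet (I := 𝓡 d) ∞ (stdBasis r) i
  refine ⟨⟨_, ContMDiffOn.smul_section_of_tsupport (f.contMDiff.contMDiffOn) e.open_baseSet hf hs⟩,
    ?_⟩
  filter_upwards [f.eventuallyEq_one] with y hy
  simp [hy, e]

/-- The set of points of `M` covered by the fibered coordinates centred at `x₀`, i.e. the common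
domain of the preferred chart of `M` and of the preferred local trivialization of `V` at `x₀`. -/
def fiberedDomain (d r : ℕ) {M : Type*} [TopologicalSpace M] [ChartedSpace (Euc d) M]
    (V : M → Type*) [TopologicalSpace (TotalSpace (Euc r) V)]
    [∀ x, TopologicalSpace (V x)] [FiberBundle (Euc r) V] (x₀ : M) : Set M :=
  (chartAt (Euc d) x₀).source ∩ (trivializationAt (Euc r) V x₀).baseSet

/-- The range `{(x, y)}` of the fibered coordinates centred at `x₀` on the total space of the dual
bundle `V*`. Here `x ∈ ℝ^d` are the coordinates of the base point in the chart at `x₀`, and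
`y = (y₁, …, y_r)` are the fiber-wise linear functions on `V*` given by the local frame. -/
def fiberedRange (d r : ℕ) {M : Type*} [TopologicalSpace M] [ChartedSpace (Euc d) M]
    (V : M → Type*) [TopologicalSpace (TotalSpace (Euc r) V)]
    [∀ x, TopologicalSpace (V x)] [FiberBundle (Euc r) V] (x₀ : M) : Set (Euc d × Euc r) :=
  {z | z.1 ∈ (chartAt (Euc d) x₀).target ∧
    (chartAt (Euc d) x₀).symm z.1 ∈ fiberedDomain d r V x₀}

namespace LieAlgebroid

variable [IsManifold (𝓡 d) ∞ M] [ContMDiffVectorBundle ∞ (Euc r) V (𝓡 d)]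
  (A : LieAlgebroid d r M V)

section Poisson

/-- The component `g_{ij}` of the anchor in the fibered coordinates centred at `x₀`, at the point
`x` of their domain: the `j`-th coordinate of the image under the anchor of the `i`-th element of
the local frame. -/
def anchorCoeff (x₀ x : M) (i : Fin r) (j : Fin d) : ℝ :=
  (show Euc d from mfderiv (𝓡 d) 𝓘(ℝ, Euc d) (chartAt (Euc d) x₀) x
    (A.anchor x ((trivializationAt (Euc r) V x₀).localFrame (stdBasis r) i x))) j

variable [T2Space M]

open scoped Classical in
/-- The structure function `f_{ij}^s` of the bracket in the local frame `(e_i)` centred at `x₀`, at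
the point `x` of its domain: `[e_i, e_j] = ∑ₛ f_{ij}^s e_s`. The bracket being local, `[e_i, e_j]`
is computed at `x` with global sections that coincide with `e_i` and `e_j` near `x`. -/
def bracketCoeff (x₀ x : M) (i j s : Fin r) : ℝ :=
  if hx : x ∈ (trivializationAt (Euc r) V x₀).baseSet then
    (trivializationAt (Euc r) V x₀ ⟨x, A.bracket (exists_section_eventuallyEq x₀ x hx i).choose
      (exists_section_eventuallyEq x₀ x hx j).choose x⟩).2 s
  else 0

/-- The matrix, in the fibered coordinates `(x, y)` centred at `x₀`, of the fiber-wise linear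
Poisson bivector field `Π` on the total space of `V*` which corresponds to the Lie algebroid:
`{y_i, y_j} = ∑ₛ f_{ij}^s(x) y_s`, `{y_i, x_j} = g_{ij}(x)`, `{x_i, x_j} = 0`. -/
def poisson (x₀ : M) (z : Euc d × Euc r) : Fin r ⊕ Fin d → Fin r ⊕ Fin d → ℝ
  | .inl i, .inl j =>
      ∑ s, A.bracketCoeff x₀ ((chartAt (Euc d) x₀).symm z.1) i j s * z.2 s
  | .inl i, .inr j => A.anchorCoeff x₀ ((chartAt (Euc d) x₀).symm z.1) i j
  | .inr i, .inl j => -A.anchorCoeff x₀ ((chartAt (Euc d) x₀).symm z.1) j i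
  | .inr _, .inr _ => 0

/-- The filter of neighborhoods of a Lie algebroid structure on `V` for the `C^s`-topology, i.e. the
topology of uniform convergence on compact sets of the total space of `V*` of the corresponding
bivector fields and of their derivatives up to order `s`. -/
def csNhds (s : ℕ) : Filter (LieAlgebroid d r M V) :=
  ⨅ (x₀ : M) (K : Set (Euc d × Euc r)) (_ : IsCompact K) (_ : K ⊆ fiberedRange d r V x₀)
    (ε : ℝ) (_ : 0 < ε),
    𝓟 {B | ∀ z ∈ K, ∀ j ≤ s,
      ‖iteratedFDeriv ℝ j (fun w ↦ B.poisson x₀ w - A.poisson x₀ w) z‖ < ε}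

/-- The point `m` is a singularity of order `k > 0`: the `(k-1)`-jet of `Π` at the origin `0_m` of
the fiber of `V*` over `m` vanishes, but not its `k`-jet. -/
def IsSingularityOfOrder (k : ℕ) (m : M) : Prop :=
  0 < k ∧ (∀ j < k, iteratedFDeriv ℝ j (A.poisson m) (chartAt (Euc d) m m, 0) = 0) ∧
    iteratedFDeriv ℝ k (A.poisson m) (chartAt (Euc d) m m, 0) ≠ 0

/-- The point `m` is a `k`-stable singularity: it is a singularity of order `k`, and for every
neighborhood `Ω` of `m`, all Lie algebroid structures on `V` which are close enough in the
`C^{2k}`-topology have a singularity of order `k` in `Ω`. -/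
def IsKStableSingularity (k : ℕ) (m : M) : Prop :=
  A.IsSingularityOfOrder k m ∧
    ∀ Ω ∈ 𝓝 m, ∀ᶠ B in A.csNhds (2 * k), ∃ p ∈ Ω, B.IsSingularityOfOrder k p

end Poisson

section Leaves

/-- `x` and `y` are the end points of a smooth path in the algebroid: a smooth curve `a` in `V` over
a curve `γ` in `M` from `x` to `y` with `γ'(t) = anchor (a(t))`. -/
def JoinedByPath (x y : M) : Prop :=
  ∃ a : ℝ → TotalSpace (Euc r) V,
    ContMDiff 𝓘(ℝ, ℝ) ((𝓡 d).prod 𝓘(ℝ, Euc r)) ∞ a ∧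
    (∀ t ∈ Set.Icc (0 : ℝ) 1, HasMFDerivAt 𝓘(ℝ, ℝ) (𝓡 d) (fun u ↦ (a u).proj) t
      (ContinuousLinearMap.toSpanSingleton ℝ (A.anchor (a t).proj (a t).snd))) ∧
    (a 0).proj = x ∧ (a 1).proj = y

/-- The leaf through `x` of the foliation of the Lie algebroid: the set of the points that can be
reached from `x` along finitely many paths of the algebroid. -/
def leaf (x : M) : Set M := {y | Relation.ReflTransGen A.JoinedByPath x y}

/-- `L` is a leaf of dimension `n`. The tangent space of a leaf at its point `y` is the image of the
anchor at `y`. -/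
def IsLeafOfDim (L : Set M) (n : ℕ) : Prop :=
  (∃ x, L = A.leaf x) ∧ ∀ y ∈ L, Module.finrank ℝ (LinearMap.range (A.anchor y)) = n

/-- The leaf `S`, of dimension `n`, is singular: every neighborhood of `S` meets a leaf of higher
dimension. -/
def IsSingularLeaf (S : Set M) (n : ℕ) : Prop :=
  A.IsLeafOfDim S n ∧ ∀ U, IsOpen U → S ⊆ U →
    ∃ L n', A.IsLeafOfDim L n' ∧ n < n' ∧ (L ∩ U).Nonempty

/-- The leaf `S`, of dimension `n`, is stable for the `C^s`-topology: for every neighborhood `U` of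
`S`, all Lie algebroid structures on `V` which are close enough in the `C^s`-topology have a leaf of
dimension `n` that meets `U`. -/
def IsStableLeaf [T2Space M] (s : ℕ) (S : Set M) (n : ℕ) : Prop :=
  ∀ U, IsOpen U → S ⊆ U →
    ∀ᶠ B in A.csNhds s, ∃ L, B.IsLeafOfDim L n ∧ (L ∩ U).Nonempty

end Leaves

section Transversal

variable {q l : ℕ} {N : Type*} [TopologicalSpace N] [ChartedSpace (Euc q) N]
  [IsManifold (𝓡 q) ∞ N]
  {W : N → Type*} [TopologicalSpace (TotalSpace (Euc l) W)]
  [∀ z, AddCommGroup (W z)] [∀ z, Module ℝ (W z)] [∀ z, TopologicalSpace (W z)]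
  [FiberBundle (Euc l) W] [VectorBundle ℝ (Euc l) W] [ContMDiffVectorBundle ∞ (Euc l) W (𝓡 q)]

/-- The Lie algebroid `B` on `W → N` is the transversal structure of `A` at the point `ι p` of its
leaf, on the transversal submanifold `ι : N → M`. The submanifold is embedded, satisfies
`T_m M = T_m S ⊕ T_m N` at `m = ι p`, where `T_m S = anchor (V_m)`, and is transverse to all the
leaves that it meets. The bundle `W` is identified by `J` with the subbundle `anchor⁻¹(TN)` of the
restriction of `V` to `N`, and the anchor and the bracket of `B` are the restrictions of those of
`A`. -/
structure IsTransversalStructure (B : LieAlgebroid q l N W) (ι : N → M)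
    (J : ∀ z, W z →ₗ[ℝ] V (ι z)) (p : N) : Prop where
  isSmoothEmbedding : IsSmoothEmbedding (𝓡 q) (𝓡 d) ∞ ι
  isCompl : IsCompl (LinearMap.range (A.anchor (ι p)))
    (LinearMap.range (mfderiv (𝓡 q) (𝓡 d) ι p).toLinearMap)
  transverse : ∀ z, LinearMap.range (A.anchor (ι z)) ⊔
    LinearMap.range (mfderiv (𝓡 q) (𝓡 d) ι z).toLinearMap = ⊤
  contMDiff_map : ContMDiff ((𝓡 q).prod 𝓘(ℝ, Euc l)) ((𝓡 d).prod 𝓘(ℝ, Euc r)) ∞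
    (fun w : TotalSpace (Euc l) W ↦ (⟨ι w.proj, J w.proj w.snd⟩ : TotalSpace (Euc r) V))
  injective : ∀ z, Function.Injective (J z)
  range_eq : ∀ z, LinearMap.range (J z) =
    (LinearMap.range (mfderiv (𝓡 q) (𝓡 d) ι z).toLinearMap).comap (A.anchor (ι z))
  anchor_eq : ∀ z (w : W z),
    mfderiv (𝓡 q) (𝓡 d) ι z (B.anchor z w) = A.anchor (ι z) (J z w)
  bracket_eq : ∀ (X Y : Cₛ^∞⟮𝓡 d; Euc r, V⟯) (X' Y' : Cₛ^∞⟮𝓡 q; Euc l, W⟯),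
    (∀ z, X (ι z) = J z (X' z)) → (∀ z, Y (ι z) = J z (Y' z)) →
    ∀ z, A.bracket X Y (ι z) = J z (B.bracket X' Y' z)

end Transversal

end LieAlgebroid

/-- `S` is an embedded submanifold of dimension `n` of the `d`-dimensional manifold `M`: around
every point of `S` there is a chart of `M` in which `S` is an `n`-dimensional linear subspace. -/
def IsEmbeddedSubmanifold (d : ℕ) {M : Type*} [TopologicalSpace M] [ChartedSpace (Euc d) M]
    (S : Set M) (n : ℕ) : Prop :=
  ∀ x ∈ S, ∃ φ ∈ IsManifold.maximalAtlas (𝓡 d) ∞ M, x ∈ φ.source ∧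
    ∃ T : Submodule ℝ (Euc d), Module.finrank ℝ T = n ∧ ∀ y ∈ φ.source, y ∈ S ↔ φ y ∈ T

end Definitions

end AlgebroidStability

end

noncomputable section

namespace AlgebroidStability

set_option linter.unusedSectionVars false

universe u

/-! Cut everything along the disc `N`. A structure `A'` close to `A` is still transverse to `N` over
any prescribed compact part of it, so it induces a transversal structure there. If this structure is
close to `B`, then `k`-stability gives it a singularity `z` of order `k ≥ 1` near `p`. At `z` the
transversal anchor vanishes: the image of the anchor of `A'` meets the tangent space of `N` only in
zero and, by transversality, is a complement of it. Its dimension is therefore `d - q`, which is `n`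
by the same count for `A` at `p`. Finally, the rank of the anchor is constant on each leaf
(`finrank_anchor_eq_of_joinedByPath`): along a path of the algebroid the matrix of the anchor solves
an equation `G' = P G + G Q`, whose solutions have locally constant rank. So the leaf of `A'`
through `ι z` has dimension `n` and meets `U`.

Three points carry the work. The subbundle `anchor⁻¹(TN)` varies with the structure, whereas
stability of `B` concerns structures on one fixed bundle. A fiberwise left inverse `lam` of `J`,
chosen once and for all, identifies the varying subbundles with the trivial bundle of rank `l`. The
condition `NondegAt`, bijectivity of `(v, ξ) ↦ (lam v, anchor v - dι ξ)`, expresses both the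
transversality and this identification, and it is open.

No derivative may be lost, since `C^{2k}`-closeness to `A` has to yield `C^{2k}`-closeness to `B`.
The bracket of lifted sections seems to involve the derivative of the lift, hence of the anchor.
Differentiating `lam (lift u) = u` moves this derivative onto `lam`, which does not depend on the
structure. The transversal coefficients thus become smooth pointwise functions of the
undifferentiated coefficients of `A'` and of fixed data (`CoordData`, `bracket_of_eq_lift`), and
`CsTendsto.comp` applies.

The induced structure lives over a compact part of the disc only. Replacing the anchor by `χ ρ` and
the bracket by `χ⁻¹ [χ X, χ Y]` gives a structure over the whole of `ℝ^q` which is unchanged where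
`χ = 1` (`exists_cutoff_algebroid`). This is enough, because closeness to `B` is tested on a ball
(`exists_ball_of_eventually_csNhds`). -/

/-- Uniform convergence on `K`, along the filter `l`, of the functions `f b` and of their
derivatives up to order `s` to `g` and its derivatives. -/
def CsTendsto {ι : Type*} {E F : Type u} [NormedAddCommGroup E] [NormedSpace ℝ E]
    [NormedAddCommGroup F] [NormedSpace ℝ F] (l : Filter ι) (s : ℕ) (K : Set E)
    (f : ι → E → F) (g : E → F) : Prop :=
  ∀ ε > 0, ∀ᶠ b in l, ∀ z ∈ K, ∀ j ≤ s, ‖iteratedFDeriv ℝ j (fun w ↦ f b w - g w) z‖ < ε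

/-! ### Calculus of `C^s`-convergence on a set. -/

namespace CsTendsto

variable {ι : Type*} {E F G : Type u} [NormedAddCommGroup E] [NormedSpace ℝ E]
    [NormedAddCommGroup F] [NormedSpace ℝ F] [NormedAddCommGroup G] [NormedSpace ℝ G]
    {l : Filter ι} {s : ℕ} {K : Set E} {f f₁ : ι → E → F} {g g₁ : E → F}

theorem zero_iff : CsTendsto l 0 K f g ↔ ∀ ε > 0, ∀ᶠ b in l, ∀ z ∈ K, ‖f b z - g z‖ < ε := by
  simp [CsTendsto]

theorem mono_order {s' : ℕ} (h : CsTendsto l s K f g) (hs : s' ≤ s) : CsTendsto l s' K f g :=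
  fun ε hε ↦ (h ε hε).mono fun _ hb z hz j hj ↦ hb z hz j (hj.trans hs)

theorem mono_set {K' : Set E} (h : CsTendsto l s K f g) (hs : K' ⊆ K) : CsTendsto l s K' f g :=
  fun ε hε ↦ (h ε hε).mono fun _ hb z hz j hj ↦ hb z (hs hz) j hj

theorem congr_eventually (h : CsTendsto l s K f g)
    (hf : ∀ᶠ b in l, ∀ z ∈ K, f₁ b =ᶠ[𝓝 z] f b) (hg : ∀ z ∈ K, g₁ =ᶠ[𝓝 z] g) :
    CsTendsto l s K f₁ g₁ := by
  intro ε hε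
  filter_upwards [h ε hε, hf] with b hb hfb z hz j hj
  have : (fun w ↦ f₁ b w - g₁ w) =ᶠ[𝓝 z] (fun w ↦ f b w - g w) := by
    filter_upwards [hfb z hz, hg z hz] with w h1 h2
    rw [h1, h2]
  rw [this.iteratedFDeriv ℝ j |>.eq_of_nhds]
  exact hb z hz j hj

theorem const (g : E → F) : CsTendsto l s K (fun _ ↦ g) g := by
  intro ε hε
  refine Eventually.of_forall fun b z _ j _ ↦ ?_
  have : (fun w ↦ g w - g w) = fun _ : E ↦ (0 : F) := by ext; simp
  rw [this]
  simpa using hε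

theorem fderiv_sub_eventuallyEq {f g : E → F} {z : E} (hf : ContDiffAt ℝ ∞ f z)
    (hg : ContDiffAt ℝ ∞ g z) :
    (fun w ↦ fderiv ℝ f w - fderiv ℝ g w) =ᶠ[𝓝 z] fderiv ℝ (fun w ↦ f w - g w) := by
  have hf' := (hf.of_le (m := 1) (mod_cast le_top)).eventually (by simp)
  have hg' := (hg.of_le (m := 1) (mod_cast le_top)).eventually (by simp)
  filter_upwards [hf', hg'] with w h1 h2
  exact (fderiv_fun_sub (h1.differentiableAt (by simp)) (h2.differentiableAt (by simp))).symm

/-- The derivatives of order `j + 1` of `f b - g` have the norms of those of order `j` of `Df b -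
Dg`. This allows induction on `s`, so that composition rules need only the first-order chain rule.
-/
theorem succ_iff (hf : ∀ᶠ b in l, ∀ z ∈ K, ContDiffAt ℝ ∞ (f b) z)
    (hg : ∀ z ∈ K, ContDiffAt ℝ ∞ g z) :
    CsTendsto l (s + 1) K f g ↔ CsTendsto l 0 K f g ∧
      CsTendsto l s K (fun b ↦ fderiv ℝ (f b)) (fderiv ℝ g) := by
  have key : ∀ b, (∀ z ∈ K, ContDiffAt ℝ ∞ (f b) z) → ∀ z ∈ K, ∀ j,
      ‖iteratedFDeriv ℝ j (fun w ↦ fderiv ℝ (f b) w - fderiv ℝ g w) z‖ =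
        ‖iteratedFDeriv ℝ (j + 1) (fun w ↦ f b w - g w) z‖ := by
    intro b hb z hz j
    rw [(fderiv_sub_eventuallyEq (hb z hz) (hg z hz)).iteratedFDeriv ℝ j |>.eq_of_nhds,
      norm_iteratedFDeriv_fderiv]
  constructor
  · intro h
    refine ⟨h.mono_order (Nat.zero_le _), fun ε hε ↦ ?_⟩
    filter_upwards [h ε hε, hf] with b hb hfb z hz j hj
    rw [key b hfb z hz]
    exact hb z hz (j + 1) (by omega)
  · rintro ⟨h0, h1⟩ ε hε
    filter_upwards [h0 ε hε, h1 ε hε, hf] with b hb0 hb1 hfb z hz j hj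
    rcases j with _ | j
    · exact hb0 z hz 0 le_rfl
    · rw [← key b hfb z hz]
      exact hb1 z hz j (by omega)

theorem clm_comp (L : F →L[ℝ] G) (hf : ∀ᶠ b in l, ∀ z ∈ K, ContDiffAt ℝ ∞ (f b) z)
    (hg : ∀ z ∈ K, ContDiffAt ℝ ∞ g z) (h : CsTendsto l s K f g) :
    CsTendsto l s K (fun b z ↦ L (f b z)) (fun z ↦ L (g z)) := by
  intro ε hε
  filter_upwards [h (ε / (‖L‖ + 1)) (by positivity), hf] with b hb hfb z hz j hj
  have h1 : (fun w ↦ L (f b w) - L (g w)) = L ∘ (fun w ↦ f b w - g w) := by ext; simp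
  have h2 := L.norm_iteratedFDeriv_comp_left (N := ∞) (n := j) ((hfb z hz).sub (hg z hz))
    (by exact_mod_cast le_top)
  rw [h1]
  refine h2.trans_lt ?_
  calc ‖L‖ * ‖iteratedFDeriv ℝ j (fun w ↦ f b w - g w) z‖
      ≤ (‖L‖ + 1) * ‖iteratedFDeriv ℝ j (fun w ↦ f b w - g w) z‖ := by gcongr; linarith
    _ < (‖L‖ + 1) * (ε / (‖L‖ + 1)) := by gcongr; exact hb z hz j hj
    _ = ε := by field_simp

theorem add (hf : ∀ᶠ b in l, ∀ z ∈ K, ContDiffAt ℝ ∞ (f b) z)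
    (hg : ∀ z ∈ K, ContDiffAt ℝ ∞ g z) (hf₁ : ∀ᶠ b in l, ∀ z ∈ K, ContDiffAt ℝ ∞ (f₁ b) z)
    (hg₁ : ∀ z ∈ K, ContDiffAt ℝ ∞ g₁ z) (h : CsTendsto l s K f g) (h₁ : CsTendsto l s K f₁ g₁) :
    CsTendsto l s K (fun b z ↦ f b z + f₁ b z) (fun z ↦ g z + g₁ z) := by
  intro ε hε
  filter_upwards [h (ε / 2) (by positivity), hf, h₁ (ε / 2) (by positivity), hf₁]
    with b hb hfb hb₁ hfb₁ z hz j hj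
  have h1 : (fun w ↦ f b w + f₁ b w - (g w + g₁ w)) =
      (fun w ↦ f b w - g w) + (fun w ↦ f₁ b w - g₁ w) := by ext; simp; abel
  have hj' : (j : ℕ∞ω) ≤ ∞ := by exact_mod_cast le_top
  rw [h1, iteratedFDeriv_add_apply (((hfb z hz).sub (hg z hz)).of_le hj')
    (((hfb₁ z hz).sub (hg₁ z hz)).of_le hj')]
  refine (norm_add_le _ _).trans_lt ?_
  linarith [hb z hz j hj, hb₁ z hz j hj]

theorem prodMk {f₂ : ι → E → G} {g₂ : E → G} (hf : ∀ᶠ b in l, ∀ z ∈ K, ContDiffAt ℝ ∞ (f b) z)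
    (hg : ∀ z ∈ K, ContDiffAt ℝ ∞ g z) (hf₂ : ∀ᶠ b in l, ∀ z ∈ K, ContDiffAt ℝ ∞ (f₂ b) z)
    (hg₂ : ∀ z ∈ K, ContDiffAt ℝ ∞ g₂ z) (h : CsTendsto l s K f g) (h₂ : CsTendsto l s K f₂ g₂) :
    CsTendsto l s K (fun b z ↦ (f b z, f₂ b z)) (fun z ↦ (g z, g₂ z)) := by
  have h1 := clm_comp (ContinuousLinearMap.inl ℝ F G) hf hg h
  have h2 := clm_comp (ContinuousLinearMap.inr ℝ F G) hf₂ hg₂ h₂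
  have := add (hf.mono fun b hb z hz ↦ (ContinuousLinearMap.inl ℝ F G).contDiff.contDiffAt.comp z (hb z hz))
    (fun z hz ↦ (ContinuousLinearMap.inl ℝ F G).contDiff.contDiffAt.comp z (hg z hz))
    (hf₂.mono fun b hb z hz ↦ (ContinuousLinearMap.inr ℝ F G).contDiff.contDiffAt.comp z (hb z hz))
    (fun z hz ↦ (ContinuousLinearMap.inr ℝ F G).contDiff.contDiffAt.comp z (hg₂ z hz)) h1 h2
  simpa using this

theorem eventually_mapsTo (hK : IsCompact K) (hg : ∀ z ∈ K, ContDiffAt ℝ ∞ g z) {Ω : Set F}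
    (hΩ : IsOpen Ω) (hgΩ : Set.MapsTo g K Ω) (h : CsTendsto l s K f g) :
    ∀ᶠ b in l, Set.MapsTo (f b) K Ω := by
  have hc : IsCompact (g '' K) := hK.image_of_continuousOn
    fun z hz ↦ (hg z hz).continuousAt.continuousWithinAt
  obtain ⟨δ, hδ, hd⟩ := hc.exists_thickening_subset_open hΩ hgΩ.image_subset
  filter_upwards [zero_iff.1 (h.mono_order (Nat.zero_le _)) δ hδ] with b hb z hz
  exact hd (Metric.mem_thickening_iff.2 ⟨g z, ⟨z, hz, rfl⟩, by rw [dist_eq_norm]; exact hb z hz⟩)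

/-- A continuous function is uniformly continuous near a compact set: one `δ` serves all points of
`g(K)`, although the values `f b z` need not belong to `g(K)`. -/
theorem zero_comp (hK : IsCompact K) (hg : ∀ z ∈ K, ContDiffAt ℝ ∞ g z) {Ω : Set F}
    (hΩ : IsOpen Ω) (hgΩ : Set.MapsTo g K Ω) {Ψ : F → G} (hΨ : ContinuousOn Ψ Ω)
    (h : CsTendsto l 0 K f g) : CsTendsto l 0 K (fun b z ↦ Ψ (f b z)) (fun z ↦ Ψ (g z)) := by
  rw [zero_iff] at h ⊢
  intro ε hε
  have hc : IsCompact (g '' K) := hK.image_of_continuousOn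
    fun z hz ↦ (hg z hz).continuousAt.continuousWithinAt
  have := hc.uniformContinuousAt_of_continuousAt Ψ
    (fun y hy ↦ hΨ.continuousAt (hΩ.mem_nhds (hgΩ.image_subset hy))) (Metric.dist_mem_uniformity hε)
  obtain ⟨δ, hδ, hd⟩ := Metric.mem_uniformity_dist.1 this
  filter_upwards [h δ hδ] with b hb z hz
  have := hd (a := g z) (b := f b z) (by rw [dist_comm, dist_eq_norm]; exact hb z hz) ⟨z, hz, rfl⟩
  rw [← dist_eq_norm, dist_comm]
  exact this

/-- By the chain rule, `D(Ψ ∘ f) = Θ(f, Df)` with `Θ(y, L) = DΨ(y) ∘ L` smooth on `Ω × univ`, and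
the pair `(f, Df)` converges to one order less; hence induction on `s`. The target spaces change
during the induction, which is why all spaces share one universe. -/
theorem comp (hK : IsCompact K) (hf : ∀ᶠ b in l, ∀ z ∈ K, ContDiffAt ℝ ∞ (f b) z)
    (hg : ∀ z ∈ K, ContDiffAt ℝ ∞ g z) {Ω : Set F}
    (hΩ : IsOpen Ω) (hgΩ : Set.MapsTo g K Ω) {Ψ : F → G} (hΨ : ContDiffOn ℝ ∞ Ψ Ω)
    (h : CsTendsto l s K f g) : CsTendsto l s K (fun b z ↦ Ψ (f b z)) (fun z ↦ Ψ (g z)) := by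
  induction s generalizing F G with
  | zero => exact zero_comp hK hg hΩ hgΩ hΨ.continuousOn h
  | succ s ih =>
    have hΨ' : ∀ y ∈ Ω, ContDiffAt ℝ ∞ Ψ y := fun y hy ↦ hΨ.contDiffAt (hΩ.mem_nhds hy)
    have hmaps := h.eventually_mapsTo hK hg hΩ hgΩ
    have hfΨ : ∀ᶠ b in l, ∀ z ∈ K, ContDiffAt ℝ ∞ (fun z ↦ Ψ (f b z)) z := by
      filter_upwards [hf, hmaps] with b hb hm z hz using (hΨ' _ (hm hz)).comp z (hb z hz)
    have hgΨ : ∀ z ∈ K, ContDiffAt ℝ ∞ (fun z ↦ Ψ (g z)) z :=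
      fun z hz ↦ (hΨ' _ (hgΩ hz)).comp z (hg z hz)
    rw [succ_iff hfΨ hgΨ]
    obtain ⟨h0, h1⟩ := (succ_iff hf hg).1 h
    refine ⟨zero_comp hK hg hΩ hgΩ hΨ.continuousOn h0, ?_⟩
    have hf' : ∀ᶠ b in l, ∀ z ∈ K, ContDiffAt ℝ ∞ (fderiv ℝ (f b)) z :=
      hf.mono fun b hb z hz ↦ (hb z hz).fderiv_right (by simp)
    have hg' : ∀ z ∈ K, ContDiffAt ℝ ∞ (fderiv ℝ g) z :=
      fun z hz ↦ (hg z hz).fderiv_right (by simp)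
    have hΘ : ContDiffOn ℝ ∞ (fun p : F × (E →L[ℝ] F) ↦ (fderiv ℝ Ψ p.1).comp p.2)
        (Ω ×ˢ Set.univ) := by
      have : ContDiffOn ℝ ∞ (fderiv ℝ Ψ) Ω := hΨ.fderiv_of_isOpen hΩ (by simp)
      exact (this.comp contDiffOn_fst (fun p hp ↦ hp.1)).clm_comp contDiffOn_snd
    have hpair := prodMk hf hg hf' hg' (h.mono_order (Nat.le_succ s)) h1
    have hchain : ∀ φ : E → F, ∀ z, ContDiffAt ℝ ∞ φ z → φ z ∈ Ω →
        fderiv ℝ (fun w ↦ Ψ (φ w)) =ᶠ[𝓝 z] fun w ↦ (fderiv ℝ Ψ (φ w)).comp (fderiv ℝ φ w) := by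
      intro φ z hφ hz
      filter_upwards [hφ.continuousAt.eventually (hΩ.mem_nhds hz),
        (hφ.of_le (m := 1) (mod_cast le_top)).eventually (by simp)] with w hw hw'
      exact fderiv_comp w ((hΨ' _ hw).differentiableAt (by simp)) (hw'.differentiableAt (by simp))
    refine (ih (f := fun b z ↦ (f b z, fderiv ℝ (f b) z)) (g := fun z ↦ (g z, fderiv ℝ g z))
      ?_ (fun z hz ↦ (hg z hz).prodMk (hg' z hz)) (hΩ.prod isOpen_univ)
      (fun z hz ↦ ⟨hgΩ hz, trivial⟩) hΘ hpair).congr_eventually ?_ ?_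
    · filter_upwards [hf, hf'] with b hb hb' z hz using (hb z hz).prodMk (hb' z hz)
    · filter_upwards [hf, hmaps] with b hb hm z hz using hchain _ z (hb z hz) (hm hz)
    · exact fun z hz ↦ hchain _ z (hg z hz) (hgΩ hz)

/-- Same induction, from `D(f ∘ h) = (Df ∘ h) ∘ Dh`. Composition of linear maps is a smooth function
of the pair, so `comp` finishes each step. -/
theorem comp_right {E' : Type u} [NormedAddCommGroup E'] [NormedSpace ℝ E'] {K' : Set E'}
    (hK' : IsCompact K') {h : E' → E} (hh : ∀ z ∈ K', ContDiffAt ℝ ∞ h z)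
    (hm : Set.MapsTo h K' K) (hf : ∀ᶠ b in l, ∀ z ∈ K, ContDiffAt ℝ ∞ (f b) z)
    (hg : ∀ z ∈ K, ContDiffAt ℝ ∞ g z) (hfg : CsTendsto l s K f g) :
    CsTendsto l s K' (fun b z ↦ f b (h z)) (fun z ↦ g (h z)) := by
  induction s generalizing F with
  | zero =>
    rw [zero_iff] at hfg ⊢
    exact fun ε hε ↦ (hfg ε hε).mono fun b hb z hz ↦ hb _ (hm hz)
  | succ s ih =>
    have hfh : ∀ᶠ b in l, ∀ z ∈ K', ContDiffAt ℝ ∞ (fun z ↦ f b (h z)) z :=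
      hf.mono fun b hb z hz ↦ (hb _ (hm hz)).comp z (hh z hz)
    have hgh : ∀ z ∈ K', ContDiffAt ℝ ∞ (fun z ↦ g (h z)) z :=
      fun z hz ↦ (hg _ (hm hz)).comp z (hh z hz)
    rw [succ_iff hfh hgh]
    obtain ⟨h0, h1⟩ := (succ_iff hf hg).1 hfg
    have h0' : CsTendsto l 0 K' (fun b z ↦ f b (h z)) (fun z ↦ g (h z)) := by
      rw [zero_iff] at h0 ⊢
      exact fun ε hε ↦ (h0 ε hε).mono fun b hb z hz ↦ hb _ (hm hz)
    refine ⟨h0', ?_⟩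
    have hf' : ∀ᶠ b in l, ∀ z ∈ K, ContDiffAt ℝ ∞ (fderiv ℝ (f b)) z :=
      hf.mono fun b hb z hz ↦ (hb z hz).fderiv_right (by simp)
    have hg' : ∀ z ∈ K, ContDiffAt ℝ ∞ (fderiv ℝ g) z :=
      fun z hz ↦ (hg z hz).fderiv_right (by simp)
    have hh' : ∀ z ∈ K', ContDiffAt ℝ ∞ (fderiv ℝ h) z :=
      fun z hz ↦ (hh z hz).fderiv_right (by simp)
    have h2 := ih hf' hg' h1
    have hf'h : ∀ᶠ b in l, ∀ z ∈ K', ContDiffAt ℝ ∞ (fun z ↦ fderiv ℝ (f b) (h z)) z :=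
      hf'.mono fun b hb z hz ↦ (hb _ (hm hz)).comp z (hh z hz)
    have hg'h : ∀ z ∈ K', ContDiffAt ℝ ∞ (fun z ↦ fderiv ℝ g (h z)) z :=
      fun z hz ↦ (hg' _ (hm hz)).comp z (hh z hz)
    have h3 := prodMk hf'h hg'h (Eventually.of_forall fun _ ↦ hh') hh' h2
      (CsTendsto.const (l := l) (fderiv ℝ h))
    have hΘ : ContDiffOn ℝ ∞ (fun p : (E →L[ℝ] F) × (E' →L[ℝ] E) ↦ p.1.comp p.2) Set.univ :=
      (contDiff_fst.clm_comp contDiff_snd).contDiffOn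
    have hchain : ∀ φ : E → F, ∀ z ∈ K', ContDiffAt ℝ ∞ φ (h z) →
        fderiv ℝ (fun w ↦ φ (h w)) =ᶠ[𝓝 z] fun w ↦ (fderiv ℝ φ (h w)).comp (fderiv ℝ h w) := by
      intro φ z hz hφ
      filter_upwards [(hh z hz).continuousAt.eventually
          ((hφ.of_le (m := 1) (mod_cast le_top)).eventually (by simp)),
        ((hh z hz).of_le (m := 1) (mod_cast le_top)).eventually (by simp)] with w hw hw'
      exact fderiv_comp w (hw.differentiableAt (by simp)) (hw'.differentiableAt (by simp))
    refine (h3.comp hK' ?_ (fun z hz ↦ (hg'h z hz).prodMk (hh' z hz)) isOpen_univ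
      (fun _ _ ↦ trivial) hΘ).congr_eventually ?_ ?_
    · filter_upwards [hf'h] with b hb z hz using (hb z hz).prodMk (hh' z hz)
    · filter_upwards [hf] with b hb z hz using hchain _ z hz (hb _ (hm hz))
    · exact fun z hz ↦ hchain _ z hz (hg _ (hm hz))

end CsTendsto

/-! ### Derivatives of vector-valued functions along tangent vectors. -/

section Calculus

variable {d : ℕ} {M : Type*} [TopologicalSpace M] [ChartedSpace (Euc d) M]
  {E E' : Type*} [NormedAddCommGroup E] [NormedSpace ℝ E] [NormedAddCommGroup E'] [NormedSpace ℝ E']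

/-- The derivative of a vector-valued function along a tangent vector. -/
def vecDeriv (F : M → E) (x : M) : TangentSpace (𝓡 d) x →ₗ[ℝ] E :=
  (show TangentSpace (𝓡 d) x →L[ℝ] E from mfderiv (𝓡 d) 𝓘(ℝ, E) F x).toLinearMap

theorem dirDeriv_eq_vecDeriv (f : M → ℝ) (x : M) (v : TangentSpace (𝓡 d) x) :
    dirDeriv f x v = vecDeriv f x v := rfl

theorem vecDeriv_congr {F G : M → E} {x : M} (h : F =ᶠ[𝓝 x] G) :
    vecDeriv (d := d) F x = vecDeriv G x := by
  unfold vecDeriv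
  rw [h.mfderiv_eq]

theorem vecDeriv_apply_of_hasMFDerivAt {F : M → E} {x : M} {L : TangentSpace (𝓡 d) x →L[ℝ] E}
    (h : HasMFDerivAt (𝓡 d) 𝓘(ℝ, E) F x L) (v : TangentSpace (𝓡 d) x) :
    vecDeriv F x v = L v := by
  unfold vecDeriv
  rw [h.mfderiv]
  rfl

theorem vecDeriv_comp {F : M → E} {x : M} {Φ : E → E'} (hΦ : DifferentiableAt ℝ Φ (F x))
    (hF : MDifferentiableAt (𝓡 d) 𝓘(ℝ, E) F x) (v : TangentSpace (𝓡 d) x) :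
    vecDeriv (fun y ↦ Φ (F y)) x v = fderiv ℝ Φ (F x) (vecDeriv F x v) := by
  have := HasMFDerivAt.comp x hΦ.hasFDerivAt.hasMFDerivAt hF.hasMFDerivAt
  exact vecDeriv_apply_of_hasMFDerivAt this v

theorem vecDeriv_clm {F : M → E} {x : M} (L : E →L[ℝ] E')
    (hF : MDifferentiableAt (𝓡 d) 𝓘(ℝ, E) F x) (v : TangentSpace (𝓡 d) x) :
    vecDeriv (fun y ↦ L (F y)) x v = L (vecDeriv F x v) := by
  rw [vecDeriv_comp L.differentiableAt hF, L.fderiv]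

theorem vecDeriv_const (c : E) (x : M) : vecDeriv (d := d) (fun _ : M ↦ c) x = 0 := by
  ext v
  rw [vecDeriv_apply_of_hasMFDerivAt (hasMFDerivAt_const c x)]
  rfl

theorem vecDeriv_comp_left {q : ℕ} {N : Type*} [TopologicalSpace N] [ChartedSpace (Euc q) N]
    {F : M → E} {h : N → M} {z : N}
    (hF : MDifferentiableAt (𝓡 d) 𝓘(ℝ, E) F (h z)) (hh : MDifferentiableAt (𝓡 q) (𝓡 d) h z)
    (v : TangentSpace (𝓡 q) z) :
    vecDeriv (fun y ↦ F (h y)) z v = vecDeriv F (h z) (mfderiv (𝓡 q) (𝓡 d) h z v) := by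
  exact vecDeriv_apply_of_hasMFDerivAt (HasMFDerivAt.comp z hF.hasMFDerivAt hh.hasMFDerivAt) v

theorem vecDeriv_eq_fderiv {q : ℕ} (F : Euc q → E) (z : Euc q) (v : Euc q) :
    vecDeriv (d := q) F z v = fderiv ℝ F z v := by
  unfold vecDeriv
  rw [mfderiv_eq_fderiv]
  rfl

variable [T2Space M] [IsManifold (𝓡 d) ∞ M]

/-- A vector-valued function which is smooth near a point coincides near this point with a globally
smooth one, supported in a given neighborhood. -/
theorem exists_contMDiff_eventuallyEq {F : M → E} {x : M}
    (hF : ∀ᶠ y in 𝓝 x, ContMDiffAt (𝓡 d) 𝓘(ℝ, E) ∞ F y) :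
    ∃ G : M → E, ContMDiff (𝓡 d) 𝓘(ℝ, E) ∞ G ∧ G =ᶠ[𝓝 x] F := by
  obtain ⟨U, hU, hUo, hxU⟩ := eventually_nhds_iff.1 hF
  obtain ⟨f, -, hf⟩ := (SmoothBumpFunction.nhds_basis_tsupport (I := 𝓡 d) x).mem_iff.1
    (hUo.mem_nhds hxU)
  refine ⟨fun y ↦ f y • F y, ?_, ?_⟩
  · refine contMDiff_of_tsupport fun y hy ↦ ?_
    have hy' : y ∈ tsupport f := closure_mono (Function.support_smul_subset_left f F) hy
    exact f.contMDiffAt.smul (hU y (hf hy'))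
  · filter_upwards [f.eventuallyEq_one] with y hy
    simp [hy]

end Calculus

/-! ### Fiber coordinates and local sections. -/

section Bracket

variable {d r : ℕ} {M : Type*} [TopologicalSpace M] [ChartedSpace (Euc d) M]
  {V : M → Type*} [TopologicalSpace (TotalSpace (Euc r) V)]
  [∀ x, AddCommGroup (V x)] [∀ x, Module ℝ (V x)] [∀ x, TopologicalSpace (V x)]
  [FiberBundle (Euc r) V] [VectorBundle ℝ (Euc r) V]

variable (r) in
/-- The fiber coordinates of a vector of `V` in the preferred trivialization at `x₀`. -/
def fib (x₀ x : M) : V x →ₗ[ℝ] Euc r := (trivializationAt (Euc r) V x₀).linearMapAt ℝ x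

/-- The vector of `V` with given coordinates in the preferred trivialization at `x₀`. -/
def fibSymm (r : ℕ) (V : M → Type*) [TopologicalSpace (TotalSpace (Euc r) V)]
    [∀ x, AddCommGroup (V x)] [∀ x, Module ℝ (V x)] [∀ x, TopologicalSpace (V x)]
    [FiberBundle (Euc r) V] [VectorBundle ℝ (Euc r) V] (x₀ x : M) : Euc r →ₗ[ℝ] V x :=
  (trivializationAt (Euc r) V x₀).symmₗ ℝ x

variable {x₀ x : M}

theorem fib_apply (hx : x ∈ (trivializationAt (Euc r) V x₀).baseSet) (v : V x) :
    fib r x₀ x v = (trivializationAt (Euc r) V x₀ ⟨x, v⟩).2 := by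
  simp [fib, Trivialization.linearMapAt_apply, hx]

theorem fib_fibSymm (hx : x ∈ (trivializationAt (Euc r) V x₀).baseSet) (u : Euc r) :
    fib r x₀ x (fibSymm r V x₀ x u) = u :=
  (trivializationAt (Euc r) V x₀).linearMapAt_symmₗ hx u

theorem fibSymm_fib (hx : x ∈ (trivializationAt (Euc r) V x₀).baseSet) (v : V x) :
    fibSymm r V x₀ x (fib r x₀ x v) = v :=
  (trivializationAt (Euc r) V x₀).symmₗ_linearMapAt hx v

theorem fib_injective (hx : x ∈ (trivializationAt (Euc r) V x₀).baseSet) :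
    Function.Injective (fib (V := V) r x₀ x) :=
  Function.LeftInverse.injective (fibSymm_fib hx)

theorem localFrame_eq (hx : x ∈ (trivializationAt (Euc r) V x₀).baseSet) (i : Fin r) :
    (trivializationAt (Euc r) V x₀).localFrame (stdBasis r) i x =
      fibSymm r V x₀ x (stdBasis r i) := by
  rw [Trivialization.localFrame_apply_of_mem_baseSet _ _ hx]
  simp only [Trivialization.basisAt, Module.Basis.map_apply, fibSymm]
  rw [Trivialization.linearEquivAt_symm_apply, Trivialization.symmₗ_apply _ hx]

variable [T2Space M] [IsManifold (𝓡 d) ∞ M] [ContMDiffVectorBundle ∞ (Euc r) V (𝓡 d)]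

theorem contMDiffAt_fib (X : Cₛ^∞⟮𝓡 d; Euc r, V⟯)
    (hx : x ∈ (trivializationAt (Euc r) V x₀).baseSet) :
    ContMDiffAt (𝓡 d) 𝓘(ℝ, Euc r) ∞ (fun y ↦ fib r x₀ y (X y)) x := by
  have := ((trivializationAt (Euc r) V x₀).contMDiffAt_section_iff (IB := 𝓡 d) hx).1
    X.contMDiff.contMDiffAt
  refine this.congr_of_eventuallyEq ?_
  filter_upwards [(trivializationAt (Euc r) V x₀).open_baseSet.mem_nhds hx] with y hy
  exact fib_apply hy _

/-- A smooth function near `x` with values in the coordinates of the fiber comes from a global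
section. -/
theorem exists_section_fib_eq {c : M → Euc r}
    (hx : x ∈ (trivializationAt (Euc r) V x₀).baseSet)
    (hc : ∀ᶠ y in 𝓝 x, ContMDiffAt (𝓡 d) 𝓘(ℝ, Euc r) ∞ c y) :
    ∃ X : Cₛ^∞⟮𝓡 d; Euc r, V⟯, ∀ᶠ y in 𝓝 x, X y = fibSymm r V x₀ y (c y) := by
  set e := trivializationAt (Euc r) V x₀
  obtain ⟨U, hU, hUo, hxU⟩ := eventually_nhds_iff.1 hc
  obtain ⟨f, -, hf⟩ := (SmoothBumpFunction.nhds_basis_tsupport (I := 𝓡 d) x).mem_iff.1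
    ((hUo.inter e.open_baseSet).mem_nhds ⟨hxU, hx⟩)
  have hs : ContMDiffOn (𝓡 d) ((𝓡 d).prod 𝓘(ℝ, Euc r)) ∞
      (fun y ↦ TotalSpace.mk' (Euc r) y (fibSymm r V x₀ y (c y))) (U ∩ e.baseSet) := by
    rw [e.contMDiffOn_section_iff (hUo.inter e.open_baseSet) Set.inter_subset_right]
    intro y hy
    refine ((hU y hy.1).congr_of_eventuallyEq ?_).contMDiffWithinAt
    filter_upwards [e.open_baseSet.mem_nhds hy.2] with w hw
    rw [← fib_apply hw, fib_fibSymm hw]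
  refine ⟨⟨_, ContMDiffOn.smul_section_of_tsupport (f.contMDiff.contMDiffOn)
    (hUo.inter e.open_baseSet) hf hs⟩, ?_⟩
  filter_upwards [f.eventuallyEq_one] with y hy
  simp [hy]

end Bracket

/-! ### Locality of the bracket and its expression in a local frame. -/

namespace LieAlgebroid

variable {d r : ℕ} {M : Type*} [TopologicalSpace M] [ChartedSpace (Euc d) M]
  {V : M → Type*} [TopologicalSpace (TotalSpace (Euc r) V)]
  [∀ x, AddCommGroup (V x)] [∀ x, Module ℝ (V x)] [∀ x, TopologicalSpace (V x)]
  [FiberBundle (Euc r) V] [VectorBundle ℝ (Euc r) V]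
  [IsManifold (𝓡 d) ∞ M] [ContMDiffVectorBundle ∞ (Euc r) V (𝓡 d)]
  (A : LieAlgebroid d r M V)

theorem bracket_antisymm (X Y : Cₛ^∞⟮𝓡 d; Euc r, V⟯) : A.bracket X Y = -A.bracket Y X := by
  have := A.bracket_self (X + Y)
  simp only [map_add, LinearMap.add_apply, A.bracket_self, zero_add, add_zero] at this
  exact eq_neg_of_add_eq_zero_right this

theorem leibniz_left (X Y : Cₛ^∞⟮𝓡 d; Euc r, V⟯) (f : C^∞⟮𝓡 d, M; 𝓘(ℝ, ℝ), ℝ⟯) (x : M) :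
    A.bracket (smulSection f X) Y x =
      f x • A.bracket X Y x - vecDeriv f x (A.anchor x (Y x)) • X x := by
  rw [A.bracket_antisymm, A.bracket_antisymm X Y]
  simp only [ContMDiffSection.coe_neg, Pi.neg_apply]
  rw [A.leibniz, dirDeriv_eq_vecDeriv, smul_neg, neg_add, sub_eq_add_neg]

theorem section_sum_apply {ι : Type*} (t : Finset ι) (X : ι → Cₛ^∞⟮𝓡 d; Euc r, V⟯) (x : M) :
    (∑ i ∈ t, X i) x = ∑ i ∈ t, X i x := by
  rw [← ContMDiffSection.coeAddHom_apply, map_sum, Finset.sum_apply]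
  rfl

variable [T2Space M]

/-- If `Y = Y'` near `x`, then `Y - Y' = g (Y - Y')` for one minus a bump function `g`, which
vanishes near `x`. Both terms of the Leibniz rule for `[X, g (Y - Y')]` then vanish at `x`. -/
theorem bracket_congr_right (X : Cₛ^∞⟮𝓡 d; Euc r, V⟯) {Y Y' : Cₛ^∞⟮𝓡 d; Euc r, V⟯} {x : M}
    (h : ∀ᶠ y in 𝓝 x, Y y = Y' y) : A.bracket X Y x = A.bracket X Y' x := by
  obtain ⟨f, -, hf⟩ := (SmoothBumpFunction.nhds_basis_support (I := 𝓡 d) h).mem_iff.1 h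
  let g : C^∞⟮𝓡 d, M; 𝓘(ℝ, ℝ), ℝ⟯ := ⟨fun y ↦ 1 - f y, contMDiff_const.sub f.contMDiff⟩
  have hg : (g : M → ℝ) =ᶠ[𝓝 x] fun _ ↦ 0 := by
    filter_upwards [f.eventuallyEq_one] with y hy
    show 1 - f y = 0
    simp [hy]
  have h1 : Y - Y' = smulSection g (Y - Y') := by
    ext y
    show (Y - Y') y = g y • (Y - Y') y
    by_cases hy : f y = 0
    · show _ = (1 - f y) • _
      simp [hy]
    · have : Y y = Y' y := hf hy
      simp [this]
  have h2 := A.leibniz X (Y - Y') g x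
  rw [← h1, hg.eq_of_nhds, dirDeriv_eq_vecDeriv, vecDeriv_congr hg, vecDeriv_const] at h2
  simpa [sub_eq_zero] using h2

theorem bracket_congr {X X' Y Y' : Cₛ^∞⟮𝓡 d; Euc r, V⟯} {x : M}
    (hX : ∀ᶠ y in 𝓝 x, X y = X' y) (hY : ∀ᶠ y in 𝓝 x, Y y = Y' y) :
    A.bracket X Y x = A.bracket X' Y' x := by
  rw [A.bracket_congr_right X hY, A.bracket_antisymm X, A.bracket_antisymm X']
  simp only [ContMDiffSection.coe_neg, Pi.neg_apply]
  rw [A.bracket_congr_right Y' hX]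

/-- The bilinear map with matrix the structure functions of the bracket. -/
def brk (x₀ x : M) : Euc r →L[ℝ] Euc r →L[ℝ] Euc r :=
  ∑ i, ∑ j, ∑ s, A.bracketCoeff x₀ x i j s •
    (EuclideanSpace.proj (𝕜 := ℝ) i : Euc r →L[ℝ] ℝ).smulRight
      ((EuclideanSpace.proj (𝕜 := ℝ) j : Euc r →L[ℝ] ℝ).smulRight (EuclideanSpace.single s (1 : ℝ)))

/-- The linear map with matrix the components of the anchor. -/
def anc (x₀ x : M) : Euc r →L[ℝ] Euc d :=
  ∑ i, ∑ j, A.anchorCoeff x₀ x i j •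
    (EuclideanSpace.proj (𝕜 := ℝ) i : Euc r →L[ℝ] ℝ).smulRight (EuclideanSpace.single j (1 : ℝ))

theorem brk_apply (x₀ x : M) (u v : Euc r) (s : Fin r) :
    A.brk x₀ x u v s = ∑ i, ∑ j, A.bracketCoeff x₀ x i j s * (u i * v j) := by
  simp [brk, Pi.single_apply]

theorem anc_apply (x₀ x : M) (u : Euc r) (j : Fin d) :
    A.anc x₀ x u j = ∑ i, A.anchorCoeff x₀ x i j * u i := by
  simp [anc, Pi.single_apply]

/-- By locality, the extensions chosen in the definition of `bracketCoeff` are immaterial. -/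
theorem bracketCoeff_eq {x₀ x : M} (hx : x ∈ (trivializationAt (Euc r) V x₀).baseSet)
    {i j : Fin r} {X Y : Cₛ^∞⟮𝓡 d; Euc r, V⟯}
    (hX : ∀ᶠ y in 𝓝 x, X y = fibSymm r V x₀ y (stdBasis r i))
    (hY : ∀ᶠ y in 𝓝 x, Y y = fibSymm r V x₀ y (stdBasis r j)) (s : Fin r) :
    A.bracketCoeff x₀ x i j s = fib r x₀ x (A.bracket X Y x) s := by
  have hev := (trivializationAt (Euc r) V x₀).open_baseSet.mem_nhds hx
  rw [bracketCoeff, dif_pos hx, fib_apply hx]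
  refine congrArg (fun w : V x ↦ (trivializationAt (Euc r) V x₀ ⟨x, w⟩).2 s) ?_
  apply A.bracket_congr
  · filter_upwards [(exists_section_eventuallyEq (d := d) (V := V) x₀ x hx i).choose_spec, hX, hev]
      with y h1 h2 hy
    rw [h1, h2, localFrame_eq hy]
  · filter_upwards [(exists_section_eventuallyEq (d := d) (V := V) x₀ x hx j).choose_spec, hY, hev]
      with y h1 h2 hy
    rw [h1, h2, localFrame_eq hy]

theorem brk_eq {x₀ x : M} (hx : x ∈ (trivializationAt (Euc r) V x₀).baseSet)
    {X : Fin r → Cₛ^∞⟮𝓡 d; Euc r, V⟯}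
    (hX : ∀ i, ∀ᶠ y in 𝓝 x, X i y = fibSymm r V x₀ y (stdBasis r i)) (u v : Euc r) :
    A.brk x₀ x u v = ∑ i, ∑ j, (u i * v j) • fib r x₀ x (A.bracket (X i) (X j) x) := by
  ext s
  rw [brk_apply]
  simp only [WithLp.ofLp_sum, Finset.sum_apply, WithLp.ofLp_smul, Pi.smul_apply, smul_eq_mul]
  refine Finset.sum_congr rfl fun i _ ↦ Finset.sum_congr rfl fun j _ ↦ ?_
  rw [A.bracketCoeff_eq hx (hX i) (hX j), mul_comm]

theorem brk_eq_single {x₀ x : M} (hx : x ∈ (trivializationAt (Euc r) V x₀).baseSet)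
    (u v : Euc r) (X Y : Cₛ^∞⟮𝓡 d; Euc r, V⟯)
    (hX : ∀ᶠ y in 𝓝 x, X y = fibSymm r V x₀ y u) (hY : ∀ᶠ y in 𝓝 x, Y y = fibSymm r V x₀ y v) :
    A.brk x₀ x u v = fib r x₀ x (A.bracket X Y x) := by
  choose E hE using fun i : Fin r ↦ exists_section_fib_eq (V := V) (d := d) (c := fun _ ↦ stdBasis r i) hx
    (Eventually.of_forall fun _ ↦ contMDiffAt_const)
  have key : ∀ (w : Euc r) (Z : Cₛ^∞⟮𝓡 d; Euc r, V⟯), (∀ᶠ y in 𝓝 x, Z y = fibSymm r V x₀ y w) →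
      ∀ᶠ y in 𝓝 x, Z y = (∑ i, w i • E i) y := by
    intro w Z hZ
    filter_upwards [hZ, eventually_all.2 hE] with y h1 h2
    have hw : w = ∑ i, w i • stdBasis r i := by
      conv_lhs => rw [← (stdBasis r).sum_repr w]
      simp
    rw [h1]
    conv_lhs => rw [hw]
    rw [section_sum_apply, map_sum]
    simp [h2]
  rw [A.bracket_congr (key u X hX) (key v Y hY), A.brk_eq hx hE]
  have : A.bracket (∑ i, u i • E i) (∑ i, v i • E i) x =
      ∑ i, ∑ j, (u i * v j) • A.bracket (E i) (E j) x := by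
    simp only [map_sum, LinearMap.sum_apply, map_smul, LinearMap.smul_apply]
    rw [section_sum_apply, Finset.sum_comm]
    refine Finset.sum_congr rfl fun j _ ↦ ?_
    show v j • (∑ i, u i • A.bracket (E i) (E j)) x = _
    rw [section_sum_apply, Finset.smul_sum]
    refine Finset.sum_congr rfl fun i _ ↦ ?_
    show v j • u i • A.bracket (E i) (E j) x = _
    rw [smul_smul, mul_comm]
  rw [this]
  simp [map_sum]

/-- The Leibniz rule is given for global functions and sections only, so the coefficients of `X` in
the frame are replaced by global functions with the same germs at `x`. -/
theorem eventually_eq_sum_frame {x₀ x : M} (hx : x ∈ (trivializationAt (Euc r) V x₀).baseSet)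
    {E : Fin r → Cₛ^∞⟮𝓡 d; Euc r, V⟯}
    (hE : ∀ i, ∀ᶠ y in 𝓝 x, E i y = fibSymm r V x₀ y (stdBasis r i)) (X : Cₛ^∞⟮𝓡 d; Euc r, V⟯) :
    ∃ a : Fin r → C^∞⟮𝓡 d, M; 𝓘(ℝ, ℝ), ℝ⟯,
      (∀ i, (a i : M → ℝ) =ᶠ[𝓝 x] fun y ↦ fib r x₀ y (X y) i) ∧
      ∀ᶠ y in 𝓝 x, X y = (∑ i, smulSection (a i) (E i)) y := by
  have hev := (trivializationAt (Euc r) V x₀).open_baseSet.mem_nhds hx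
  have h0 : ∀ i : Fin r, ∃ G : M → ℝ, ContMDiff (𝓡 d) 𝓘(ℝ, ℝ) ∞ G ∧
      G =ᶠ[𝓝 x] fun y ↦ fib r x₀ y (X y) i := by
    intro i
    apply exists_contMDiff_eventuallyEq
    filter_upwards [hev] with y hy
    exact (EuclideanSpace.proj (𝕜 := ℝ) i : Euc r →L[ℝ] ℝ).contMDiff.contMDiffAt.comp y
      (contMDiffAt_fib X hy)
  choose G hG hGX using h0
  refine ⟨fun i ↦ ⟨G i, hG i⟩, hGX, ?_⟩
  filter_upwards [eventually_all.2 hE, eventually_all.2 hGX, hev] with y h1 h2 hy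
  rw [section_sum_apply]
  show X y = ∑ i, G i y • E i y
  simp only [h1, h2]
  conv_lhs => rw [← fibSymm_fib hy (X y), ← (stdBasis r).sum_repr (fib r x₀ y (X y))]
  simp [map_sum]

/-- Expand both sections in a frame and apply the Leibniz rule in each argument: the derivatives of
the coefficients separate from the structure functions. Every later computation of a bracket rests
on this formula. -/
theorem fib_bracket {x₀ x : M} (hx : x ∈ (trivializationAt (Euc r) V x₀).baseSet)
    (X Y : Cₛ^∞⟮𝓡 d; Euc r, V⟯) :
    fib r x₀ x (A.bracket X Y x) =
      vecDeriv (fun y ↦ fib r x₀ y (Y y)) x (A.anchor x (X x)) -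
      vecDeriv (fun y ↦ fib r x₀ y (X y)) x (A.anchor x (Y x)) +
      A.brk x₀ x (fib r x₀ x (X x)) (fib r x₀ x (Y x)) := by
  choose E hE using fun i : Fin r ↦ exists_section_fib_eq (V := V) (d := d)
    (c := fun _ ↦ stdBasis r i) hx (Eventually.of_forall fun _ ↦ contMDiffAt_const)
  obtain ⟨a, ha, haX⟩ := eventually_eq_sum_frame hx hE X
  obtain ⟨b, hb, hbY⟩ := eventually_eq_sum_frame hx hE Y
  have hd : ∀ (Z : Cₛ^∞⟮𝓡 d; Euc r, V⟯) (c : Fin r → C^∞⟮𝓡 d, M; 𝓘(ℝ, ℝ), ℝ⟯),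
      (∀ i, (c i : M → ℝ) =ᶠ[𝓝 x] fun y ↦ fib r x₀ y (Z y) i) → ∀ w : TangentSpace (𝓡 d) x,
      vecDeriv (fun y ↦ fib r x₀ y (Z y)) x w = ∑ i, vecDeriv (c i) x w • stdBasis r i := by
    intro Z c hc w
    have h1 : ∀ i, vecDeriv (c i) x w = vecDeriv (fun y ↦ fib r x₀ y (Z y)) x w i := by
      intro i
      rw [vecDeriv_congr (hc i)]
      exact vecDeriv_clm (EuclideanSpace.proj (𝕜 := ℝ) i : Euc r →L[ℝ] ℝ)
        ((contMDiffAt_fib Z hx).mdifferentiableAt (by simp)) w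
    conv_lhs => rw [← (stdBasis r).sum_repr (vecDeriv (fun y ↦ fib r x₀ y (Z y)) x w)]
    simp [h1]
  have hEx : ∀ i, fib r x₀ x (E i x) = stdBasis r i := by
    intro i
    rw [(hE i).self_of_nhds, fib_fibSymm hx]
  have hterm : ∀ i j, A.bracket (smulSection (a i) (E i)) (smulSection (b j) (E j)) x =
      (a i x * b j x) • A.bracket (E i) (E j) x
        + vecDeriv (b j) x (A.anchor x (a i x • E i x)) • E j x
        - vecDeriv (a i) x (A.anchor x (b j x • E j x)) • E i x := by
    intro i j
    rw [A.leibniz, A.leibniz_left, dirDeriv_eq_vecDeriv]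
    show b j x • (a i x • A.bracket (E i) (E j) x - vecDeriv (a i) x (A.anchor x (E j x)) • E i x)
      + vecDeriv (b j) x (A.anchor x (a i x • E i x)) • E j x = _
    simp only [map_smul, smul_sub, smul_smul, smul_eq_mul]
    rw [mul_comm (b j x)]
    abel
  have hXx : X x = ∑ i, a i x • E i x := by
    rw [haX.self_of_nhds, section_sum_apply]; rfl
  have hYx : Y x = ∑ i, b i x • E i x := by
    rw [hbY.self_of_nhds, section_sum_apply]; rfl
  rw [A.bracket_congr haX hbY, hd X a ha, hd Y b hb, A.brk_eq hx hE]
  simp only [map_sum, LinearMap.sum_apply]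
  rw [section_sum_apply]
  simp_rw [section_sum_apply, hterm]
  have ha' : ∀ i, fib r x₀ x (X x) i = a i x := fun i ↦ (ha i).eq_of_nhds.symm
  have hb' : ∀ i, fib r x₀ x (Y x) i = b i x := fun i ↦ (hb i).eq_of_nhds.symm
  simp only [map_sum, map_add, map_sub, map_smul, hEx, ha', hb', Finset.sum_add_distrib,
    Finset.sum_sub_distrib]
  have e1 : ∀ j, vecDeriv (b j) x (A.anchor x (X x)) =
      ∑ i, vecDeriv (b j) x (a i x • A.anchor x (E i x)) := by
    intro j
    rw [hXx]
    simp [map_sum]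
  have e2 : ∀ j, vecDeriv (a j) x (A.anchor x (Y x)) =
      ∑ i, vecDeriv (a j) x (b i x • A.anchor x (E i x)) := by
    intro j
    rw [hYx]
    simp [map_sum]
  simp only [e1, e2, Finset.sum_smul, map_smul]
  rw [Finset.sum_comm]
  conv_lhs => arg 2; rw [Finset.sum_comm]
  abel

end LieAlgebroid

/-! ### The anchor as a morphism, and smoothness of the coefficients. -/

namespace LieAlgebroid

variable {d r : ℕ} {M : Type*} [TopologicalSpace M] [ChartedSpace (Euc d) M]
  {V : M → Type*} [TopologicalSpace (TotalSpace (Euc r) V)]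
  [∀ x, AddCommGroup (V x)] [∀ x, Module ℝ (V x)] [∀ x, TopologicalSpace (V x)]
  [FiberBundle (Euc r) V] [VectorBundle ℝ (Euc r) V]
  [T2Space M] [IsManifold (𝓡 d) ∞ M] [ContMDiffVectorBundle ∞ (Euc r) V (𝓡 d)]
  (A : LieAlgebroid d r M V)


theorem contMDiff_anchor_section (X : Cₛ^∞⟮𝓡 d; Euc r, V⟯) :
    ContMDiff (𝓡 d) (𝓡 d).tangent ∞
      (fun x ↦ (⟨x, A.anchor x (X x)⟩ : TangentBundle (𝓡 d) M)) :=
  A.contMDiff_anchor.comp X.contMDiff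

theorem contMDiff_vecDeriv {E : Type*} [NormedAddCommGroup E] [NormedSpace ℝ E] {F : M → E}
    (hF : ContMDiff (𝓡 d) 𝓘(ℝ, E) ∞ F) (X : Cₛ^∞⟮𝓡 d; Euc r, V⟯) :
    ContMDiff (𝓡 d) 𝓘(ℝ, E) ∞ (fun x ↦ vecDeriv F x (A.anchor x (X x))) :=
  (contMDiff_snd_tangentBundle_modelSpace E 𝓘(ℝ, E)).comp
    ((hF.contMDiff_tangentMap (m := ∞) (by simp)).comp (A.contMDiff_anchor_section X))

theorem contMDiffAt_vecDeriv {E : Type*} [NormedAddCommGroup E] [NormedSpace ℝ E] {F : M → E}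
    {x : M} (hF : ∀ᶠ y in 𝓝 x, ContMDiffAt (𝓡 d) 𝓘(ℝ, E) ∞ F y) (X : Cₛ^∞⟮𝓡 d; Euc r, V⟯) :
    ContMDiffAt (𝓡 d) 𝓘(ℝ, E) ∞ (fun x ↦ vecDeriv F x (A.anchor x (X x))) x := by
  obtain ⟨G, hG, hGF⟩ := exists_contMDiff_eventuallyEq hF
  refine (A.contMDiff_vecDeriv hG X).contMDiffAt.congr_of_eventuallyEq ?_
  filter_upwards [hGF.eventually_nhds] with y hy
  rw [vecDeriv_congr hy]

/-- The anchor is a morphism of Lie algebras. -/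
theorem anchor_bracket (X Y : Cₛ^∞⟮𝓡 d; Euc r, V⟯) (h : C^∞⟮𝓡 d, M; 𝓘(ℝ, ℝ), ℝ⟯) (x : M) :
    vecDeriv h x (A.anchor x (A.bracket X Y x)) =
      vecDeriv (fun y ↦ vecDeriv h y (A.anchor y (Y y))) x (A.anchor x (X x)) -
      vecDeriv (fun y ↦ vecDeriv h y (A.anchor y (X y))) x (A.anchor x (Y x)) := by
  have hx : x ∈ (trivializationAt (Euc r) V x).baseSet := mem_baseSet_trivializationAt _ _ _
  -- The argument needs a section that does not vanish at `x`. In rank zero there is none, but then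
  -- all sections are zero and so are both sides.
  rcases Nat.eq_zero_or_pos r with hr | hr
  · subst hr
    have h0 : ∀ y (v : V y), v = 0 := fun y v ↦
      fib_injective (mem_baseSet_trivializationAt (Euc 0) V y) (Subsingleton.elim _ _)
    simp only [h0 _ (X _), h0 _ (Y _), h0 _ (A.bracket X Y x), map_zero, sub_zero]
  · let u : Euc r := stdBasis r ⟨0, hr⟩
    have hu : u ≠ 0 := (stdBasis r).ne_zero _
    obtain ⟨Z, hZ⟩ := exists_section_fib_eq (V := V) (d := d) (c := fun _ ↦ u) hx
      (Eventually.of_forall fun _ ↦ contMDiffAt_const)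
    have hZx : Z x ≠ 0 := by
      intro h0
      apply hu
      rw [← fib_fibSymm (V := V) hx u, ← hZ.self_of_nhds, h0, map_zero]
    let Xh : C^∞⟮𝓡 d, M; 𝓘(ℝ, ℝ), ℝ⟯ := ⟨_, A.contMDiff_vecDeriv h.contMDiff X⟩
    let Yh : C^∞⟮𝓡 d, M; 𝓘(ℝ, ℝ), ℝ⟯ := ⟨_, A.contMDiff_vecDeriv h.contMDiff Y⟩
    have hX : ∀ W, A.bracket X (smulSection h W) = smulSection h (A.bracket X W) +
        smulSection Xh W := fun W ↦ by
      ext y; exact A.leibniz X W h y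
    have hY : ∀ W, A.bracket Y (smulSection h W) = smulSection h (A.bracket Y W) +
        smulSection Yh W := fun W ↦ by
      ext y; exact A.leibniz Y W h y
    -- The Jacobi identity for `X, Y, h Z` minus `h` times the one for `X, Y, Z` is, at `x`, the
    -- defect of the desired identity times the nonzero vector `Z x`.
    have j1 := congrArg (fun W : Cₛ^∞⟮𝓡 d; Euc r, V⟯ ↦ W x) (A.jacobi X Y (smulSection h Z))
    have j2 := congrArg (fun W : Cₛ^∞⟮𝓡 d; Euc r, V⟯ ↦ W x) (A.jacobi X Y Z)
    rw [A.bracket_antisymm (smulSection h Z) X, A.bracket_antisymm (smulSection h Z)] at j1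
    rw [A.bracket_antisymm Z X, A.bracket_antisymm Z] at j2
    rw [hX, hY] at j1
    simp only [map_neg, map_add, hX, hY] at j1
    simp only [map_neg] at j2
    have l1 := A.leibniz (A.bracket X Y) Z h x
    have l2 := A.leibniz X Z Yh x
    have l3 := A.leibniz Y Z Xh x
    simp only [ContMDiffSection.coe_add, ContMDiffSection.coe_neg, Pi.add_apply, Pi.neg_apply, l1,
      l2, l3, ContMDiffSection.coe_zero, Pi.zero_apply] at j1 j2
    have e : ∀ (f : C^∞⟮𝓡 d, M; 𝓘(ℝ, ℝ), ℝ⟯) (W : Cₛ^∞⟮𝓡 d; Euc r, V⟯),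
      smulSection f W x = f x • W x := fun _ _ ↦ rfl
    simp only [e] at j1
    have j3 : (vecDeriv Yh x (A.anchor x (X x)) - vecDeriv Xh x (A.anchor x (Y x))
        - vecDeriv h x (A.anchor x (A.bracket X Y x))) • Z x = 0 := by
      simp only [dirDeriv_eq_vecDeriv] at j1
      linear_combination (norm := module) j1 - h x • j2
    rcases smul_eq_zero.1 j3 with h1 | h1
    · exact (sub_eq_zero.1 h1).symm
    · exact absurd h1 hZx

theorem mem_fiberedDomain (x : M) : x ∈ fiberedDomain d r V x :=
  ⟨mem_chart_source _ _, mem_baseSet_trivializationAt _ _ _⟩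

theorem isOpen_fiberedDomain (x₀ : M) : IsOpen (fiberedDomain d r V x₀) :=
  (chartAt (Euc d) x₀).open_source.inter (trivializationAt (Euc r) V x₀).open_baseSet

theorem isOpen_fiberedRange (x₀ : M) : IsOpen (fiberedRange d r V x₀) := by
  have h : IsOpen ((chartAt (Euc d) x₀).target ∩
      (chartAt (Euc d) x₀).symm ⁻¹' fiberedDomain d r V x₀) :=
    (chartAt (Euc d) x₀).isOpen_inter_preimage_symm (isOpen_fiberedDomain x₀)
  exact h.preimage continuous_fst

theorem contMDiffAt_chart {x₀ x : M} (hx : x ∈ (chartAt (Euc d) x₀).source) :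
    ContMDiffAt (𝓡 d) 𝓘(ℝ, Euc d) ∞ (chartAt (Euc d) x₀) x :=
  contMDiffAt_of_mem_maximalAtlas (IsManifold.chart_mem_maximalAtlas x₀) hx

theorem anchorCoeff_eq {x₀ x : M} (hx : x ∈ fiberedDomain d r V x₀) (i : Fin r) (j : Fin d) :
    A.anchorCoeff x₀ x i j =
      vecDeriv (chartAt (Euc d) x₀) x (A.anchor x (fibSymm r V x₀ x (stdBasis r i))) j := by
  rw [anchorCoeff, localFrame_eq hx.2]
  rfl

theorem anc_eq {x₀ x : M} (hx : x ∈ fiberedDomain d r V x₀) (u : Euc r) :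
    A.anc x₀ x u = vecDeriv (chartAt (Euc d) x₀) x (A.anchor x (fibSymm r V x₀ x u)) := by
  ext j
  rw [anc_apply]
  conv_rhs => rw [← (stdBasis r).sum_repr u]
  simp [map_sum, A.anchorCoeff_eq hx, mul_comm]

theorem anc_fib {x₀ x : M} (hx : x ∈ fiberedDomain d r V x₀) (v : V x) :
    A.anc x₀ x (fib r x₀ x v) = vecDeriv (chartAt (Euc d) x₀) x (A.anchor x v) := by
  rw [A.anc_eq hx, fibSymm_fib hx.2]

theorem contMDiffAt_anchorCoeff {x₀ x : M} (hx : x ∈ fiberedDomain d r V x₀) (i : Fin r)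
    (j : Fin d) : ContMDiffAt (𝓡 d) 𝓘(ℝ, ℝ) ∞ (fun y ↦ A.anchorCoeff x₀ y i j) x := by
  obtain ⟨X, hX⟩ := exists_section_fib_eq (V := V) (d := d) (c := fun _ ↦ stdBasis r i) hx.2
    (Eventually.of_forall fun _ ↦ contMDiffAt_const)
  have h1 := A.contMDiffAt_vecDeriv (F := chartAt (Euc d) x₀) (x := x) (by
    filter_upwards [(chartAt (Euc d) x₀).open_source.mem_nhds hx.1] with y hy
    exact contMDiffAt_chart hy) X
  refine ((EuclideanSpace.proj (𝕜 := ℝ) j : Euc d →L[ℝ] ℝ).contMDiff.contMDiffAt.comp x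
    h1).congr_of_eventuallyEq ?_
  filter_upwards [(isOpen_fiberedDomain x₀).mem_nhds hx, hX] with y hy hXy
  rw [A.anchorCoeff_eq hy, ← hXy]
  rfl

theorem contMDiffAt_bracketCoeff {x₀ x : M} (hx : x ∈ (trivializationAt (Euc r) V x₀).baseSet)
    (i j s : Fin r) : ContMDiffAt (𝓡 d) 𝓘(ℝ, ℝ) ∞ (fun y ↦ A.bracketCoeff x₀ y i j s) x := by
  choose E hE using fun i : Fin r ↦ exists_section_fib_eq (V := V) (d := d)
    (c := fun _ ↦ stdBasis r i) hx (Eventually.of_forall fun _ ↦ contMDiffAt_const)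
  refine ((EuclideanSpace.proj (𝕜 := ℝ) s : Euc r →L[ℝ] ℝ).contMDiff.contMDiffAt.comp x
    (contMDiffAt_fib (A.bracket (E i) (E j)) hx)).congr_of_eventuallyEq ?_
  filter_upwards [(trivializationAt (Euc r) V x₀).open_baseSet.mem_nhds hx,
    (hE i).eventually_nhds, (hE j).eventually_nhds] with y hy h1 h2
  exact A.bracketCoeff_eq hy h1 h2 s

theorem contMDiffAt_anc {x₀ x : M} (hx : x ∈ fiberedDomain d r V x₀) :
    ContMDiffAt (𝓡 d) 𝓘(ℝ, Euc r →L[ℝ] Euc d) ∞ (A.anc x₀) x := by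
  unfold anc
  exact contMDiffAt_finsetSum fun i _ ↦ contMDiffAt_finsetSum fun j _ ↦
    (A.contMDiffAt_anchorCoeff hx i j).smul contMDiffAt_const

theorem contMDiffAt_brk {x₀ x : M} (hx : x ∈ (trivializationAt (Euc r) V x₀).baseSet) :
    ContMDiffAt (𝓡 d) 𝓘(ℝ, Euc r →L[ℝ] Euc r →L[ℝ] Euc r) ∞ (A.brk x₀) x := by
  unfold brk
  exact contMDiffAt_finsetSum fun i _ ↦ contMDiffAt_finsetSum fun j _ ↦
    contMDiffAt_finsetSum fun s _ ↦ (A.contMDiffAt_bracketCoeff hx i j s).smul contMDiffAt_const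

/-- The structure equation which expresses that the anchor preserves brackets. -/
theorem anc_brk {x₀ x : M} (hx : x ∈ fiberedDomain d r V x₀) (u v : Euc r) :
    A.anc x₀ x (A.brk x₀ x u v) =
      vecDeriv (fun y ↦ A.anc x₀ y v) x (A.anchor x (fibSymm r V x₀ x u)) -
      vecDeriv (fun y ↦ A.anc x₀ y u) x (A.anchor x (fibSymm r V x₀ x v)) := by
  obtain ⟨X, hX⟩ := exists_section_fib_eq (V := V) (d := d) (c := fun _ ↦ u) hx.2
    (Eventually.of_forall fun _ ↦ contMDiffAt_const)
  obtain ⟨Y, hY⟩ := exists_section_fib_eq (V := V) (d := d) (c := fun _ ↦ v) hx.2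
    (Eventually.of_forall fun _ ↦ contMDiffAt_const)
  rw [A.brk_eq_single hx.2 u v X Y hX hY, A.anc_fib hx]
  have hD := (isOpen_fiberedDomain x₀).mem_nhds hx
  ext k
  have hp : ∀ (F : M → Euc d), MDifferentiableAt (𝓡 d) 𝓘(ℝ, Euc d) F x →
      ∀ w : TangentSpace (𝓡 d) x, vecDeriv (fun y ↦ F y k) x w = vecDeriv F x w k :=
    fun F hF w ↦ vecDeriv_clm (EuclideanSpace.proj (𝕜 := ℝ) k : Euc d →L[ℝ] ℝ) hF w
  have hp' : ∀ y ∈ fiberedDomain d r V x₀, ∀ w : TangentSpace (𝓡 d) y,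
      vecDeriv (fun y ↦ chartAt (Euc d) x₀ y k) y w = vecDeriv (chartAt (Euc d) x₀) y w k :=
    fun y hy w ↦ vecDeriv_clm (EuclideanSpace.proj (𝕜 := ℝ) k : Euc d →L[ℝ] ℝ)
      ((contMDiffAt_chart hy.1).mdifferentiableAt (by simp)) w
  -- `anchor_bracket` concerns global functions, hence a global function with the germ at `x` of the
  -- `k`-th coordinate.
  obtain ⟨h, hh, hhc⟩ := exists_contMDiff_eventuallyEq (d := d) (x := x)
    (F := fun y ↦ chartAt (Euc d) x₀ y k) (by
      filter_upwards [hD] with y hy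
      exact (EuclideanSpace.proj (𝕜 := ℝ) k : Euc d →L[ℝ] ℝ).contMDiff.contMDiffAt.comp y
        (contMDiffAt_chart hy.1))
  have hanc : ∀ w : Euc r, MDifferentiableAt (𝓡 d) 𝓘(ℝ, Euc d) (fun y ↦ A.anc x₀ y w) x := by
    intro w
    have := (A.contMDiffAt_anc hx).clm_apply (contMDiffAt_const (c := w))
    exact this.mdifferentiableAt (by simp)
  have key : ∀ (Z : Cₛ^∞⟮𝓡 d; Euc r, V⟯) (w : Euc r),
      (∀ᶠ y in 𝓝 x, Z y = fibSymm r V x₀ y w) →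
      (fun y ↦ vecDeriv h y (A.anchor y (Z y))) =ᶠ[𝓝 x] fun y ↦ A.anc x₀ y w k := by
    intro Z w hZ
    filter_upwards [hZ, hhc.eventually_nhds, hD] with y h1 h2 hy
    rw [vecDeriv_congr h2, hp' y hy, h1, A.anc_eq hy]
  have := A.anchor_bracket X Y ⟨h, hh⟩ x
  simp only [ContMDiffMap.coeFn_mk] at this
  rw [vecDeriv_congr hhc, vecDeriv_congr (key X u hX), vecDeriv_congr (key Y v hY),
    hp' x hx, hp _ (hanc u), hp _ (hanc v), hX.self_of_nhds, hY.self_of_nhds] at this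
  exact this

theorem contDiffOn_poisson (x₀ : M) : ContDiffOn ℝ ∞ (A.poisson x₀) (fiberedRange d r V x₀) := by
  have hc : ∀ z ∈ fiberedRange d r V x₀, ContMDiffAt 𝓘(ℝ, Euc d × Euc r) (𝓡 d) ∞
      (fun z : Euc d × Euc r ↦ (chartAt (Euc d) x₀).symm z.1) z := by
    intro z hz
    exact ((contMDiffOn_chart_symm (I := 𝓡 d) (n := ∞) (x := x₀)).contMDiffAt
      ((chartAt (Euc d) x₀).open_target.mem_nhds hz.1)).comp z
      (contDiff_fst.contMDiff.contMDiffAt)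
  have hcoord : ∀ (s : Fin r) z, ContDiffAt ℝ ∞ (fun w : Euc d × Euc r ↦ w.2 s) z := fun s z ↦
    ((EuclideanSpace.proj (𝕜 := ℝ) s : Euc r →L[ℝ] ℝ).contDiff.comp contDiff_snd).contDiffAt
  have ha : ∀ z ∈ fiberedRange d r V x₀, ∀ i j, ContDiffAt ℝ ∞
      (fun z : Euc d × Euc r ↦ A.anchorCoeff x₀ ((chartAt (Euc d) x₀).symm z.1) i j) z := by
    intro z hz i j
    exact ((A.contMDiffAt_anchorCoeff hz.2 i j).comp z (hc z hz)).contDiffAt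
  have hb : ∀ z ∈ fiberedRange d r V x₀, ∀ i j s, ContDiffAt ℝ ∞
      (fun z : Euc d × Euc r ↦ A.bracketCoeff x₀ ((chartAt (Euc d) x₀).symm z.1) i j s) z := by
    intro z hz i j s
    exact ((A.contMDiffAt_bracketCoeff hz.2.2 i j s).comp z (hc z hz)).contDiffAt
  intro z hz
  refine ContDiffAt.contDiffWithinAt ?_
  rw [contDiffAt_pi]
  intro i
  rw [contDiffAt_pi]
  intro j
  rcases i with i | i <;> rcases j with j | j
  · exact ContDiffAt.sum fun s _ ↦ (hb z hz i j s).mul (hcoord s z)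
  · exact ha z hz i j
  · exact (ha z hz j i).neg
  · exact contDiffAt_const

end LieAlgebroid

/-! ### Constancy of the rank of the anchor along leaves. -/

theorem continuous_clm_apply_flip {E F : Type*} [NormedAddCommGroup E] [NormedSpace ℝ E]
    [NormedAddCommGroup F] [NormedSpace ℝ F] :
    Continuous (fun u : E ↦ (ContinuousLinearMap.apply ℝ F u : (E →L[ℝ] F) →L[ℝ] F)) :=
  (ContinuousLinearMap.apply ℝ F).continuous

/-- Along a solution of the linear differential equation `G' = P G + G Q`, the rank does not
increase locally. -/
theorem eventually_finrank_range_le {E F : Type*} [NormedAddCommGroup E] [NormedSpace ℝ E]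
    [FiniteDimensional ℝ E] [NormedAddCommGroup F] [NormedSpace ℝ F] {G : ℝ → E →L[ℝ] F}
    {P : ℝ → F →L[ℝ] F} {Q : ℝ → E →L[ℝ] E} {I : Set ℝ} [I.OrdConnected] {t₀ : ℝ} (ht₀ : t₀ ∈ I)
    (hP : ContinuousAt P t₀) (hQ : ContDiffAt ℝ 1 Q t₀)
    (hG : ∀ᶠ t in 𝓝 t₀, t ∈ I → HasDerivAt G (P t ∘L G t + G t ∘L Q t) t) :
    ∀ᶠ t in 𝓝 t₀, t ∈ I → Module.finrank ℝ (LinearMap.range (G t).toLinearMap) ≤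
      Module.finrank ℝ (LinearMap.range (G t₀).toLinearMap) := by
  -- Let `U` solve `U' = -Q U` with `U t₀ = 1`. Then `(G U)' = P (G U)`, while `G U` and `G` have
  -- the same range as long as `U` is invertible. Time is added as a first component to make the
  -- equation autonomous.
  obtain ⟨α, hα0, ε, hε, hα⟩ :=
    ContDiffAt.exists_forall_mem_closedBall_exists_eq_forall_mem_Ioo_hasDerivAt₀
    (f := fun p : ℝ × (E →L[ℝ] E) ↦ ((1 : ℝ), -(Q p.1 ∘L p.2)))
    (x₀ := (t₀, ContinuousLinearMap.id ℝ E))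
    (contDiffAt_const.prodMk
      ((ContDiffAt.clm_comp (ContDiffAt.comp _ hQ contDiffAt_fst) contDiffAt_snd).neg)) t₀
  have hIoo : Set.Ioo (t₀ - ε) (t₀ + ε) ∈ 𝓝 t₀ := Ioo_mem_nhds (by linarith) (by linarith)
  -- The added component is indeed the time, being a solution of `t' = 1` with value `t₀` at `t₀`.
  have hα1 : Set.EqOn (fun t ↦ (α t).1) id (Set.Ioo (t₀ - ε) (t₀ + ε)) := by
    refine ODE_solution_unique_of_mem_Ioo (v := fun _ _ ↦ (1 : ℝ)) (K := 0)
      (s := fun _ ↦ Set.univ) (fun t _ ↦ LipschitzWith.const' (1 : ℝ) |>.lipschitzOnWith)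
      (t₀ := t₀) ⟨by linarith, by linarith⟩ (fun t ht ↦ ⟨(hα t ht).fst, trivial⟩)
      (fun t _ ↦ ⟨hasDerivAt_id t, trivial⟩) (by simp [hα0])
  set U : ℝ → E →L[ℝ] E := fun t ↦ (α t).2 with hU
  have hU' : ∀ t ∈ Set.Ioo (t₀ - ε) (t₀ + ε), HasDerivAt U (-(Q t ∘L U t)) t := by
    intro t ht
    have h1 := (hα t ht).snd
    have h2 : (α t).1 = t := hα1 ht
    rwa [h2] at h1
  have hU0 : U t₀ = 1 := by simp [hU, hα0]; rfl
  have hUunit : ∀ᶠ t in 𝓝 t₀, IsUnit (U t) := by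
    have : {f : E →L[ℝ] E | IsUnit f} ∈ 𝓝 (U t₀) := by
      rw [hU0]
      exact Units.isOpen.mem_nhds isUnit_one
    exact (hU' t₀ (mem_of_mem_nhds hIoo)).continuousAt this
  have hPb : ∀ᶠ t in 𝓝 t₀, ‖P t‖ ≤ ‖P t₀‖ + 1 :=
    (hP.norm.eventually_lt continuousAt_const (by simp)).mono fun _ h ↦ h.le
  obtain ⟨δ, hδ, hball⟩ := Metric.eventually_nhds_iff_ball.1 (hG.and (hPb.and hIoo))
  filter_upwards [hUunit, Metric.ball_mem_nhds t₀ hδ] with t htU htδ htI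
  have hseg : ∀ τ ∈ Set.uIcc t₀ t, HasDerivAt (fun τ ↦ G τ ∘L U τ) (P τ ∘L (G τ ∘L U τ)) τ ∧
      ‖P τ‖ ≤ ‖P t₀‖ + 1 := by
    intro τ hτ
    have hτI : τ ∈ I := Set.OrdConnected.uIcc_subset ‹_› ht₀ htI hτ
    have hτδ : τ ∈ Metric.ball t₀ δ :=
      (convex_ball t₀ δ).ordConnected.uIcc_subset (Metric.mem_ball_self hδ) htδ hτ
    obtain ⟨h1, h2, h3⟩ := hball τ hτδ
    refine ⟨?_, h2⟩
    convert! (h1 hτI).clm_comp (hU' τ h3) using 1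
    ext v
    simp
  -- For fixed `v`, the curve `(G U) v` solves `w' = P w`; if it vanishes at `t₀`, uniqueness makes
  -- it vanish up to `t`. The kernel can only grow, so the rank can only drop.
  have hker : LinearMap.ker (G t₀).toLinearMap ≤ LinearMap.ker (G t ∘L U t).toLinearMap := by
    intro v hv
    have hv0 : (G t₀ ∘L U t₀) v = 0 := by
      rw [hU0]
      exact hv
    have hw : ∀ τ ∈ Set.uIcc t₀ t, HasDerivAt (fun τ ↦ (G τ ∘L U τ) v) (P τ ((G τ ∘L U τ) v)) τ := by
      intro τ hτ
      have := (hseg τ hτ).1.clm_apply (hasDerivAt_const τ v)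
      simpa using this
    have hLip : ∀ τ ∈ Set.uIcc t₀ t, LipschitzOnWith (⟨‖P t₀‖ + 1, by positivity⟩ : NNReal)
        (P τ) Set.univ := fun τ hτ ↦
      ((P τ).lipschitz.weaken (by exact (hseg τ hτ).2)).lipschitzOnWith
    have hc : ContinuousOn (fun τ ↦ (G τ ∘L U τ) v) (Set.uIcc t₀ t) :=
      fun τ hτ ↦ (hw τ hτ).continuousAt.continuousWithinAt
    show (G t ∘L U t) v = 0
    rcases le_total t₀ t with h | h
    · rw [Set.uIcc_of_le h] at hw hLip hc
      exact ODE_solution_unique_of_mem_Icc_right (v := fun τ ↦ P τ) (s := fun _ ↦ Set.univ)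
        (g := fun _ ↦ 0)
        (fun τ hτ ↦ hLip τ (Set.Ico_subset_Icc_self hτ)) hc
        (fun τ hτ ↦ (hw τ (Set.Ico_subset_Icc_self hτ)).hasDerivWithinAt) (fun _ _ ↦ trivial)
        continuousOn_const (fun τ _ ↦ by simpa using (hasDerivAt_const τ (0 : F)).hasDerivWithinAt)
        (fun _ _ ↦ trivial) hv0 (Set.right_mem_Icc.2 h)
    · rw [Set.uIcc_of_ge h] at hw hLip hc
      exact ODE_solution_unique_of_mem_Icc_left (v := fun τ ↦ P τ) (s := fun _ ↦ Set.univ)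
        (g := fun _ ↦ 0)
        (fun τ hτ ↦ hLip τ (Set.Ioc_subset_Icc_self hτ)) hc
        (fun τ hτ ↦ (hw τ (Set.Ioc_subset_Icc_self hτ)).hasDerivWithinAt) (fun _ _ ↦ trivial)
        continuousOn_const (fun τ _ ↦ by simpa using (hasDerivAt_const τ (0 : F)).hasDerivWithinAt)
        (fun _ _ ↦ trivial) hv0 (Set.left_mem_Icc.2 h)
  have hrange : LinearMap.range (G t ∘L U t).toLinearMap = LinearMap.range (G t).toLinearMap := by
    obtain ⟨u, hu⟩ := htU
    have hsurj : Function.Surjective (U t) := fun w ↦ ⟨(↑u⁻¹ : E →L[ℝ] E) w, by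
      rw [← hu, ← mul_apply_eq_comp, Units.mul_inv]; rfl⟩
    exact LinearMap.range_comp_of_range_eq_top _ (LinearMap.range_eq_top.2 hsurj)
  have h1 := (G t ∘L U t).toLinearMap.finrank_range_add_finrank_ker
  have h2 := (G t₀).toLinearMap.finrank_range_add_finrank_ker
  have h3 := Submodule.finrank_mono hker
  rw [hrange] at h1
  omega

/-- Semicontinuity of the rank supplies the inequality opposite to that of
`eventually_finrank_range_le`. -/
theorem eventually_le_finrank_range {E F X : Type*} [NormedAddCommGroup E] [NormedSpace ℝ E]
    [FiniteDimensional ℝ E] [NormedAddCommGroup F] [NormedSpace ℝ F] [FiniteDimensional ℝ F]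
    [TopologicalSpace X] {G : X → E →L[ℝ] F} {t₀ : X} (hG : ContinuousAt G t₀) :
    ∀ᶠ t in 𝓝 t₀, Module.finrank ℝ (LinearMap.range (G t₀).toLinearMap) ≤
      Module.finrank ℝ (LinearMap.range (G t).toLinearMap) := by
  have h := (isOpen_setOfPred_nat_le_rank (𝕜 := ℝ) (E := E) (F := F)
    (Module.finrank ℝ (LinearMap.range (G t₀).toLinearMap)))
  have key : ∀ f : E →L[ℝ] F, ∀ n : ℕ, (n : Cardinal) ≤ f.toLinearMap.rank ↔
      n ≤ Module.finrank ℝ (LinearMap.range f.toLinearMap) := by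
    intro f n
    rw [LinearMap.rank, ← Module.finrank_eq_rank]
    exact Nat.cast_le
  have hm : G t₀ ∈ {f : E →L[ℝ] F |
      ((Module.finrank ℝ (LinearMap.range (G t₀).toLinearMap) : ℕ) : Cardinal) ≤
        f.toLinearMap.rank} := (key _ _).2 le_rfl
  filter_upwards [hG (h.mem_nhds hm)] with t ht using (key _ _).1 ht

namespace LieAlgebroid

variable {d r : ℕ} {M : Type*} [TopologicalSpace M] [ChartedSpace (Euc d) M]
  {V : M → Type*} [TopologicalSpace (TotalSpace (Euc r) V)]
  [∀ x, AddCommGroup (V x)] [∀ x, Module ℝ (V x)] [∀ x, TopologicalSpace (V x)]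
  [FiberBundle (Euc r) V] [VectorBundle ℝ (Euc r) V]
  [T2Space M] [IsManifold (𝓡 d) ∞ M] [ContMDiffVectorBundle ∞ (Euc r) V (𝓡 d)]
  (A : LieAlgebroid d r M V)



theorem _root_.AlgebroidStability.vecDeriv_eq_fderiv_chart {E : Type*} [NormedAddCommGroup E]
    [NormedSpace ℝ E] {F : M → E} {x₀ x : M} (hx : x ∈ (chartAt (Euc d) x₀).source)
    (hF : MDifferentiableAt (𝓡 d) 𝓘(ℝ, E) F x) (w : TangentSpace (𝓡 d) x) :
    vecDeriv F x w = fderiv ℝ (F ∘ (chartAt (Euc d) x₀).symm) (chartAt (Euc d) x₀ x)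
      (vecDeriv (chartAt (Euc d) x₀) x w) := by
  have hs : MDifferentiableAt 𝓘(ℝ, Euc d) (𝓡 d) (chartAt (Euc d) x₀).symm (chartAt (Euc d) x₀ x) :=
    mdifferentiableAt_atlas_symm (chart_mem_atlas _ _) ((chartAt (Euc d) x₀).map_source hx)
  have hFs : MDifferentiableAt 𝓘(ℝ, Euc d) 𝓘(ℝ, E) (F ∘ (chartAt (Euc d) x₀).symm)
      (chartAt (Euc d) x₀ x) := by
    refine MDifferentiableAt.comp _ ?_ hs
    rwa [(chartAt (Euc d) x₀).left_inv hx]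
  rw [← vecDeriv_comp (Φ := F ∘ (chartAt (Euc d) x₀).symm) hFs.differentiableAt
    ((contMDiffAt_chart hx).mdifferentiableAt (by simp))]
  congr 1
  apply vecDeriv_congr
  filter_upwards [(chartAt (Euc d) x₀).open_source.mem_nhds hx] with y hy
  simp [(chartAt (Euc d) x₀).left_inv hy]

theorem _root_.AlgebroidStability.vecDeriv_chart_injective {x₀ x : M}
    (hx : x ∈ (chartAt (Euc d) x₀).source) :
    Function.Injective (vecDeriv (d := d) (chartAt (Euc d) x₀) x) := by
  intro v w h
  exact ((isInvertible_mfderiv_extChartAt (I := 𝓡 d) (by simpa using hx)).injective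
    (show mfderiv (𝓡 d) 𝓘(ℝ, Euc d) (extChartAt (𝓡 d) x₀) x v = _ by simpa using! h))

theorem _root_.AlgebroidStability.vecDeriv_chart_surjective {x₀ x : M}
    (hx : x ∈ (chartAt (Euc d) x₀).source) :
    Function.Surjective (vecDeriv (d := d) (chartAt (Euc d) x₀) x) := by
  intro w
  obtain ⟨v, hv⟩ := (isInvertible_mfderiv_extChartAt (I := 𝓡 d) (x := x₀) (y := x)
    (by simpa using hx)).surjective w
  exact ⟨v, by simpa using! hv⟩

theorem finrank_range_anc {x₀ x : M} (hx : x ∈ fiberedDomain d r V x₀) :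
    Module.finrank ℝ (LinearMap.range (A.anc x₀ x).toLinearMap) =
      Module.finrank ℝ (LinearMap.range (A.anchor x)) := by
  have h : (A.anc x₀ x).toLinearMap =
      (vecDeriv (chartAt (Euc d) x₀) x ∘ₗ A.anchor x) ∘ₗ fibSymm r V x₀ x := by
    ext1 u
    exact A.anc_eq hx u
  have hs : LinearMap.range (fibSymm r V x₀ x) = ⊤ :=
    LinearMap.range_eq_top.2 fun v ↦ ⟨fib r x₀ x v, fibSymm_fib hx.2 v⟩
  rw [h, LinearMap.range_comp_of_range_eq_top _ hs, LinearMap.range_comp]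
  exact (Submodule.equivMapOfInjective _ (vecDeriv_chart_injective hx.1) _).finrank_eq.symm

/-- The rank of the anchor is constant along the paths of the algebroid. -/
theorem finrank_anchor_eq_of_joinedByPath {x y : M} (h : A.JoinedByPath x y) :
    Module.finrank ℝ (LinearMap.range (A.anchor x)) =
      Module.finrank ℝ (LinearMap.range (A.anchor y)) := by
  obtain ⟨a, ha, hγ, h0, h1⟩ := h
  set γ : ℝ → M := fun t ↦ (a t).proj with hγdef
  have hγs : ContMDiff 𝓘(ℝ, ℝ) (𝓡 d) ∞ γ := (contMDiff_proj V).comp ha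
  set ρ : ℝ → ℕ := fun t ↦ Module.finrank ℝ (LinearMap.range (A.anchor (γ t))) with hρ
  have hloc : ∀ t₀ ∈ Set.Icc (0 : ℝ) 1, ∀ᶠ t in 𝓝[Set.Icc 0 1] t₀, ρ t = ρ t₀ := by
    intro t₀ ht₀
    set x₀ := γ t₀
    set c := chartAt (Euc d) x₀
    set G : ℝ → Euc r →L[ℝ] Euc d := fun t ↦ A.anc x₀ (γ t) with hG
    set u : ℝ → Euc r := fun t ↦ fib r x₀ (γ t) (a t).snd with hu
    have hdom : ∀ᶠ t in 𝓝 t₀, γ t ∈ fiberedDomain d r V x₀ :=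
      hγs.continuous.continuousAt.eventually_mem
        ((isOpen_fiberedDomain x₀).mem_nhds (mem_fiberedDomain x₀))
    have hx₀ := mem_fiberedDomain (d := d) (r := r) (V := V) x₀
    have hus : ContMDiffAt 𝓘(ℝ, ℝ) 𝓘(ℝ, Euc r) ∞ u t₀ := by
      have h2 := ((trivializationAt (Euc r) V x₀).contMDiffAt_iff (IB := 𝓡 d) (IM := 𝓘(ℝ, ℝ)) (n := ∞)
        (f := a) (x₀ := t₀) (by
          rw [Trivialization.mem_source]; exact hx₀.2)).1 ha.contMDiffAt
      refine h2.2.congr_of_eventuallyEq ?_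
      filter_upwards [hdom] with t ht
      exact fib_apply ht.2 _
    have hGs : ContMDiffAt 𝓘(ℝ, ℝ) 𝓘(ℝ, Euc r →L[ℝ] Euc d) ∞ G t₀ :=
      ContMDiffAt.comp (g := A.anc x₀) (f := γ) (I' := 𝓡 d) t₀ (A.contMDiffAt_anc hx₀) hγs.contMDiffAt
    set D : Euc d → Euc d →L[ℝ] Euc r →L[ℝ] Euc d := fderiv ℝ (A.anc x₀ ∘ c.symm) with hD
    have hDs : ContDiffAt ℝ ∞ (A.anc x₀ ∘ c.symm) (c x₀) := by
      refine ContMDiffAt.contDiffAt (ContMDiffAt.comp (I' := 𝓡 d) _ ?_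
        ((contMDiffOn_chart_symm (I := 𝓡 d) (n := ∞) (x := x₀)).contMDiffAt
        (c.open_target.mem_nhds (c.map_source hx₀.1))))
      rw [c.left_inv hx₀.1]
      exact A.contMDiffAt_anc hx₀
    -- With `u` the coordinates of the path, `anc_brk` for `u t` and `v` says that the derivative of
    -- `G v` along the path is `G (brk u v)` plus the derivative of `anc` in the direction `G v`,
    -- applied to `u`. These two terms are `G Q v` and `P G v`.
    set P : ℝ → Euc d →L[ℝ] Euc d := fun t ↦
      (ContinuousLinearMap.apply ℝ (Euc d) (u t)) ∘L (D (c (γ t))) with hP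
    set Q : ℝ → Euc r →L[ℝ] Euc r := fun t ↦ A.brk x₀ (γ t) (u t) with hQ
    have hPc : ContinuousAt P t₀ := by
      have h2 : ContinuousAt (fun t ↦ D (c (γ t))) t₀ :=
        ContinuousAt.comp (g := D) (f := fun t ↦ c (γ t))
          (hDs.fderiv_right (m := ∞) (by simp)).continuousAt
          ((c.continuousAt hx₀.1).comp (f := γ) hγs.continuous.continuousAt)
      exact ((continuous_clm_apply_flip (E := Euc r) (F := Euc d)).continuousAt.comp
        hus.continuousAt).clm_comp h2
    have hQs : ContDiffAt ℝ 1 Q t₀ := by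
      have h2 : ContMDiffAt 𝓘(ℝ, ℝ) 𝓘(ℝ, Euc r →L[ℝ] Euc r) ∞ Q t₀ :=
        (ContMDiffAt.comp (g := A.brk x₀) (f := γ) (I' := 𝓡 d) t₀ (A.contMDiffAt_brk hx₀.2)
          hγs.contMDiffAt).clm_apply hus
      exact h2.contDiffAt.of_le (by exact_mod_cast le_top)
    have hGd : ∀ᶠ t in 𝓝 t₀, t ∈ Set.Icc (0 : ℝ) 1 →
        HasDerivAt G (P t ∘L G t + G t ∘L Q t) t := by
      filter_upwards [hdom] with t ht htI
      have hanc := (A.contMDiffAt_anc ht).mdifferentiableAt (by simp)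
      have h1 : HasFDerivAt G ((show TangentSpace (𝓡 d) (γ t) →L[ℝ] (Euc r →L[ℝ] Euc d) from
          mfderiv (𝓡 d) 𝓘(ℝ, Euc r →L[ℝ] Euc d) (A.anc x₀) (γ t)).comp
          (show ℝ →L[ℝ] TangentSpace (𝓡 d) (γ t) from
            ContinuousLinearMap.toSpanSingleton ℝ (A.anchor (a t).proj (a t).snd))) t :=
        HasMFDerivAt.hasFDerivAt (HasMFDerivAt.comp (g := A.anc x₀) (f := γ) (I' := 𝓡 d) t hanc.hasMFDerivAt (hγ t htI))
      have h2 := HasFDerivAt.hasDerivAt (F := Euc r →L[ℝ] Euc d) h1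
      convert! h2 using 1
      ext1 v
      have hat : (a t).snd = fibSymm r V x₀ (γ t) (u t) := (fibSymm_fib ht.2 _).symm
      have e1 : ∀ w : Euc r, ∀ η : TangentSpace (𝓡 d) (γ t),
          vecDeriv (fun y ↦ A.anc x₀ y w) (γ t) η = vecDeriv (A.anc x₀) (γ t) η w := fun w η ↦
        vecDeriv_clm (ContinuousLinearMap.apply ℝ (Euc d) w) hanc η
      have e2 := A.anc_brk ht (u t) v
      rw [e1, e1, ← hat, vecDeriv_eq_fderiv_chart ht.1 hanc (A.anchor _ (fibSymm r V x₀ (γ t) v)),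
        ← A.anc_eq ht] at e2
      have e3 : (P t ∘L G t + G t ∘L Q t) v =
        D (c (γ t)) (A.anc x₀ (γ t) v) (u t) + A.anc x₀ (γ t) (A.brk x₀ (γ t) (u t) v) := rfl
      rw [e3, e2, hD, add_sub_cancel]
      show _ = (vecDeriv (A.anc x₀) (γ t) ((1 : ℝ) • A.anchor (γ t) (a t).snd)) v
      rw [one_smul]
    have hle := eventually_finrank_range_le ht₀ hPc hQs hGd
    have hge := eventually_le_finrank_range hGs.continuousAt
    have e0 : ∀ t, γ t ∈ fiberedDomain d r V x₀ →
      Module.finrank ℝ (LinearMap.range (G t).toLinearMap) = ρ t := fun t ht ↦ A.finrank_range_anc ht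
    rw [eventually_nhdsWithin_iff]
    filter_upwards [hle, hge, hdom] with t h2 h3 h4 ht
    rw [← e0 t h4, ← e0 t₀ hx₀]
    exact le_antisymm (h2 ht) h3
  have hconst : ρ 0 = ρ 1 := by
    refine isPreconnected_Icc.constant (s := Set.Icc (0 : ℝ) 1) (f := ρ) (fun t ht ↦ ?_) (by simp)
      (by simp)
    exact continuousWithinAt_const.congr_of_eventuallyEq (hloc t ht) rfl
  rw [← h0, ← h1]
  exact hconst

theorem isLeafOfDim_leaf (x : M) :
    A.IsLeafOfDim (A.leaf x) (Module.finrank ℝ (LinearMap.range (A.anchor x))) := by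
  refine ⟨⟨x, rfl⟩, fun y hy ↦ ?_⟩
  induction hy with
  | refl => rfl
  | tail _ h ih => rw [← A.finrank_anchor_eq_of_joinedByPath h, ih]

end LieAlgebroid

/-- A linear map between Euclidean spaces as a continuous linear map. -/
abbrev toCLM {a b : ℕ} (L : Euc a →ₗ[ℝ] Euc b) : Euc a →L[ℝ] Euc b :=
  LinearMap.toContinuousLinearMap L

theorem contDiffAt_toCLM {a b : ℕ} {E : Type*} [NormedAddCommGroup E] [NormedSpace ℝ E]
    {L : E → Euc a →ₗ[ℝ] Euc b} {z : E} (h : ∀ u, ContDiffAt ℝ ∞ (fun w ↦ L w u) z) :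
    ContDiffAt ℝ ∞ (fun w ↦ toCLM (L w)) z := by
  have e : (fun w ↦ toCLM (L w)) = fun w ↦ ∑ i : Fin a,
      (ContinuousLinearMap.smulRightL ℝ (Euc a) (Euc b)
        (EuclideanSpace.proj (𝕜 := ℝ) i : Euc a →L[ℝ] ℝ)) (L w (stdBasis a i)) := by
    ext1 w
    ext1 u
    rw [_root_.sum_apply]
    show L w u = ∑ i, u i • L w (stdBasis a i)
    conv_lhs => rw [← (stdBasis a).sum_repr u]
    simp [map_sum]
  rw [e]
  exact ContDiffAt.sum fun i _ ↦
    (ContinuousLinearMap.contDiff _).contDiffAt.comp z (h (stdBasis a i))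

/-! ### Embedded discs: retractions, extension of sections, smooth left inverses. -/

section Immersion

variable {d q : ℕ} {M : Type*} [TopologicalSpace M] [ChartedSpace (Euc d) M]
  {ι : Euc q → M} (hι : IsSmoothEmbedding (𝓡 q) (𝓡 d) ∞ ι)
include hι

/-- A smooth embedding has a smooth left inverse near each of its points. -/
theorem exists_local_retraction (z₀ : Euc q) :
    ∃ (O : Set M) (κ : M → Euc q), IsOpen O ∧ ι z₀ ∈ O ∧
      ContMDiffOn (𝓡 d) 𝓘(ℝ, Euc q) ∞ κ O ∧ ∀ z, ι z ∈ O → κ (ι z) = z := by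
  have h := hι.isImmersion.isImmersionAt z₀
  set φ := h.domChart
  set ψ := h.codChart
  -- As `ι` is a topological embedding, the chart domain is the preimage of an open set of `M`. This
  -- prevents distant parts of the disc from coming back near `ι z₀`.
  obtain ⟨O', hO', hφO'⟩ := hι.isEmbedding.isInducing.isOpen_iff.1 φ.open_source
  let f : Euc d → Euc q := fun y ↦ (h.equiv.symm y).1
  have hf : ContDiff ℝ ∞ f := contDiff_fst.comp h.equiv.symm.contDiff
  -- In charts adapted to the immersion, `ι` is `x ↦ (x, 0)`, so the projection to the first factor
  -- inverts it.
  have hkey : ∀ z ∈ φ.source, f (ψ (ι z)) = φ z := by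
    intro z hz
    have h0 : φ z ∈ (h.domChart.extend (𝓡 q)).target := by simpa [φ] using φ.map_source hz
    have h1 := h.writtenInCharts h0
    have h2 : ψ (ι z) = h.equiv (φ z, 0) := by
      have h3 : φ.symm (φ z) = z := φ.left_inv hz
      simpa [h3, φ, ψ] using! h1
    simp [f, h2]
  refine ⟨O' ∩ (ψ.source ∩ ψ ⁻¹' (f ⁻¹' φ.target)), fun x ↦ φ.symm (f (ψ x)), ?_, ?_, ?_, ?_⟩
  · exact hO'.inter (ψ.isOpen_inter_preimage (φ.open_target.preimage hf.continuous))
  · have hz₀ : z₀ ∈ φ.source := h.mem_domChart_source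
    refine ⟨?_, h.mem_codChart_source, ?_⟩
    · rw [← hφO'] at hz₀; exact hz₀
    · show f (ψ (ι z₀)) ∈ φ.target
      rw [hkey z₀ hz₀]
      exact φ.map_source hz₀
  · intro x hx
    have h1 : ContMDiffAt (𝓡 d) 𝓘(ℝ, Euc d) ∞ ψ x :=
      contMDiffAt_of_mem_maximalAtlas h.codChart_mem_maximalAtlas hx.2.1
    have h2 : ContMDiffAt (𝓡 d) 𝓘(ℝ, Euc q) ∞ (fun x ↦ f (ψ x)) x :=
      hf.contMDiff.contMDiffAt.comp x h1
    have h3 : ContMDiffAt 𝓘(ℝ, Euc q) 𝓘(ℝ, Euc q) ∞ φ.symm (f (ψ x)) :=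
      contMDiffAt_symm_of_mem_maximalAtlas h.domChart_mem_maximalAtlas hx.2.2
    exact (h3.comp x h2).contMDiffWithinAt
  · intro z hz
    have hz' : z ∈ φ.source := by rw [← hφO']; exact hz.1
    show φ.symm (f (ψ (ι z))) = z
    rw [hkey z hz', φ.left_inv hz']

theorem contMDiff_of_isSmoothEmbedding : ContMDiff 𝓘(ℝ, Euc q) (𝓡 d) ∞ ι :=
  hι.isImmersion.contMDiff

/-- Differentiate `κ ∘ ι = id` for a local retraction `κ`. -/
theorem mfderiv_injective (z : Euc q) :
    Function.Injective (mfderiv (𝓡 q) (𝓡 d) ι z) := by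
  obtain ⟨O, κ, hO, hzO, hκ, hκι⟩ := exists_local_retraction hι z
  have h1 : MDifferentiableAt (𝓡 q) (𝓡 d) ι z :=
    (contMDiff_of_isSmoothEmbedding hι).mdifferentiableAt (by simp)
  have h2 : MDifferentiableAt (𝓡 d) 𝓘(ℝ, Euc q) κ (ι z) :=
    (hκ.contMDiffAt (hO.mem_nhds hzO)).mdifferentiableAt (by simp)
  have h3 : ∀ ξ, vecDeriv κ (ι z) (mfderiv (𝓡 q) (𝓡 d) ι z ξ) = ξ := by
    intro ξ
    rw [← vecDeriv_comp_left h2 h1, vecDeriv_congr (G := id)]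
    · exact (vecDeriv_eq_fderiv id z ξ).trans (by rw [fderiv_id]; rfl)
    · filter_upwards [(contMDiff_of_isSmoothEmbedding hι).continuous.continuousAt
        (hO.mem_nhds hzO)] with w hw using hκι w hw
  exact Function.LeftInverse.injective h3

variable [T2Space M] [IsManifold (𝓡 d) ∞ M] {r : ℕ}
  {V : M → Type*} [TopologicalSpace (TotalSpace (Euc r) V)]
  [∀ x, AddCommGroup (V x)] [∀ x, Module ℝ (V x)] [∀ x, TopologicalSpace (V x)]
  [FiberBundle (Euc r) V] [VectorBundle ℝ (Euc r) V] [ContMDiffVectorBundle ∞ (Euc r) V (𝓡 d)]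

/-- A section of `V` along an embedded submanifold extends, after multiplication by a bump
function, to a global section. -/
theorem exists_section_extension {x₀ : M} {z₀ : Euc q}
    (hz₀ : ι z₀ ∈ (trivializationAt (Euc r) V x₀).baseSet) {c : Euc q → Euc r}
    (hc : ∀ᶠ z in 𝓝 z₀, ContDiffAt ℝ ∞ c z) :
    ∃ (ψ : M → ℝ) (X : Cₛ^∞⟮𝓡 d; Euc r, V⟯), ContMDiff (𝓡 d) 𝓘(ℝ, ℝ) ∞ ψ ∧
      (∀ᶠ x in 𝓝 (ι z₀), ψ x = 1) ∧
      (∀ x, ψ x ≠ 0 → x ∈ (trivializationAt (Euc r) V x₀).baseSet) ∧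
      ∀ z, X (ι z) = ψ (ι z) • fibSymm r V x₀ (ι z) (c z) := by
  set e := trivializationAt (Euc r) V x₀
  obtain ⟨O, κ, hO, hzO, hκ, hκι⟩ := exists_local_retraction hι z₀
  obtain ⟨P, hP, hPo, hzP⟩ := eventually_nhds_iff.1 hc
  have hU : IsOpen (O ∩ κ ⁻¹' P) := hκ.continuousOn.isOpen_inter_preimage hO hPo
  have hzU : ι z₀ ∈ O ∩ κ ⁻¹' P := ⟨hzO, by
    show κ (ι z₀) ∈ P
    rwa [hκι z₀ hzO]⟩
  obtain ⟨f, -, hf⟩ := (SmoothBumpFunction.nhds_basis_tsupport (I := 𝓡 d) (ι z₀)).mem_iff.1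
    ((hU.inter e.open_baseSet).mem_nhds ⟨hzU, hz₀⟩)
  have hs : ContMDiffOn (𝓡 d) ((𝓡 d).prod 𝓘(ℝ, Euc r)) ∞
      (fun y ↦ TotalSpace.mk' (Euc r) y (fibSymm r V x₀ y (c (κ y))))
      ((O ∩ κ ⁻¹' P) ∩ e.baseSet) := by
    rw [e.contMDiffOn_section_iff (hU.inter e.open_baseSet) Set.inter_subset_right]
    intro y hy
    have h1 : ContMDiffAt (𝓡 d) 𝓘(ℝ, Euc r) ∞ (fun y ↦ c (κ y)) y :=
      (hP _ hy.1.2).contMDiffAt.comp y (hκ.contMDiffAt (hO.mem_nhds hy.1.1))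
    refine (h1.congr_of_eventuallyEq ?_).contMDiffWithinAt
    filter_upwards [e.open_baseSet.mem_nhds hy.2] with w hw
    rw [← fib_apply hw, fib_fibSymm hw]
  refine ⟨f, ⟨_, ContMDiffOn.smul_section_of_tsupport (f.contMDiff.contMDiffOn)
    (hU.inter e.open_baseSet) hf hs⟩, f.contMDiff, f.eventuallyEq_one,
    fun x hx ↦ (hf (subset_tsupport f hx)).2, fun z ↦ ?_⟩
  show f (ι z) • fibSymm r V x₀ (ι z) (c (κ (ι z))) = _
  -- Where the bump function is nonzero, `κ` is a left inverse of `ι`; elsewhere both sides vanish,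
  -- whatever `κ` is.
  by_cases hz : f (ι z) = 0
  · simp [hz]
  · rw [hκι z (hf (subset_tsupport f hz)).1.1]

/-- A smooth injective bundle map over an embedding has a smooth fiberwise left inverse. -/
theorem exists_smooth_leftInverse {l : ℕ} (J : ∀ z, Euc l →ₗ[ℝ] V (ι z))
    (hJ : ∀ x₀ z, ι z ∈ (trivializationAt (Euc r) V x₀).baseSet →
      ContDiffAt ℝ ∞ (fun z ↦ toCLM (fib r x₀ (ι z) ∘ₗ J z)) z)
    (hinj : ∀ z, Function.Injective (J z)) :
    ∃ lam : ∀ z, V (ι z) →ₗ[ℝ] Euc l, (∀ z u, lam z (J z u) = u) ∧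
      ∀ x₀ z, ι z ∈ (trivializationAt (Euc r) V x₀).baseSet →
        ContDiffAt ℝ ∞ (fun z ↦ toCLM (lam z ∘ₗ fibSymm r V x₀ (ι z))) z := by
  have hιc := (contMDiff_of_isSmoothEmbedding hι).continuous
  set T : Euc q → Euc q → Euc l →L[ℝ] Euc r := fun i z ↦ toCLM (fib r (ι i) (ι z) ∘ₗ J z) with hT
  have hbase : ∀ i, ι i ∈ (trivializationAt (Euc r) V (ι i)).baseSet := fun i ↦
    mem_baseSet_trivializationAt _ _ _
  have hS : ∀ i, ∃ S : Euc r →L[ℝ] Euc l, S ∘L T i i = 1 := by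
    intro i
    obtain ⟨S, hS⟩ := (fib r (ι i) (ι i) ∘ₗ J i).exists_leftInverse_of_injective
      (LinearMap.ker_eq_bot.2 ((fib_injective (hbase i)).comp (hinj i)))
    exact ⟨toCLM S, by ext1 u; exact LinearMap.congr_fun hS u⟩
  choose S hS using hS
  have hTs : ∀ i z, ι z ∈ (trivializationAt (Euc r) V (ι i)).baseSet → ContDiffAt ℝ ∞ (T i) z :=
    fun i z ↦ hJ (ι i) z
  set Uo : Euc q → Set (Euc q) := fun i ↦
    {z | ι z ∈ (trivializationAt (Euc r) V (ι i)).baseSet ∧ IsUnit (S i ∘L T i z)} with hUo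
  have hUn : ∀ i, ∀ z ∈ Uo i, Uo i ∈ 𝓝 z := by
    intro i z hz
    have h1 : ContinuousAt (fun z ↦ S i ∘L T i z) z :=
      continuousAt_const.clm_comp (hTs i z hz.1).continuousAt
    filter_upwards [h1 (Units.isOpen.mem_nhds hz.2), hιc.continuousAt
      ((trivializationAt (Euc r) V (ι i)).open_baseSet.mem_nhds hz.1)] with w hw1 hw2
    exact ⟨hw2, hw1⟩
  have hUopen : ∀ i, IsOpen (Uo i) := fun i ↦ isOpen_iff_mem_nhds.2 (hUn i)
  have hUi : ∀ i, i ∈ Uo i := fun i ↦ ⟨hbase i, by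
    show IsUnit (S i ∘L T i i)
    rw [hS i]; exact isUnit_one⟩
  obtain ⟨ρ, hρ⟩ := SmoothPartitionOfUnity.exists_isSubordinate (𝓡 q) isClosed_univ Uo hUopen
    (fun i _ ↦ Set.mem_iUnion.2 ⟨i, hUi i⟩)
  -- If `S T` is invertible then `(S T)⁻¹ S` is a left inverse of `T`. This holds near the index
  -- point `i`, where `S T = 1`.
  set lamᵢ : ∀ _ z : Euc q, V (ι z) →ₗ[ℝ] Euc l := fun i z ↦
    (Ring.inverse (S i ∘L T i z) ∘L S i).toLinearMap ∘ₗ fib r (ι i) (ι z) with hlamᵢ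
  have hinv : ∀ i z u, z ∈ Uo i → lamᵢ i z (J z u) = u := by
    intro i z u hz
    have := Ring.inverse_mul_cancel _ hz.2
    exact congrArg (fun L : Euc l →L[ℝ] Euc l ↦ L u) this
  have hlams : ∀ i z x₀, z ∈ Uo i → ι z ∈ (trivializationAt (Euc r) V x₀).baseSet → ∀ u,
      ContDiffAt ℝ ∞ (fun z ↦ lamᵢ i z (fibSymm r V x₀ (ι z) u)) z := by
    intro i z x₀ hz hx₀ u
    -- The constant coordinate vector `u` is extended to a global section, whose coordinates in the
    -- other trivialization are known to be smooth.
    obtain ⟨X, hX⟩ := exists_section_fib_eq (V := V) (d := d) (c := fun _ ↦ u) hx₀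
      (Eventually.of_forall fun _ ↦ contMDiffAt_const)
    have h1 : ContDiffAt ℝ ∞ (fun z ↦ fib r (ι i) (ι z) (X (ι z))) z :=
      ((contMDiffAt_fib X hz.1).comp z (contMDiff_of_isSmoothEmbedding hι).contMDiffAt).contDiffAt
    have h2 : ContDiffAt ℝ ∞ (fun z ↦ Ring.inverse (S i ∘L T i z)) z := by
      obtain ⟨w, hw⟩ := hz.2
      have h3 : ContDiffAt ℝ ∞ Ring.inverse (S i ∘L T i z) := by
        rw [← hw]
        exact contDiffAt_ringInverse ℝ w
      exact h3.comp z (contDiffAt_const.clm_comp (hTs i z hz.1))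
    have h3 : ContDiffAt ℝ ∞
        (fun z ↦ Ring.inverse (S i ∘L T i z) (S i (fib r (ι i) (ι z) (X (ι z))))) z :=
      h2.clm_apply ((S i).contDiff.contDiffAt.comp z h1)
    refine h3.congr_of_eventuallyEq ?_
    filter_upwards [hιc.continuousAt.eventually hX] with w hw
    rw [hw]
    rfl
  -- Being a left inverse is an affine condition, so it survives averaging with a partition of
  -- unity.
  refine ⟨fun z ↦ ∑ i ∈ ρ.finsupport z, ρ i z • lamᵢ i z, fun z u ↦ ?_, fun x₀ z hz ↦ ?_⟩
  · have h1 := ρ.sum_finsupport (x₀ := z) (Set.mem_univ z)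
    rw [LinearMap.sum_apply]
    calc ∑ i ∈ ρ.finsupport z, (ρ i z • lamᵢ i z) (J z u)
        = ∑ i ∈ ρ.finsupport z, ρ i z • u := by
          refine Finset.sum_congr rfl fun i hi ↦ ?_
          have : z ∈ Uo i := hρ i (subset_tsupport _ ((ρ.mem_finsupport z).1 hi))
          rw [LinearMap.smul_apply, hinv i z u this]
      _ = u := by rw [← Finset.sum_smul, h1, one_smul]
  · refine contDiffAt_toCLM fun u ↦ ?_
    -- The index set `ρ.finsupport w` varies with `w`; near `z` it is contained in the fixed finite
    -- set `ρ.fintsupport z`, and the additional terms are zero.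
    have h1 : ContDiffAt ℝ ∞ (fun w ↦ ∑ i ∈ ρ.fintsupport z,
        ρ i w • lamᵢ i w (fibSymm r V x₀ (ι w) u)) z := by
      refine ContDiffAt.sum fun i hi ↦ ?_
      exact (ρ i).contMDiff.contMDiffAt.contDiffAt.smul
        (hlams i z x₀ (hρ i ((ρ.mem_fintsupport_iff z i).1 hi)) hz u)
    refine h1.congr_of_eventuallyEq ?_
    filter_upwards [ρ.eventually_finsupport_subset z] with w hw
    simp only [LinearMap.comp_apply, LinearMap.sum_apply, LinearMap.smul_apply]
    refine Finset.sum_subset hw fun i _ hi ↦ ?_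
    have : ρ i w = 0 := by
      by_contra h
      exact hi ((ρ.mem_finsupport w).2 h)
    rw [this, zero_smul]

end Immersion

/-! ### The matrix of the bivector field and the coefficients read in it. -/

theorem contDiff_smul_const {E F : Type*} [NormedAddCommGroup E] [NormedSpace ℝ E]
    [NormedAddCommGroup F] [NormedSpace ℝ F] {f : E → ℝ} (hf : ContDiff ℝ ∞ f) (c : F) :
    ContDiff ℝ ∞ (fun x ↦ f x • c) := hf.smul contDiff_const

/-- The matrix of a fiber-wise linear bivector field at a point of the total space, in terms of the
matrices of the anchor and of the bracket. -/
def poissonOf {d r : ℕ} (a : Euc r →L[ℝ] Euc d) (b : Euc r →L[ℝ] Euc r →L[ℝ] Euc r) (y : Euc r) :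
    Fin r ⊕ Fin d → Fin r ⊕ Fin d → ℝ
  | .inl i, .inl j => ∑ s, b (stdBasis r i) (stdBasis r j) s * y s
  | .inl i, .inr j => a (stdBasis r i) j
  | .inr i, .inl j => -a (stdBasis r j) i
  | .inr _, .inr _ => 0

theorem contDiff_poissonOf {d r : ℕ} : ContDiff ℝ ∞
    (fun p : (Euc r →L[ℝ] Euc d) × (Euc r →L[ℝ] Euc r →L[ℝ] Euc r) × Euc r ↦
      poissonOf p.1 p.2.1 p.2.2) := by
  have hpr : ∀ (n : ℕ) (s : Fin n), ContDiff ℝ ∞ (fun y : Euc n ↦ y s) := fun n s ↦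
    (EuclideanSpace.proj (𝕜 := ℝ) s : Euc n →L[ℝ] ℝ).contDiff
  have ha : ∀ (i : Fin r) (j : Fin d), ContDiff ℝ ∞
      (fun p : (Euc r →L[ℝ] Euc d) × (Euc r →L[ℝ] Euc r →L[ℝ] Euc r) × Euc r ↦
        p.1 (stdBasis r i) j) := fun i j ↦
    (hpr d j).comp (contDiff_fst.clm_apply contDiff_const)
  rw [contDiff_pi]
  intro i
  rw [contDiff_pi]
  intro j
  rcases i with i | i <;> rcases j with j | j
  · refine ContDiff.sum fun s _ ↦ ContDiff.mul ?_ ?_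
    · exact (hpr r s).comp (((contDiff_fst.comp contDiff_snd).clm_apply contDiff_const).clm_apply
        contDiff_const)
    · exact (hpr r s).comp (contDiff_snd.comp contDiff_snd)
  · exact ha i j
  · exact (ha j i).neg
  · exact contDiff_const

/-- The vector of components of the anchor, read in the matrix of the bivector field. -/
def anchorOf {d r : ℕ} (p : Fin r ⊕ Fin d → Fin r ⊕ Fin d → ℝ) : Euc r →L[ℝ] Euc d :=
  ∑ i, ∑ j, p (.inl i) (.inr j) •
    (EuclideanSpace.proj (𝕜 := ℝ) i : Euc r →L[ℝ] ℝ).smulRight (EuclideanSpace.single j (1 : ℝ))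

/-- The structure functions of the bracket, read in the matrices of the bivector field at the
vectors of the dual frame. -/
def bracketOf {d r : ℕ} (p : Fin r → Fin r ⊕ Fin d → Fin r ⊕ Fin d → ℝ) :
    Euc r →L[ℝ] Euc r →L[ℝ] Euc r :=
  ∑ i, ∑ j, ∑ s, p s (.inl i) (.inl j) •
    (EuclideanSpace.proj (𝕜 := ℝ) i : Euc r →L[ℝ] ℝ).smulRight
      ((EuclideanSpace.proj (𝕜 := ℝ) j : Euc r →L[ℝ] ℝ).smulRight (EuclideanSpace.single s (1 : ℝ)))

theorem contDiff_anchorOf {d r : ℕ} : ContDiff ℝ ∞ (anchorOf (d := d) (r := r)) := by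
  unfold anchorOf
  exact ContDiff.sum fun i _ ↦ ContDiff.sum fun j _ ↦
    contDiff_smul_const (contDiff_apply_apply ℝ ℝ _ _) _

theorem contDiff_bracketOf {d r : ℕ} : ContDiff ℝ ∞ (bracketOf (d := d) (r := r)) := by
  unfold bracketOf
  exact ContDiff.sum fun i _ ↦ ContDiff.sum fun j _ ↦ ContDiff.sum fun s _ ↦
    contDiff_smul_const ((contDiff_apply_apply ℝ ℝ _ _).comp (contDiff_apply ℝ _ s)) _

namespace LieAlgebroid

section

variable {d r : ℕ} {M : Type*} [TopologicalSpace M] [ChartedSpace (Euc d) M]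
  {V : M → Type*} [TopologicalSpace (TotalSpace (Euc r) V)]
  [∀ x, AddCommGroup (V x)] [∀ x, Module ℝ (V x)] [∀ x, TopologicalSpace (V x)]
  [FiberBundle (Euc r) V] [VectorBundle ℝ (Euc r) V]
  [T2Space M] [IsManifold (𝓡 d) ∞ M] [ContMDiffVectorBundle ∞ (Euc r) V (𝓡 d)]
  (A : LieAlgebroid d r M V)

theorem poisson_eq_poissonOf (x₀ : M) (z : Euc d × Euc r) :
    A.poisson x₀ z = poissonOf (A.anc x₀ ((chartAt (Euc d) x₀).symm z.1))
      (A.brk x₀ ((chartAt (Euc d) x₀).symm z.1)) z.2 := by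
  have hs : ∀ i k : Fin r, (stdBasis r i) k = if k = i then 1 else 0 := by
    intro i k
    simp [stdBasis]
  funext i j
  rcases i with i | i <;> rcases j with j | j
  · simp [poisson, poissonOf, brk_apply]
  · simp [poisson, poissonOf, anc_apply]
  · simp [poisson, poissonOf, anc_apply]
  · rfl

theorem anchorOf_poisson (x₀ : M) {x : M} (hx : x ∈ (chartAt (Euc d) x₀).source) (y : Euc r) :
    anchorOf (A.poisson x₀ (chartAt (Euc d) x₀ x, y)) = A.anc x₀ x := by
  simp only [anchorOf, poisson, (chartAt (Euc d) x₀).left_inv hx]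
  rfl

theorem bracketOf_poisson (x₀ : M) {x : M} (hx : x ∈ (chartAt (Euc d) x₀).source) :
    bracketOf (fun s ↦ A.poisson x₀ (chartAt (Euc d) x₀ x, stdBasis r s)) = A.brk x₀ x := by
  have hs : ∀ i k : Fin r, (stdBasis r i) k = if k = i then 1 else 0 := by
    intro i k
    simp [stdBasis]
  simp only [bracketOf, poisson, (chartAt (Euc d) x₀).left_inv hx, hs]
  simp [brk]

end

/-! ### Lie algebroid structures on trivial bundles. -/

section Trivial

variable {q l : ℕ}

/-- The space of sections of a trivial bundle. -/
abbrev TrivSection (q l : ℕ) : Type :=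
  Cₛ^∞⟮𝓡 q; Euc l, Bundle.Trivial (Euc q) (Euc l)⟯

theorem fib_trivial (x₀ x : Euc q) (v : Bundle.Trivial (Euc q) (Euc l) x) :
    fib l x₀ x v = v :=
  fib_apply (r := l) (V := Bundle.Trivial (Euc q) (Euc l)) (x₀ := x₀) (x := x) (Set.mem_univ _) v

theorem fibSymm_trivial (x₀ x : Euc q) (v : Euc l) :
    fibSymm l (Bundle.Trivial (Euc q) (Euc l)) x₀ x v = v := by
  have := fib_fibSymm (r := l) (V := Bundle.Trivial (Euc q) (Euc l)) (x₀ := x₀) (x := x)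
    (Set.mem_univ _) v
  rwa [fib_trivial] at this

theorem contDiff_trivSection (X : TrivSection q l) : ContDiff ℝ ∞ (fun z ↦ (X z : Euc l)) := by
  rw [← contMDiff_iff_contDiff]
  intro z
  exact (contMDiffAt_fib (x₀ := z) X (Set.mem_univ z)).congr_of_eventuallyEq
    (Eventually.of_forall fun y ↦ (fib_trivial z y (X y)).symm)

/-- The section of the trivial bundle defined by a smooth function. -/
def mkTriv (X : Euc q → Euc l) (hX : ContDiff ℝ ∞ X) : TrivSection q l :=
  ⟨X, fun z ↦ ((trivializationAt (Euc l) (Bundle.Trivial (Euc q) (Euc l)) z).contMDiffAt_section_iff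
    (IB := 𝓡 q) (s := X) (Set.mem_univ z)).2 hX.contMDiff.contMDiffAt⟩

/-- The bracket of vector-valued functions with given anchor and structure functions. -/
def bracketFun (ρ : Euc q → Euc l →L[ℝ] Euc q) (f : Euc q → Euc l →L[ℝ] Euc l →L[ℝ] Euc l)
    (X Y : Euc q → Euc l) (z : Euc q) : Euc l :=
  fderiv ℝ Y z (ρ z (X z)) - fderiv ℝ X z (ρ z (Y z)) + f z (X z) (Y z)

theorem anc_trivial (B : LieAlgebroid q l (Euc q) (Bundle.Trivial (Euc q) (Euc l)))
    (x₀ x : Euc q) : B.anc x₀ x = toCLM (B.anchor x) := by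
  ext1 u
  rw [B.anc_eq ⟨Set.mem_univ _, Set.mem_univ _⟩, fibSymm_trivial]
  exact (vecDeriv_eq_fderiv id x (B.anchor x u)).trans (by rw [fderiv_id]; rfl)

theorem brk_trivial (B : LieAlgebroid q l (Euc q) (Bundle.Trivial (Euc q) (Euc l)))
    (x₀ x : Euc q) {u v : Euc l} {X Y : TrivSection q l} (hX : ∀ᶠ y in 𝓝 x, X y = u)
    (hY : ∀ᶠ y in 𝓝 x, Y y = v) : B.brk x₀ x u v = B.bracket X Y x := by
  rw [B.brk_eq_single (x₀ := x₀) (x := x) (Set.mem_univ _) u v X Y, fib_trivial]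
  · simpa only [fibSymm_trivial] using hX
  · simpa only [fibSymm_trivial] using hY

variable {ρ : Euc q → Euc l →L[ℝ] Euc q} {f : Euc q → Euc l →L[ℝ] Euc l →L[ℝ] Euc l}

theorem contDiffAt_bracketFun {X Y : Euc q → Euc l} {z : Euc q} (hρ : ContDiffAt ℝ ∞ ρ z)
    (hf : ContDiffAt ℝ ∞ f z)
    (hX : ContDiffAt ℝ ∞ X z) (hY : ContDiffAt ℝ ∞ Y z) :
    ContDiffAt ℝ ∞ (bracketFun ρ f X Y) z := by
  unfold bracketFun
  exact (((hY.fderiv_right (by simp)).clm_apply (hρ.clm_apply hX)).sub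
    ((hX.fderiv_right (by simp)).clm_apply (hρ.clm_apply hY))).add ((hf.clm_apply hX).clm_apply hY)

theorem bracketFun_add_left {X X' Y : Euc q → Euc l} {z : Euc q} (hX : DifferentiableAt ℝ X z)
    (hX' : DifferentiableAt ℝ X' z) :
    bracketFun ρ f (fun z ↦ X z + X' z) Y z = bracketFun ρ f X Y z + bracketFun ρ f X' Y z := by
  simp only [bracketFun, fderiv_fun_add hX hX', map_add, add_apply]
  abel

theorem bracketFun_add_right {X Y Y' : Euc q → Euc l} {z : Euc q} (hY : DifferentiableAt ℝ Y z)
    (hY' : DifferentiableAt ℝ Y' z) :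
    bracketFun ρ f X (fun z ↦ Y z + Y' z) z = bracketFun ρ f X Y z + bracketFun ρ f X Y' z := by
  simp only [bracketFun, fderiv_fun_add hY hY', map_add, add_apply]
  abel

theorem bracketFun_smul_left (c : ℝ) {X Y : Euc q → Euc l} {z : Euc q}
    (hX : DifferentiableAt ℝ X z) :
    bracketFun ρ f (fun z ↦ c • X z) Y z = c • bracketFun ρ f X Y z := by
  simp only [bracketFun, fderiv_fun_const_smul hX, map_smul, smul_apply, smul_add, smul_sub]

theorem bracketFun_const_smul_right (c : ℝ) {X Y : Euc q → Euc l} {z : Euc q}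
    (hY : DifferentiableAt ℝ Y z) :
    bracketFun ρ f X (fun z ↦ c • Y z) z = c • bracketFun ρ f X Y z := by
  simp only [bracketFun, fderiv_fun_const_smul hY, map_smul, smul_apply, smul_add, smul_sub]

theorem bracketFun_smul_right {X Y : Euc q → Euc l} {g : Euc q → ℝ} {z : Euc q}
    (hg : DifferentiableAt ℝ g z) (hY : DifferentiableAt ℝ Y z) :
    bracketFun ρ f X (fun z ↦ g z • Y z) z =
      g z • bracketFun ρ f X Y z + fderiv ℝ g z (ρ z (X z)) • Y z := by
  simp only [bracketFun, fderiv_fun_smul hg hY, map_smul, add_apply, smul_apply, smul_add,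
    smul_sub, ContinuousLinearMap.smulRight_apply]
  abel

theorem bracketFun_smul_left' {X Y : Euc q → Euc l} {g : Euc q → ℝ} {z : Euc q}
    (hg : DifferentiableAt ℝ g z) (hX : DifferentiableAt ℝ X z) :
    bracketFun ρ f (fun z ↦ g z • X z) Y z =
      g z • bracketFun ρ f X Y z - fderiv ℝ g z (ρ z (Y z)) • X z := by
  simp only [bracketFun, fderiv_fun_smul hg hX, map_smul, add_apply, smul_apply, smul_add,
    smul_sub, ContinuousLinearMap.smulRight_apply]
  abel

/-- The Lie algebroid structure on a trivial bundle with given anchor and structure functions. -/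
def ofCoeff (hρ : ContDiff ℝ ∞ ρ) (hf : ContDiff ℝ ∞ f) (halt : ∀ z u, f z u u = 0)
    (hjac : ∀ X Y Z : Euc q → Euc l, ContDiff ℝ ∞ X → ContDiff ℝ ∞ Y → ContDiff ℝ ∞ Z → ∀ z,
      bracketFun ρ f X (bracketFun ρ f Y Z) z + bracketFun ρ f Y (bracketFun ρ f Z X) z +
        bracketFun ρ f Z (bracketFun ρ f X Y) z = 0) :
    LieAlgebroid q l (Euc q) (Bundle.Trivial (Euc q) (Euc l)) where
  anchor x := (ρ x).toLinearMap
  contMDiff_anchor := by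
    have hproj : ContMDiff ((𝓡 q).prod 𝓘(ℝ, Euc l)) 𝓘(ℝ, Euc q) ∞
        (fun v : TotalSpace (Euc l) (Bundle.Trivial (Euc q) (Euc l)) ↦ v.proj) :=
      contMDiff_proj _
    have hsnd : ContMDiff ((𝓡 q).prod 𝓘(ℝ, Euc l)) 𝓘(ℝ, Euc l) ∞
        (fun v : TotalSpace (Euc l) (Bundle.Trivial (Euc q) (Euc l)) ↦ (v.snd : Euc l)) := by
      intro v
      exact (((trivializationAt (Euc l) (Bundle.Trivial (Euc q) (Euc l)) v.proj).contMDiffAt_iff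
        (IB := 𝓡 q) (IM := (𝓡 q).prod 𝓘(ℝ, Euc l)) (n := ∞) (f := id) (x₀ := v)
        (by simp)).1 contMDiffAt_id).2
    intro v
    rw [contMDiffAt_totalSpace]
    refine ⟨hproj v, ((hρ.contMDiff.comp hproj).clm_apply hsnd v).congr_of_eventuallyEq ?_⟩
    refine Eventually.of_forall fun w ↦ ?_
    simp
    rfl
  bracket := LinearMap.mk₂ ℝ
    (fun X Y ↦ mkTriv (bracketFun ρ f (fun z ↦ X z) (fun z ↦ Y z)) (contDiff_iff_contDiffAt.2
      fun z ↦ contDiffAt_bracketFun hρ.contDiffAt hf.contDiffAt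
        (contDiff_trivSection X).contDiffAt (contDiff_trivSection Y).contDiffAt))
    (fun X X' Y ↦ ContMDiffSection.ext fun z ↦
      bracketFun_add_left ((contDiff_trivSection X).differentiable (by simp) z)
        ((contDiff_trivSection X').differentiable (by simp) z))
    (fun c X Y ↦ ContMDiffSection.ext fun z ↦
      bracketFun_smul_left c ((contDiff_trivSection X).differentiable (by simp) z))
    (fun X Y Y' ↦ ContMDiffSection.ext fun z ↦
      bracketFun_add_right ((contDiff_trivSection Y).differentiable (by simp) z)
        ((contDiff_trivSection Y').differentiable (by simp) z))
    (fun c X Y ↦ ContMDiffSection.ext fun z ↦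
      bracketFun_const_smul_right c ((contDiff_trivSection Y).differentiable (by simp) z))
  bracket_self X := by
    ext1 z
    show bracketFun ρ f (fun z ↦ X z) (fun z ↦ X z) z = 0
    simp [bracketFun, halt]
  jacobi X Y Z := by
    ext1 z
    exact hjac (fun z ↦ X z) (fun z ↦ Y z) (fun z ↦ Z z) (contDiff_trivSection X)
      (contDiff_trivSection Y) (contDiff_trivSection Z) z
  leibniz X Y g z := by
    rw [dirDeriv_eq_vecDeriv]
    refine (bracketFun_smul_right (ρ := ρ) (f := f) (X := fun z ↦ X z)
      (g.contMDiff.contDiff.differentiable (by simp) z)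
      ((contDiff_trivSection Y).differentiable (by simp) z)).trans ?_
    congr 2
    exact (vecDeriv_eq_fderiv g z (ρ z (X z))).symm

theorem anc_ofCoeff (hρ : ContDiff ℝ ∞ ρ) (hf : ContDiff ℝ ∞ f) (halt) (hjac) (x₀ x : Euc q) :
    (ofCoeff hρ hf halt hjac).anc x₀ x = ρ x := by
  rw [anc_trivial]
  rfl

theorem brk_ofCoeff (hρ : ContDiff ℝ ∞ ρ) (hf : ContDiff ℝ ∞ f) (halt) (hjac) (x₀ x : Euc q) :
    (ofCoeff hρ hf halt hjac).brk x₀ x = f x := by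
  ext1 u
  ext1 v
  rw [brk_trivial _ x₀ x (X := mkTriv (fun _ ↦ u) contDiff_const)
    (Y := mkTriv (fun _ ↦ v) contDiff_const) (Eventually.of_forall fun _ ↦ rfl)
    (Eventually.of_forall fun _ ↦ rfl)]
  show bracketFun ρ f (fun _ ↦ u) (fun _ ↦ v) x = _
  simp [bracketFun]

end Trivial

end LieAlgebroid

/-- The first-order data which determine a transversal structure, in coordinates: a left inverse of
the inclusion of the transversal bundle and its derivative, the derivative of the transversal disc,
the anchor and the structure functions of the bracket. -/
abbrev CoordData (d r q l : ℕ) : Type :=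
  (Euc r →L[ℝ] Euc l) × (Euc q →L[ℝ] Euc r →L[ℝ] Euc l) × (Euc q →L[ℝ] Euc d) ×
    (Euc r →L[ℝ] Euc d) × (Euc r →L[ℝ] Euc r →L[ℝ] Euc r)

/-! ### Pointwise algebra of transversal structures. -/

namespace CoordData

variable {d r q l : ℕ}

/-- The linear system whose solutions are the lift and the anchor of the transversal structure. -/
def system (p : CoordData d r q l) : Euc r × Euc q →L[ℝ] Euc l × Euc d :=
  (ContinuousLinearMap.inl ℝ (Euc l) (Euc d)) ∘L p.1 ∘L (ContinuousLinearMap.fst ℝ (Euc r) (Euc q)) +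
    (ContinuousLinearMap.inr ℝ (Euc l) (Euc d)) ∘L
      (p.2.2.2.1 ∘L (ContinuousLinearMap.fst ℝ (Euc r) (Euc q)) -
        p.2.2.1 ∘L (ContinuousLinearMap.snd ℝ (Euc r) (Euc q)))

theorem system_apply (p : CoordData d r q l) (x : Euc r × Euc q) :
    p.system x = (p.1 x.1, p.2.2.2.1 x.1 - p.2.2.1 x.2) := by
  simp [system]

/-- The inclusion of the transversal bundle, in coordinates. -/
def lift (p : CoordData d r q l) : Euc l →L[ℝ] Euc r :=
  ContinuousLinearMap.fst ℝ (Euc r) (Euc q) ∘L p.system.inverse ∘L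
    ContinuousLinearMap.inl ℝ (Euc l) (Euc d)

/-- The anchor of the transversal structure, in coordinates. -/
def anc (p : CoordData d r q l) : Euc l →L[ℝ] Euc q :=
  ContinuousLinearMap.snd ℝ (Euc r) (Euc q) ∘L p.system.inverse ∘L
    ContinuousLinearMap.inl ℝ (Euc l) (Euc d)

/-- The structure functions of the bracket of the transversal structure, in coordinates. -/
def brk (p : CoordData d r q l) : Euc l →L[ℝ] Euc l →L[ℝ] Euc l :=
  (ContinuousLinearMap.compL ℝ (Euc l) (Euc r) (Euc l) p.1) ∘L
      (p.2.2.2.2.bilinearComp p.lift p.lift) -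
    p.2.1.bilinearComp p.anc p.lift + (p.2.1.bilinearComp p.anc p.lift).flip

/-- The terms in `p.2.1`, the derivative of `lam`, stand for those in the derivative of the lift:
`lam (lift u) = u` gives `(D lam) (lift u) = -lam (D (lift u))`. No derivative of the anchor is
left. -/
theorem brk_apply (p : CoordData d r q l) (u v : Euc l) :
    p.brk u v = p.1 (p.2.2.2.2 (p.lift u) (p.lift v)) - p.2.1 (p.anc u) (p.lift v) +
      p.2.1 (p.anc v) (p.lift u) := by
  simp [brk]

theorem contDiff_system : ContDiff ℝ ∞ (system : CoordData d r q l → _) := by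
  have h1 : ContDiff ℝ ∞ (fun p : CoordData d r q l ↦ p.1) := contDiff_fst
  have h2 : ContDiff ℝ ∞ (fun p : CoordData d r q l ↦ p.2.2.1) :=
    contDiff_fst.comp (contDiff_snd.comp contDiff_snd)
  have h3 : ContDiff ℝ ∞ (fun p : CoordData d r q l ↦ p.2.2.2.1) :=
    contDiff_fst.comp (contDiff_snd.comp (contDiff_snd.comp contDiff_snd))
  exact (contDiff_const.clm_comp (h1.clm_comp contDiff_const)).add
    (contDiff_const.clm_comp ((h3.clm_comp contDiff_const).sub (h2.clm_comp contDiff_const)))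

/-- The data whose linear system is uniquely solvable. -/
def nondeg (d r q l : ℕ) : Set (CoordData d r q l) := {p | p.system.IsInvertible}

theorem isOpen_nondeg : IsOpen (nondeg d r q l) :=
  ContinuousLinearEquiv.isOpen.preimage contDiff_system.continuous

theorem contDiffOn_inverse_system :
    ContDiffOn ℝ ∞ (fun p : CoordData d r q l ↦ p.system.inverse) (nondeg d r q l) := fun p hp ↦
  ((ContinuousLinearMap.IsInvertible.contDiffAt_map_inverse hp).comp p
    contDiff_system.contDiffAt).contDiffWithinAt

theorem contDiffOn_lift : ContDiffOn ℝ ∞ (lift : CoordData d r q l → _) (nondeg d r q l) :=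
  contDiffOn_const.clm_comp (contDiffOn_inverse_system.clm_comp contDiffOn_const)

theorem contDiffOn_anc : ContDiffOn ℝ ∞ (anc : CoordData d r q l → _) (nondeg d r q l) :=
  contDiffOn_const.clm_comp (contDiffOn_inverse_system.clm_comp contDiffOn_const)

theorem contDiffOn_brk : ContDiffOn ℝ ∞ (brk : CoordData d r q l → _) (nondeg d r q l) := by
  refine contDiffOn_clm_apply.2 fun u ↦ contDiffOn_clm_apply.2 fun v ↦ ?_
  simp only [brk_apply]
  have h1 : ContDiff ℝ ∞ (fun p : CoordData d r q l ↦ p.1) := contDiff_fst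
  have h2 : ContDiff ℝ ∞ (fun p : CoordData d r q l ↦ p.2.1) :=
    contDiff_fst.comp contDiff_snd
  have h3 : ContDiff ℝ ∞ (fun p : CoordData d r q l ↦ p.2.2.2.2) :=
    contDiff_snd.comp (contDiff_snd.comp (contDiff_snd.comp contDiff_snd))
  have hl : ∀ w, ContDiffOn ℝ ∞ (fun p : CoordData d r q l ↦ p.lift w) (nondeg d r q l) :=
    fun w ↦ contDiffOn_lift.clm_apply contDiffOn_const
  have ha : ∀ w, ContDiffOn ℝ ∞ (fun p : CoordData d r q l ↦ p.anc w) (nondeg d r q l) :=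
    fun w ↦ contDiffOn_anc.clm_apply contDiffOn_const
  exact ((h1.contDiffOn.clm_apply ((h3.contDiffOn.clm_apply (hl u)).clm_apply (hl v))).sub
    ((h2.contDiffOn.clm_apply (ha u)).clm_apply (hl v))).add
    ((h2.contDiffOn.clm_apply (ha v)).clm_apply (hl u))

theorem system_lift_anc {p : CoordData d r q l} (hp : p ∈ nondeg d r q l) (u : Euc l) :
    p.system (p.lift u, p.anc u) = (u, 0) := by
  obtain ⟨e, he⟩ := hp
  have h : (p.lift u, p.anc u) = e.symm (u, 0) := by
    simp [lift, anc, ← he]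
  rw [h, ← he]
  simp

end CoordData

theorem CoordData.mem_nondeg_iff {d r q l : ℕ} (p : CoordData d r q l) :
    p ∈ CoordData.nondeg d r q l ↔ Function.Bijective p.system := by
  refine ⟨fun h ↦ h.bijective, fun h ↦ ?_⟩
  refine ⟨(LinearEquiv.ofBijective p.system.toLinearMap h).toContinuousLinearEquiv, ?_⟩
  exact ContinuousLinearMap.ext fun _ ↦ rfl

/-! ### The transversal structure: lift and anchor. -/

namespace LieAlgebroid

variable {d r : ℕ} {M : Type*} [TopologicalSpace M] [ChartedSpace (Euc d) M]
  {V : M → Type*} [TopologicalSpace (TotalSpace (Euc r) V)]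
  [∀ x, AddCommGroup (V x)] [∀ x, Module ℝ (V x)] [∀ x, TopologicalSpace (V x)]
  [FiberBundle (Euc r) V] [VectorBundle ℝ (Euc r) V]
  [T2Space M] [IsManifold (𝓡 d) ∞ M] [ContMDiffVectorBundle ∞ (Euc r) V (𝓡 d)]
  (A : LieAlgebroid d r M V) {q l : ℕ} {ι : Euc q → M}

/-- Vector-valued version of the compatibility of the anchor with the brackets. -/
theorem vecDeriv_anchor_bracket {F : M → Euc d} {x : M}
    (hF : ∀ᶠ y in 𝓝 x, ContMDiffAt (𝓡 d) 𝓘(ℝ, Euc d) ∞ F y) (X Y : Cₛ^∞⟮𝓡 d; Euc r, V⟯) :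
    vecDeriv F x (A.anchor x (A.bracket X Y x)) =
      vecDeriv (fun y ↦ vecDeriv F y (A.anchor y (Y y))) x (A.anchor x (X x)) -
      vecDeriv (fun y ↦ vecDeriv F y (A.anchor y (X y))) x (A.anchor x (Y x)) := by
  obtain ⟨G, hG, hGF⟩ := exists_contMDiff_eventuallyEq hF
  have key : ∀ Z : Cₛ^∞⟮𝓡 d; Euc r, V⟯, (fun y ↦ vecDeriv F y (A.anchor y (Z y))) =ᶠ[𝓝 x]
      fun y ↦ vecDeriv G y (A.anchor y (Z y)) := by
    intro Z
    filter_upwards [hGF.eventually_nhds] with y hy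
    rw [vecDeriv_congr hy]
  rw [← vecDeriv_congr hGF, vecDeriv_congr (key X), vecDeriv_congr (key Y)]
  ext k
  have hp : ∀ (H : M → Euc d), ContMDiff (𝓡 d) 𝓘(ℝ, Euc d) ∞ H →
      ∀ (y : M) (w : TangentSpace (𝓡 d) y), vecDeriv H y w k = vecDeriv (fun y ↦ H y k) y w :=
    fun H hH y w ↦ (vecDeriv_clm (EuclideanSpace.proj (𝕜 := ℝ) k : Euc d →L[ℝ] ℝ)
      (hH.mdifferentiable (by simp) y) w).symm
  have := A.anchor_bracket X Y ⟨fun y ↦ G y k,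
    (EuclideanSpace.proj (𝕜 := ℝ) k : Euc d →L[ℝ] ℝ).contMDiff.comp hG⟩ x
  rw [PiLp.sub_apply, hp G hG, hp _ (A.contMDiff_vecDeriv hG Y), hp _ (A.contMDiff_vecDeriv hG X)]
  simp only [hp G hG]
  exact this

/-- The matrix of a family of linear forms on the fibers along a submanifold. -/
def fiberMatrix (lam : ∀ z, V (ι z) →ₗ[ℝ] Euc l) (x₀ : M) (z : Euc q) : Euc r →L[ℝ] Euc l :=
  toCLM (lam z ∘ₗ fibSymm r V x₀ (ι z))

theorem fiberMatrix_fib (lam : ∀ z, V (ι z) →ₗ[ℝ] Euc l) {x₀ : M} {z : Euc q}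
    (hz : ι z ∈ (trivializationAt (Euc r) V x₀).baseSet) (v : V (ι z)) :
    fiberMatrix lam x₀ z (fib r x₀ (ι z) v) = lam z v := by
  show lam z (fibSymm r V x₀ (ι z) (fib r x₀ (ι z) v)) = _
  rw [fibSymm_fib hz]

variable (lam : ∀ z, V (ι z) →ₗ[ℝ] Euc l)

/-- The coordinates centred at `x₀` of the data which determine the transversal structure. -/
def coordData (x₀ : M) (z : Euc q) : CoordData d r q l :=
  (fiberMatrix lam x₀ z, fderiv ℝ (fiberMatrix lam x₀) z,
    fderiv ℝ (fun w ↦ chartAt (Euc d) x₀ (ι w)) z, A.anc x₀ (ι z), A.brk x₀ (ι z))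

/-- The transversal disc is transverse to the anchor in the directions of the kernels of `lam`. -/
def NondegAt (z : Euc q) : Prop :=
  Function.Bijective (fun p : V (ι z) × Euc q ↦
    (lam z p.1, A.anchor (ι z) p.1 - mfderiv (𝓡 q) (𝓡 d) ι z p.2))

/-- The inclusion of the transversal bundle. -/
def lift (z : Euc q) : Euc l →ₗ[ℝ] V (ι z) :=
  fibSymm r V (ι z) (ι z) ∘ₗ (A.coordData lam (ι z) z).lift.toLinearMap

/-- The anchor of the transversal structure. -/
def tanc (z : Euc q) : Euc l →L[ℝ] Euc q := (A.coordData lam (ι z) z).anc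

/-- The structure functions of the bracket of the transversal structure. -/
def tbrk (z : Euc q) : Euc l →L[ℝ] Euc l →L[ℝ] Euc l := (A.coordData lam (ι z) z).brk

variable {lam} (hι : IsSmoothEmbedding (𝓡 q) (𝓡 d) ∞ ι)
  (hlam : ∀ x₀ z, ι z ∈ (trivializationAt (Euc r) V x₀).baseSet →
    ContDiffAt ℝ ∞ (fiberMatrix (r := r) lam x₀) z)

include hι in
theorem contDiffAt_chart_comp {x₀ : M} {z : Euc q} (hz : ι z ∈ (chartAt (Euc d) x₀).source) :
    ContDiffAt ℝ ∞ (fun w ↦ chartAt (Euc d) x₀ (ι w)) z :=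
  ((contMDiffAt_chart hz).comp z
    (contMDiff_of_isSmoothEmbedding hι).contMDiffAt).contDiffAt

include hι in
theorem fderiv_chart_comp {x₀ : M} {z : Euc q} (hz : ι z ∈ (chartAt (Euc d) x₀).source)
    (ξ : Euc q) : fderiv ℝ (fun w ↦ chartAt (Euc d) x₀ (ι w)) z ξ =
      vecDeriv (chartAt (Euc d) x₀) (ι z) (mfderiv (𝓡 q) (𝓡 d) ι z ξ) := by
  rw [← vecDeriv_eq_fderiv]
  exact vecDeriv_comp_left ((contMDiffAt_chart hz).mdifferentiableAt (by simp))
    ((contMDiff_of_isSmoothEmbedding hι).mdifferentiableAt (by simp)) ξ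

include hι in
theorem eventually_mem_fiberedDomain {x₀ : M} {z : Euc q} (hz : ι z ∈ fiberedDomain d r V x₀) :
    ∀ᶠ w in 𝓝 z, ι w ∈ fiberedDomain d r V x₀ :=
  (contMDiff_of_isSmoothEmbedding hι).continuous.continuousAt
    ((isOpen_fiberedDomain x₀).mem_nhds hz)

include hι hlam in
theorem contDiffAt_coordData {x₀ : M} {z : Euc q} (hz : ι z ∈ fiberedDomain d r V x₀) :
    ContDiffAt ℝ ∞ (A.coordData lam x₀) z :=
  (hlam x₀ z hz.2).prodMk (((hlam x₀ z hz.2).fderiv_right (by simp)).prodMk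
    (((contDiffAt_chart_comp hι hz.1).fderiv_right (by simp)).prodMk
      (((A.contMDiffAt_anc hz).comp z
        (contMDiff_of_isSmoothEmbedding hι).contMDiffAt).contDiffAt.prodMk
      ((A.contMDiffAt_brk hz.2).comp z
        (contMDiff_of_isSmoothEmbedding hι).contMDiffAt).contDiffAt)))

include hι in
theorem system_coordData {x₀ : M} {z : Euc q} (hz : ι z ∈ fiberedDomain d r V x₀) (v : V (ι z))
    (ξ : Euc q) : (A.coordData lam x₀ z).system (fib r x₀ (ι z) v, ξ) =
      (lam z v, vecDeriv (chartAt (Euc d) x₀) (ι z)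
        (A.anchor (ι z) v - mfderiv (𝓡 q) (𝓡 d) ι z ξ)) := by
  rw [CoordData.system_apply, map_sub, ← A.anc_fib hz, ← fderiv_chart_comp hι hz.1,
    ← fiberMatrix_fib lam hz.2]
  rfl

include hι in
-- The coordinates only compose the map in `NondegAt` with bijections of its source and target, so
-- the condition may be tested in any chart around the point.
theorem nondegAt_iff {x₀ : M} {z : Euc q} (hz : ι z ∈ fiberedDomain d r V x₀) :
    A.NondegAt lam z ↔ A.coordData lam x₀ z ∈ CoordData.nondeg d r q l := by
  rw [CoordData.mem_nondeg_iff]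
  have h1 : Function.Bijective (fun p : V (ι z) × Euc q ↦ (fib r x₀ (ι z) p.1, p.2)) :=
    Function.Bijective.prodMap ⟨fib_injective hz.2,
      fun u ↦ ⟨fibSymm r V x₀ (ι z) u, fib_fibSymm hz.2 u⟩⟩ Function.bijective_id
  have h2 : Function.Bijective (fun p : Euc l × TangentSpace (𝓡 d) (ι z) ↦
      (p.1, vecDeriv (chartAt (Euc d) x₀) (ι z) p.2)) :=
    Function.Bijective.prodMap Function.bijective_id
      ⟨vecDeriv_chart_injective hz.1, vecDeriv_chart_surjective hz.1⟩
  rw [← h1.of_comp_iff, NondegAt, ← h2.of_comp_iff']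
  refine iff_of_eq (congrArg _ (funext fun p ↦ ?_))
  exact (A.system_coordData hι hz p.1 p.2).symm

include hι hlam in
theorem isOpen_nondegAt : IsOpen {z | A.NondegAt lam z} := by
  refine isOpen_iff_mem_nhds.2 fun z hz ↦ ?_
  have hz' := mem_fiberedDomain (d := d) (r := r) (V := V) (ι z)
  filter_upwards [eventually_mem_fiberedDomain hι hz',
    (A.contDiffAt_coordData hι hlam hz').continuousAt
      (CoordData.isOpen_nondeg.mem_nhds ((A.nondegAt_iff hι hz').1 hz))] with w h1 h2
  exact (A.nondegAt_iff hι h1).2 h2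

include hι in
theorem lam_lift {z : Euc q} (hz : A.NondegAt lam z) (u : Euc l) :
    lam z (A.lift lam z u) = u ∧
      A.anchor (ι z) (A.lift lam z u) = mfderiv (𝓡 q) (𝓡 d) ι z (A.tanc lam z u) := by
  have hz' := mem_fiberedDomain (d := d) (r := r) (V := V) (ι z)
  have h := CoordData.system_lift_anc ((A.nondegAt_iff hι hz').1 hz) u
  have h' := A.system_coordData (lam := lam) hι hz' (A.lift lam z u) (A.tanc lam z u)
  have h2 : fib r (ι z) (ι z) (A.lift lam z u) = (A.coordData lam (ι z) z).lift u :=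
    fib_fibSymm hz'.2 _
  rw [h2] at h'
  have h3 := h'.symm.trans h
  rw [Prod.mk.injEq] at h3
  refine ⟨h3.1, ?_⟩
  have h4 := vecDeriv_chart_injective hz'.1 (h3.2.trans (map_zero _).symm)
  exact sub_eq_zero.1 h4

include hι in
theorem lift_injective {z : Euc q} (hn : A.NondegAt lam z) :
    Function.Injective (A.lift lam z) := by
  intro u v h
  rw [← (A.lam_lift hι hn u).1, h, (A.lam_lift hι hn v).1]

/-- Both pairs have the same image `(lam z v, 0)` under an injective map. Thus the range of the lift
is exactly the set of vectors with anchor tangent to the disc. -/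
theorem eq_lift_of_anchor_eq {z : Euc q} (hι : IsSmoothEmbedding (𝓡 q) (𝓡 d) ∞ ι)
    (hz : A.NondegAt lam z) {v : V (ι z)} {ξ : Euc q}
    (h : A.anchor (ι z) v = mfderiv (𝓡 q) (𝓡 d) ι z ξ) :
    v = A.lift lam z (lam z v) ∧ ξ = A.tanc lam z (lam z v) := by
  have h1 := A.lam_lift hι hz (lam z v)
  have := hz.injective (a₁ := (v, ξ)) (a₂ := (A.lift lam z (lam z v), A.tanc lam z (lam z v)))
    (by simp only [h1.1, h1.2, h, sub_self])
  exact ⟨congrArg Prod.fst this, congrArg Prod.snd this⟩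

/-- `lift` and `tanc` are defined at `z` in the chart centred at `ι z`, which changes with `z`.
Uniqueness of the solution of the linear system makes them computable in one fixed chart, which is
what smoothness and `C^s` estimates require. -/
theorem lift_tanc_coord {x₀ : M} {z : Euc q} (hι : IsSmoothEmbedding (𝓡 q) (𝓡 d) ∞ ι)
    (hz : ι z ∈ fiberedDomain d r V x₀) (hn : A.NondegAt lam z) (u : Euc l) :
    fib r x₀ (ι z) (A.lift lam z u) = (A.coordData lam x₀ z).lift u ∧
      A.tanc lam z u = (A.coordData lam x₀ z).anc u := by
  have hp := (A.nondegAt_iff hι hz).1 hn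
  have h1 := CoordData.system_lift_anc hp u
  have h2 := A.system_coordData (lam := lam) hι hz (A.lift lam z u) (A.tanc lam z u)
  obtain ⟨h3, h4⟩ := A.lam_lift hι hn u
  rw [h3, h4, sub_self, map_zero] at h2
  have := ((CoordData.mem_nondeg_iff _).1 hp).injective (h2.trans h1.symm)
  exact Prod.mk.inj this

theorem tanc_eq {x₀ : M} {z : Euc q} (hι : IsSmoothEmbedding (𝓡 q) (𝓡 d) ∞ ι)
    (hz : ι z ∈ fiberedDomain d r V x₀) (hn : A.NondegAt lam z) :
    A.tanc lam z = (A.coordData lam x₀ z).anc := by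
  ext1 u
  exact (A.lift_tanc_coord hι hz hn u).2

include hι hlam in
theorem contDiffAt_tanc {z : Euc q} (hn : A.NondegAt lam z) : ContDiffAt ℝ ∞ (A.tanc lam) z := by
  have hz := mem_fiberedDomain (d := d) (r := r) (V := V) (ι z)
  refine ((CoordData.contDiffOn_anc.contDiffAt (CoordData.isOpen_nondeg.mem_nhds
    ((A.nondegAt_iff hι hz).1 hn))).comp z (A.contDiffAt_coordData hι hlam hz)).congr_of_eventuallyEq
      ?_
  filter_upwards [eventually_mem_fiberedDomain hι hz, (A.isOpen_nondegAt hι hlam).mem_nhds hn]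
    with w h1 h2
  exact A.tanc_eq hι h1 h2

end LieAlgebroid

/-! ### The bracket of the transversal structure. -/

namespace LieAlgebroid

variable {d r : ℕ} {M : Type*} [TopologicalSpace M] [ChartedSpace (Euc d) M]
  {V : M → Type*} [TopologicalSpace (TotalSpace (Euc r) V)]
  [∀ x, AddCommGroup (V x)] [∀ x, Module ℝ (V x)] [∀ x, TopologicalSpace (V x)]
  [FiberBundle (Euc r) V] [VectorBundle ℝ (Euc r) V]
  [T2Space M] [IsManifold (𝓡 d) ∞ M] [ContMDiffVectorBundle ∞ (Euc r) V (𝓡 d)]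
  (A : LieAlgebroid d r M V) {q l : ℕ} {ι : Euc q → M}
  {lam : ∀ z, V (ι z) →ₗ[ℝ] Euc l} (hι : IsSmoothEmbedding (𝓡 q) (𝓡 d) ∞ ι)
  (hlam : ∀ x₀ z, ι z ∈ (trivializationAt (Euc r) V x₀).baseSet →
    ContDiffAt ℝ ∞ (fiberMatrix (r := r) lam x₀) z)

include hι hlam

theorem contDiffAt_of_eq_lift {z₀ : Euc q} (hn : A.NondegAt lam z₀)
    {Z : Cₛ^∞⟮𝓡 d; Euc r, V⟯} {Z' : Euc q → Euc l}
    (hZ : ∀ᶠ z in 𝓝 z₀, Z (ι z) = A.lift lam z (Z' z)) : ContDiffAt ℝ ∞ Z' z₀ := by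
  have hz := mem_fiberedDomain (d := d) (r := r) (V := V) (ι z₀)
  have h1 : ContDiffAt ℝ ∞ (fun z ↦ fib r (ι z₀) (ι z) (Z (ι z))) z₀ :=
    ((contMDiffAt_fib Z hz.2).comp z₀ (contMDiff_of_isSmoothEmbedding hι).contMDiffAt).contDiffAt
  refine ((hlam _ _ hz.2).clm_apply h1).congr_of_eventuallyEq ?_
  filter_upwards [hZ, eventually_mem_fiberedDomain hι hz,
    (A.isOpen_nondegAt hι hlam).mem_nhds hn] with z h1 h2 h3
  rw [fiberMatrix_fib lam h2.2, h1, (A.lam_lift hι h3 _).1]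

/-- Product rule for `Z' = lam (Z ∘ ι)`. It replaces the derivative of the lift by that of `lam`,
which is independent of the algebroid. -/
theorem fiberMatrix_vecDeriv {x₀ : M} {z₀ : Euc q} (hz : ι z₀ ∈ fiberedDomain d r V x₀)
    (hn : A.NondegAt lam z₀) {Z : Cₛ^∞⟮𝓡 d; Euc r, V⟯} {Z' : Euc q → Euc l}
    (hZ : ∀ᶠ z in 𝓝 z₀, Z (ι z) = A.lift lam z (Z' z)) (ξ : Euc q) :
    fiberMatrix lam x₀ z₀ (vecDeriv (fun y ↦ fib r x₀ y (Z y)) (ι z₀)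
      (mfderiv (𝓡 q) (𝓡 d) ι z₀ ξ)) =
    fderiv ℝ Z' z₀ ξ -
      fderiv ℝ (fiberMatrix lam x₀) z₀ ξ ((A.coordData lam x₀ z₀).lift (Z' z₀)) := by
  set ζ : Euc q → Euc r := fun z ↦ fib r x₀ (ι z) (Z (ι z)) with hζ
  have h1 : ContDiffAt ℝ ∞ ζ z₀ :=
    ((contMDiffAt_fib Z hz.2).comp z₀ (contMDiff_of_isSmoothEmbedding hι).contMDiffAt).contDiffAt
  have h2 : vecDeriv (fun y ↦ fib r x₀ y (Z y)) (ι z₀) (mfderiv (𝓡 q) (𝓡 d) ι z₀ ξ) =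
      fderiv ℝ ζ z₀ ξ := by
    rw [← vecDeriv_eq_fderiv]
    exact (vecDeriv_comp_left ((contMDiffAt_fib Z hz.2).mdifferentiableAt (by simp))
      ((contMDiff_of_isSmoothEmbedding hι).mdifferentiableAt (by simp)) ξ).symm
  have h3 : Z' =ᶠ[𝓝 z₀] fun z ↦ fiberMatrix lam x₀ z (ζ z) := by
    filter_upwards [hZ, eventually_mem_fiberedDomain hι hz,
      (A.isOpen_nondegAt hι hlam).mem_nhds hn] with z h1 h2 h3
    rw [hζ, fiberMatrix_fib lam h2.2, h1, (A.lam_lift hι h3 _).1]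
  have h4 : ζ z₀ = (A.coordData lam x₀ z₀).lift (Z' z₀) := by
    rw [← (A.lift_tanc_coord hι hz hn _).1, ← hZ.self_of_nhds]
  rw [h2, h3.fderiv_eq, fderiv_clm_apply ((hlam _ _ hz.2).differentiableAt (by simp))
    (h1.differentiableAt (by simp)), ← h4]
  simp

/-- On the disc, the anchor of `Z` is the image under `dι` of `tanc Z'`. The product rule produces a
second derivative of the disc, whose symmetry cancels it in commutators. -/
theorem vecDeriv_chart_anchor {x₀ : M} {z₀ : Euc q} (hz : ι z₀ ∈ fiberedDomain d r V x₀)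
    (hn : A.NondegAt lam z₀) {Z : Cₛ^∞⟮𝓡 d; Euc r, V⟯} {Z' : Euc q → Euc l}
    (hZ : ∀ᶠ z in 𝓝 z₀, Z (ι z) = A.lift lam z (Z' z)) (ξ : Euc q) :
    vecDeriv (fun y ↦ vecDeriv (chartAt (Euc d) x₀) y (A.anchor y (Z y))) (ι z₀)
      (mfderiv (𝓡 q) (𝓡 d) ι z₀ ξ) =
    fderiv ℝ (fun w ↦ chartAt (Euc d) x₀ (ι w)) z₀
        (fderiv ℝ (fun z ↦ A.tanc lam z (Z' z)) z₀ ξ) +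
      fderiv ℝ (fderiv ℝ (fun w ↦ chartAt (Euc d) x₀ (ι w))) z₀ ξ (A.tanc lam z₀ (Z' z₀)) := by
  have h0 : ContMDiffAt (𝓡 d) 𝓘(ℝ, Euc d) ∞
      (fun y ↦ vecDeriv (chartAt (Euc d) x₀) y (A.anchor y (Z y))) (ι z₀) :=
    A.contMDiffAt_vecDeriv (by
      filter_upwards [(chartAt (Euc d) x₀).open_source.mem_nhds hz.1] with y hy
      exact contMDiffAt_chart hy) Z
  have h1 := vecDeriv_comp_left (h := ι) (z := z₀) (h0.mdifferentiableAt (by simp))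
      ((contMDiff_of_isSmoothEmbedding hι).mdifferentiableAt (by simp)) ξ
  have h2 : (fun z ↦ vecDeriv (chartAt (Euc d) x₀) (ι z) (A.anchor (ι z) (Z (ι z)))) =ᶠ[𝓝 z₀]
      fun z ↦ fderiv ℝ (fun w ↦ chartAt (Euc d) x₀ (ι w)) z (A.tanc lam z (Z' z)) := by
    filter_upwards [hZ, eventually_mem_fiberedDomain hι hz,
      (A.isOpen_nondegAt hι hlam).mem_nhds hn] with z h1 h2 h3
    rw [h1, (A.lam_lift hι h3 _).2, fderiv_chart_comp hι h2.1]
  have h3 : ContDiffAt ℝ ∞ (fun z ↦ A.tanc lam z (Z' z)) z₀ :=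
    (A.contDiffAt_tanc hι hlam hn).clm_apply (A.contDiffAt_of_eq_lift hι hlam hn hZ)
  rw [← h1, vecDeriv_eq_fderiv, h2.fderiv_eq, fderiv_clm_apply
    (((contDiffAt_chart_comp hι hz.1).fderiv_right (m := ∞) (by simp)).differentiableAt (by simp))
    (h3.differentiableAt (by simp))]
  simp

/-- The bracket of sections which restrict to sections of the transversal bundle. -/
theorem bracket_of_eq_lift {x₀ : M} {z₀ : Euc q} (hz : ι z₀ ∈ fiberedDomain d r V x₀)
    (hn : A.NondegAt lam z₀) {X Y : Cₛ^∞⟮𝓡 d; Euc r, V⟯} {X' Y' : Euc q → Euc l}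
    (hX : ∀ᶠ z in 𝓝 z₀, X (ι z) = A.lift lam z (X' z))
    (hY : ∀ᶠ z in 𝓝 z₀, Y (ι z) = A.lift lam z (Y' z)) :
    A.bracket X Y (ι z₀) = A.lift lam z₀ (fderiv ℝ Y' z₀ (A.tanc lam z₀ (X' z₀)) -
      fderiv ℝ X' z₀ (A.tanc lam z₀ (Y' z₀)) +
      (A.coordData lam x₀ z₀).brk (X' z₀) (Y' z₀)) := by
  have hXa : A.anchor (ι z₀) (X (ι z₀)) =
      mfderiv (𝓡 q) (𝓡 d) ι z₀ (A.tanc lam z₀ (X' z₀)) := by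
    rw [hX.self_of_nhds, (A.lam_lift hι hn _).2]
  have hYa : A.anchor (ι z₀) (Y (ι z₀)) =
      mfderiv (𝓡 q) (𝓡 d) ι z₀ (A.tanc lam z₀ (Y' z₀)) := by
    rw [hY.self_of_nhds, (A.lam_lift hι hn _).2]
  -- The bracket is again tangent to the disc: its anchor is the commutator of two fields tangent to
  -- the disc, and the second derivatives of `ι` cancel.
  have h1 : A.anchor (ι z₀) (A.bracket X Y (ι z₀)) = mfderiv (𝓡 q) (𝓡 d) ι z₀
      (fderiv ℝ (fun z ↦ A.tanc lam z (Y' z)) z₀ (A.tanc lam z₀ (X' z₀)) -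
        fderiv ℝ (fun z ↦ A.tanc lam z (X' z)) z₀ (A.tanc lam z₀ (Y' z₀))) := by
    apply vecDeriv_chart_injective hz.1
    rw [A.vecDeriv_anchor_bracket (by
      filter_upwards [(chartAt (Euc d) x₀).open_source.mem_nhds hz.1] with y hy
      exact contMDiffAt_chart hy), hXa, hYa, A.vecDeriv_chart_anchor hι hlam hz hn hX,
      A.vecDeriv_chart_anchor hι hlam hz hn hY, ← fderiv_chart_comp hι hz.1, map_sub,
      ((contDiffAt_chart_comp hι hz.1).isSymmSndFDerivAt (by
        rw [minSmoothness_of_isRCLikeNormedField]; exact ENat.LEInfty.out)).eq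
        (A.tanc lam z₀ (X' z₀)) (A.tanc lam z₀ (Y' z₀))]
    abel
  -- Being tangent, the bracket is the lift of its value under `lam`, which `fib_bracket` and the
  -- product rule compute.
  rw [(A.eq_lift_of_anchor_eq hι hn h1).1, ← fiberMatrix_fib lam hz.2, A.fib_bracket hz.2, hXa, hYa,
    map_add, map_sub, A.fiberMatrix_vecDeriv hι hlam hz hn hX,
    A.fiberMatrix_vecDeriv hι hlam hz hn hY, CoordData.brk_apply, hX.self_of_nhds,
    hY.self_of_nhds, (A.lift_tanc_coord hι hz hn _).1, (A.lift_tanc_coord hι hz hn _).1,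
    ← A.tanc_eq hι hz hn]
  congr 1
  simp only [coordData]
  abel

/-- Every germ of a transversal section comes from a global section of `V`, so identities between
brackets can be transferred from `A`. -/
theorem exists_section_eq_lift {z₀ : Euc q} (hn : A.NondegAt lam z₀) {c : Euc q → Euc l}
    (hc : ∀ᶠ z in 𝓝 z₀, ContDiffAt ℝ ∞ c z) :
    ∃ X : Cₛ^∞⟮𝓡 d; Euc r, V⟯, ∀ᶠ z in 𝓝 z₀, X (ι z) = A.lift lam z (c z) := by
  have hz := mem_fiberedDomain (d := d) (r := r) (V := V) (ι z₀)
  have hnd := (A.isOpen_nondegAt hι hlam).mem_nhds hn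
  obtain ⟨ψ, X, -, hψ, -, hX⟩ := exists_section_extension (V := V) (r := r) hι hz.2
    (c := fun z ↦ (A.coordData lam (ι z₀) z).lift (c z)) (by
      filter_upwards [hc, eventually_mem_fiberedDomain hι hz, hnd] with z h1 h2 h3
      exact ((CoordData.contDiffOn_lift.contDiffAt (CoordData.isOpen_nondeg.mem_nhds
        ((A.nondegAt_iff hι h2).1 h3))).comp z (A.contDiffAt_coordData hι hlam h2)).clm_apply h1)
  refine ⟨X, ?_⟩
  filter_upwards [(contMDiff_of_isSmoothEmbedding hι).continuous.continuousAt.eventually hψ,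
    eventually_mem_fiberedDomain hι hz, hnd] with z h1 h2 h3
  rw [hX, h1, one_smul, ← (A.lift_tanc_coord hι h2 h3 _).1, fibSymm_fib h2.2]

/-- `bracket_of_eq_lift` holds in every chart. Applied in two charts to sections lifting constants,
it computes the same vector twice, and the lift is injective. -/
theorem tbrk_eq {x₀ : M} {z : Euc q} (hz : ι z ∈ fiberedDomain d r V x₀)
    (hn : A.NondegAt lam z) : A.tbrk lam z = (A.coordData lam x₀ z).brk := by
  ext1 u
  ext1 v
  obtain ⟨X, hX⟩ := A.exists_section_eq_lift hι hlam hn (c := fun _ ↦ u)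
    (Eventually.of_forall fun _ ↦ contDiffAt_const)
  obtain ⟨Y, hY⟩ := A.exists_section_eq_lift hι hlam hn (c := fun _ ↦ v)
    (Eventually.of_forall fun _ ↦ contDiffAt_const)
  have h1 := A.bracket_of_eq_lift hι hlam hz hn hX hY
  rw [A.bracket_of_eq_lift hι hlam (mem_fiberedDomain (ι z)) hn hX hY] at h1
  simpa [tbrk] using A.lift_injective hι hn h1

theorem bracket_eq_lift_bracketFun {z₀ : Euc q}
    (hn : A.NondegAt lam z₀) {X Y : Cₛ^∞⟮𝓡 d; Euc r, V⟯} {X' Y' : Euc q → Euc l}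
    (hX : ∀ᶠ z in 𝓝 z₀, X (ι z) = A.lift lam z (X' z))
    (hY : ∀ᶠ z in 𝓝 z₀, Y (ι z) = A.lift lam z (Y' z)) :
    A.bracket X Y (ι z₀) = A.lift lam z₀ (bracketFun (A.tanc lam) (A.tbrk lam) X' Y' z₀) :=
  A.bracket_of_eq_lift hι hlam (mem_fiberedDomain (ι z₀)) hn hX hY

theorem contDiffAt_tbrk {z : Euc q} (hn : A.NondegAt lam z) : ContDiffAt ℝ ∞ (A.tbrk lam) z := by
  have hz := mem_fiberedDomain (d := d) (r := r) (V := V) (ι z)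
  refine ((CoordData.contDiffOn_brk.contDiffAt (CoordData.isOpen_nondeg.mem_nhds
    ((A.nondegAt_iff hι hz).1 hn))).comp z (A.contDiffAt_coordData hι hlam hz)).congr_of_eventuallyEq
      ?_
  filter_upwards [eventually_mem_fiberedDomain hι hz, (A.isOpen_nondegAt hι hlam).mem_nhds hn]
    with w h1 h2
  exact A.tbrk_eq hι hlam h1 h2

theorem tbrk_self {z : Euc q} (hn : A.NondegAt lam z) (u : Euc l) : A.tbrk lam z u u = 0 := by
  obtain ⟨X, hX⟩ := A.exists_section_eq_lift hι hlam hn (c := fun _ ↦ u)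
    (Eventually.of_forall fun _ ↦ contDiffAt_const)
  have h1 := A.bracket_eq_lift_bracketFun hι hlam hn hX hX
  rw [A.bracket_self] at h1
  have h2 := A.lift_injective hι hn (h1.symm.trans (map_zero _).symm)
  simpa [bracketFun] using h2

/-- The lift intertwines `bracketFun` with the bracket of `A` and is injective, so it pulls back the
Jacobi identity. -/
theorem bracketFun_jacobi {z₀ : Euc q} (hn : A.NondegAt lam z₀) {X Y Z : Euc q → Euc l}
    (hX : ∀ᶠ z in 𝓝 z₀, ContDiffAt ℝ ∞ X z) (hY : ∀ᶠ z in 𝓝 z₀, ContDiffAt ℝ ∞ Y z)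
    (hZ : ∀ᶠ z in 𝓝 z₀, ContDiffAt ℝ ∞ Z z) :
    bracketFun (A.tanc lam) (A.tbrk lam) X (bracketFun (A.tanc lam) (A.tbrk lam) Y Z) z₀ +
      bracketFun (A.tanc lam) (A.tbrk lam) Y (bracketFun (A.tanc lam) (A.tbrk lam) Z X) z₀ +
      bracketFun (A.tanc lam) (A.tbrk lam) Z (bracketFun (A.tanc lam) (A.tbrk lam) X Y) z₀ = 0 := by
  obtain ⟨X₁, hX₁⟩ := A.exists_section_eq_lift hι hlam hn hX
  obtain ⟨Y₁, hY₁⟩ := A.exists_section_eq_lift hι hlam hn hY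
  obtain ⟨Z₁, hZ₁⟩ := A.exists_section_eq_lift hι hlam hn hZ
  have key : ∀ {P Q : Euc q → Euc l} {P₁ Q₁ : Cₛ^∞⟮𝓡 d; Euc r, V⟯},
      (∀ᶠ z in 𝓝 z₀, P₁ (ι z) = A.lift lam z (P z)) →
      (∀ᶠ z in 𝓝 z₀, Q₁ (ι z) = A.lift lam z (Q z)) →
      ∀ᶠ z in 𝓝 z₀, A.bracket P₁ Q₁ (ι z) =
        A.lift lam z (bracketFun (A.tanc lam) (A.tbrk lam) P Q z) := by
    intro P Q P₁ Q₁ hP hQ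
    filter_upwards [hP.eventually_nhds, hQ.eventually_nhds,
      (A.isOpen_nondegAt hι hlam).mem_nhds hn] with z h1 h2 h3
    exact A.bracket_eq_lift_bracketFun hι hlam h3 h1 h2
  have h := congrArg (fun S : Cₛ^∞⟮𝓡 d; Euc r, V⟯ ↦ S (ι z₀)) (A.jacobi X₁ Y₁ Z₁)
  simp only [ContMDiffSection.coe_add, ContMDiffSection.coe_zero, Pi.add_apply, Pi.zero_apply] at h
  rw [A.bracket_eq_lift_bracketFun hι hlam hn hX₁ (key hY₁ hZ₁),
    A.bracket_eq_lift_bracketFun hι hlam hn hY₁ (key hZ₁ hX₁),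
    A.bracket_eq_lift_bracketFun hι hlam hn hZ₁ (key hX₁ hY₁), ← map_add, ← map_add] at h
  exact A.lift_injective hι hn (h.trans (map_zero _).symm)

end LieAlgebroid

/-- The alternating bilinear map `(u, v) ↦ φ(u) v - φ(v) u`. -/
def smulRightAlt {E : Type*} [NormedAddCommGroup E] [NormedSpace ℝ E] (φ : E →L[ℝ] ℝ) :
    E →L[ℝ] E →L[ℝ] E :=
  φ.smulRight (ContinuousLinearMap.id ℝ E) - (φ.smulRight (ContinuousLinearMap.id ℝ E)).flip

theorem smulRightAlt_apply {E : Type*} [NormedAddCommGroup E] [NormedSpace ℝ E] (φ : E →L[ℝ] ℝ)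
    (u v : E) : smulRightAlt φ u v = φ u • v - φ v • u := by
  simp [smulRightAlt]

namespace LieAlgebroid

/-! ### Cutting off a locally defined structure. -/

section Cutoff

variable {q l : ℕ} (χ : Euc q → ℝ) (ρ : Euc q → Euc l →L[ℝ] Euc q)
  (f : Euc q → Euc l →L[ℝ] Euc l →L[ℝ] Euc l)

/-- The anchor multiplied by a function. -/
def cutAnc (z : Euc q) : Euc l →L[ℝ] Euc q := χ z • ρ z

/-- The structure functions of the bracket `(X, Y) ↦ χ⁻¹ [χ X, χ Y]`. -/
def cutBrk (z : Euc q) : Euc l →L[ℝ] Euc l →L[ℝ] Euc l :=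
  χ z • f z + smulRightAlt (fderiv ℝ χ z ∘L ρ z)

theorem cutBrk_apply (z : Euc q) (u v : Euc l) : cutBrk χ ρ f z u v =
    χ z • f z u v + fderiv ℝ χ z (ρ z u) • v - fderiv ℝ χ z (ρ z v) • u := by
  simp [cutBrk, smulRightAlt_apply, add_sub_assoc]

variable {χ ρ f}

/-- Multiplication by `χ` is a morphism from the new bracket to the old one. The new bracket has
smooth coefficients even at the zeros of `χ`, where dividing by `χ` would make no sense. -/
theorem smul_bracketFun_cut {X Y : Euc q → Euc l} {z : Euc q} (hχ : DifferentiableAt ℝ χ z)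
    (hX : DifferentiableAt ℝ X z) (hY : DifferentiableAt ℝ Y z) :
    χ z • bracketFun (cutAnc χ ρ) (cutBrk χ ρ f) X Y z =
      bracketFun ρ f (fun w ↦ χ w • X w) (fun w ↦ χ w • Y w) z := by
  rw [bracketFun_smul_right hχ hY, bracketFun_smul_left' hχ hX]
  simp only [bracketFun, cutBrk_apply, cutAnc, smul_apply, map_smul]
  module

variable {N : Set (Euc q)} (hχ : ContDiff ℝ ∞ χ) (hN : tsupport χ ⊆ N)
  (hρ : ∀ z ∈ N, ContDiffAt ℝ ∞ ρ z) (hf : ∀ z ∈ N, ContDiffAt ℝ ∞ f z)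
include hχ hN hρ

theorem contDiff_cutAnc : ContDiff ℝ ∞ (cutAnc χ ρ) := by
  refine contDiff_iff_contDiffAt.2 fun z ↦ ?_
  by_cases hz : z ∈ tsupport χ
  · exact hχ.contDiffAt.smul (hρ z (hN hz))
  · refine (contDiffAt_const (c := 0)).congr_of_eventuallyEq ?_
    filter_upwards [notMem_tsupport_iff_eventuallyEq.1 hz] with w hw
    have h1 : χ w = 0 := hw
    ext1 u
    simp [cutAnc, h1]

include hf

theorem contDiff_cutBrk : ContDiff ℝ ∞ (cutBrk χ ρ f) := by
  refine contDiff_clm_apply_iff.2 fun u ↦ contDiff_clm_apply_iff.2 fun v ↦ ?_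
  refine contDiff_iff_contDiffAt.2 fun z ↦ ?_
  simp only [cutBrk_apply]
  by_cases hz : z ∈ tsupport χ
  · have h1 : ContDiffAt ℝ ∞ (fderiv ℝ χ) z := hχ.contDiffAt.fderiv_right (by simp)
    have h2 : ∀ u, ContDiffAt ℝ ∞ (fun w ↦ fderiv ℝ χ w (ρ w u)) z := fun u ↦
      h1.clm_apply ((hρ z (hN hz)).clm_apply contDiffAt_const)
    exact ((hχ.contDiffAt.smul (((hf z (hN hz)).clm_apply contDiffAt_const).clm_apply
      contDiffAt_const)).add ((h2 u).smul contDiffAt_const)).sub ((h2 v).smul contDiffAt_const)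
  · refine (contDiffAt_const (c := 0)).congr_of_eventuallyEq ?_
    filter_upwards [(notMem_tsupport_iff_eventuallyEq.1 hz).eventually_nhds] with w hw
    have h0 : fderiv ℝ χ w = 0 := by
      rw [EventuallyEq.fderiv_eq hw]
      exact fderiv_const_apply 0
    have h1 : χ w = 0 := EventuallyEq.eq_of_nhds hw
    simp [h0, h1]

/-- Where `χ ≠ 0`, the morphism `X ↦ χ X` is injective and the identity is inherited. If the cyclic
sum were nonzero at `z`, it would be nonzero around `z` by continuity, so `χ` would vanish there;
but then the new bracket is zero at `z`. -/
theorem bracketFun_cut_jacobi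
    (hjac : ∀ z ∈ N, ∀ X Y Z : Euc q → Euc l, ContDiff ℝ ∞ X → ContDiff ℝ ∞ Y → ContDiff ℝ ∞ Z →
      bracketFun ρ f X (bracketFun ρ f Y Z) z + bracketFun ρ f Y (bracketFun ρ f Z X) z +
        bracketFun ρ f Z (bracketFun ρ f X Y) z = 0) {X Y Z : Euc q → Euc l}
    (hX : ContDiff ℝ ∞ X) (hY : ContDiff ℝ ∞ Y) (hZ : ContDiff ℝ ∞ Z) (z : Euc q) :
    bracketFun (cutAnc χ ρ) (cutBrk χ ρ f) X
        (bracketFun (cutAnc χ ρ) (cutBrk χ ρ f) Y Z) z +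
      bracketFun (cutAnc χ ρ) (cutBrk χ ρ f) Y
        (bracketFun (cutAnc χ ρ) (cutBrk χ ρ f) Z X) z +
      bracketFun (cutAnc χ ρ) (cutBrk χ ρ f) Z
        (bracketFun (cutAnc χ ρ) (cutBrk χ ρ f) X Y) z = 0 := by
  set b := bracketFun (cutAnc χ ρ) (cutBrk χ ρ f) with hb
  have hsm : ∀ {P Q : Euc q → Euc l}, ContDiff ℝ ∞ P → ContDiff ℝ ∞ Q → ContDiff ℝ ∞ (b P Q) :=
    fun hP hQ ↦ contDiff_iff_contDiffAt.2 fun z ↦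
      contDiffAt_bracketFun (contDiff_cutAnc hχ hN hρ).contDiffAt
        (contDiff_cutBrk hχ hN hρ hf).contDiffAt hP.contDiffAt hQ.contDiffAt
  have hd : ∀ {P : Euc q → Euc l}, ContDiff ℝ ∞ P → ∀ w, DifferentiableAt ℝ P w :=
    fun hP w ↦ hP.differentiable (by simp) w
  have hχd : ∀ w, DifferentiableAt ℝ χ w := fun w ↦ hχ.differentiable (by simp) w
  have hcut : ∀ {P Q : Euc q → Euc l}, ContDiff ℝ ∞ P → ContDiff ℝ ∞ Q →
      ∀ w, χ w • b P Q w = bracketFun ρ f (fun w ↦ χ w • P w) (fun w ↦ χ w • Q w) w :=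
    fun hP hQ w ↦ smul_bracketFun_cut (hχd w) (hd hP w) (hd hQ w)
  have hcut2 : ∀ {P Q R : Euc q → Euc l}, ContDiff ℝ ∞ P → ContDiff ℝ ∞ Q → ContDiff ℝ ∞ R →
      ∀ w, χ w • b P (b Q R) w = bracketFun ρ f (fun w ↦ χ w • P w)
        (bracketFun ρ f (fun w ↦ χ w • Q w) (fun w ↦ χ w • R w)) w := by
    intro P Q R hP hQ hR w
    rw [hcut hP (hsm hQ hR), funext (hcut hQ hR)]
  have hne : ∀ w, χ w ≠ 0 → b X (b Y Z) w + b Y (b Z X) w + b Z (b X Y) w = 0 := by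
    intro w hw
    have h := hjac w (hN (subset_tsupport _ hw)) _ _ _ (hχ.smul hX) (hχ.smul hY) (hχ.smul hZ)
    have h2 : χ w • (b X (b Y Z) w + b Y (b Z X) w + b Z (b X Y) w) = 0 := by
      rw [smul_add, smul_add, hcut2 hX hY hZ, hcut2 hY hZ hX, hcut2 hZ hX hY]
      exact h
    exact (smul_eq_zero.1 h2).resolve_left hw
  by_contra hj
  have hcont : Continuous fun w ↦ b X (b Y Z) w + b Y (b Z X) w + b Z (b X Y) w :=
    (((hsm hX (hsm hY hZ)).add (hsm hY (hsm hZ hX))).add (hsm hZ (hsm hX hY))).continuous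
  have hχ0 : χ =ᶠ[𝓝 z] fun _ ↦ 0 := by
    filter_upwards [hcont.continuousAt.eventually_ne hj] with w hw
    by_contra h
    exact hw (hne w h)
  have h0 : ∀ P Q, b P Q z = 0 := by
    intro P Q
    have h1 : fderiv ℝ χ z = 0 := by
      rw [hχ0.fderiv_eq]
      exact fderiv_const_apply 0
    have h2 : χ z = 0 := hχ0.eq_of_nhds
    simp [hb, bracketFun, cutBrk_apply, cutAnc, h1, h2]
  exact hj (by simp only [h0, add_zero])

end Cutoff

variable {d r : ℕ} {M : Type*} [TopologicalSpace M] [ChartedSpace (Euc d) M]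
  {V : M → Type*} [TopologicalSpace (TotalSpace (Euc r) V)]
  [∀ x, AddCommGroup (V x)] [∀ x, Module ℝ (V x)] [∀ x, TopologicalSpace (V x)]
  [FiberBundle (Euc r) V] [VectorBundle ℝ (Euc r) V]
  [T2Space M] [IsManifold (𝓡 d) ∞ M] [ContMDiffVectorBundle ∞ (Euc r) V (𝓡 d)]
  (A : LieAlgebroid d r M V) {q l : ℕ} {ι : Euc q → M}
  {lam : ∀ z, V (ι z) →ₗ[ℝ] Euc l}

/-- A transversal structure which is defined near the support of a cutoff function gives rise to a
Lie algebroid structure on the whole trivial bundle, which coincides with it where the cutoff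
function is one. -/
theorem exists_cutoff_algebroid (hι : IsSmoothEmbedding (𝓡 q) (𝓡 d) ∞ ι)
    (hlam : ∀ x₀ z, ι z ∈ (trivializationAt (Euc r) V x₀).baseSet →
      ContDiffAt ℝ ∞ (fiberMatrix (r := r) lam x₀) z) {χ : Euc q → ℝ} (hχ : ContDiff ℝ ∞ χ)
    (hχN : ∀ z ∈ tsupport χ, A.NondegAt lam z) :
    ∃ B : LieAlgebroid q l (Euc q) (Bundle.Trivial (Euc q) (Euc l)),
      ∀ z, (∀ᶠ w in 𝓝 z, χ w = 1) → ∀ x₀,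
        B.anc x₀ z = A.tanc lam z ∧ B.brk x₀ z = A.tbrk lam z := by
  have hN : tsupport χ ⊆ {z | A.NondegAt lam z} := hχN
  have hρ : ∀ z ∈ {z | A.NondegAt lam z}, ContDiffAt ℝ ∞ (A.tanc lam) z :=
    fun z hz ↦ A.contDiffAt_tanc hι hlam hz
  have hf : ∀ z ∈ {z | A.NondegAt lam z}, ContDiffAt ℝ ∞ (A.tbrk lam) z :=
    fun z hz ↦ A.contDiffAt_tbrk hι hlam hz
  refine ⟨ofCoeff (contDiff_cutAnc hχ hN hρ) (contDiff_cutBrk hχ hN hρ hf) ?_ ?_, ?_⟩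
  · intro z u
    rw [cutBrk_apply, add_sub_cancel_right]
    by_cases hz : χ z = 0
    · rw [hz, zero_smul]
    · rw [A.tbrk_self hι hlam (hN (subset_tsupport _ hz)), smul_zero]
  · intro X Y Z hX hY hZ z
    exact bracketFun_cut_jacobi hχ hN hρ hf (fun z hz X Y Z hX hY hZ ↦
      A.bracketFun_jacobi hι hlam hz (Eventually.of_forall fun _ ↦ hX.contDiffAt)
        (Eventually.of_forall fun _ ↦ hY.contDiffAt) (Eventually.of_forall fun _ ↦ hZ.contDiffAt))
      hX hY hZ z
  · intro z hz x₀
    have h1 : fderiv ℝ χ z = 0 := by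
      rw [EventuallyEq.fderiv_eq hz]
      exact fderiv_const_apply 1
    have h2 : χ z = 1 := hz.self_of_nhds
    rw [anc_ofCoeff, brk_ofCoeff]
    refine ⟨by simp [cutAnc, h2], ?_⟩
    ext1 u
    ext1 v
    simp [cutBrk_apply, h1, h2]

end LieAlgebroid

/-! ### Continuous dependence of the transversal structure on the algebroid. -/

namespace CsTendsto


variable {ι : Type*} {E F : Type u} [NormedAddCommGroup E] [NormedSpace ℝ E]
    [NormedAddCommGroup F] [NormedSpace ℝ F] {l : Filter ι} {s : ℕ} {K : Set E}

theorem sum {κ : Type*} (t : Finset κ) {f : κ → ι → E → F} {g : κ → E → F}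
    (hf : ∀ i, ∀ᶠ b in l, ∀ z ∈ K, ContDiffAt ℝ ∞ (f i b) z)
    (hg : ∀ i, ∀ z ∈ K, ContDiffAt ℝ ∞ (g i) z) (h : ∀ i, CsTendsto l s K (f i) (g i)) :
    CsTendsto l s K (fun b z ↦ ∑ i ∈ t, f i b z) (fun z ↦ ∑ i ∈ t, g i z) := by
  classical
  induction t using Finset.induction_on with
  | empty =>
    simp only [Finset.sum_empty]
    exact const _
  | insert i t hi ih =>
    simp only [Finset.sum_insert hi]
    refine add (hf i) (hg i) ?_ (fun z hz ↦ ContDiffAt.sum fun j _ ↦ hg j z hz) (h i) ih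
    filter_upwards [(Finset.eventually_all t).2 fun j _ ↦ hf j] with b hb z hz
    exact ContDiffAt.sum fun j hj ↦ hb j hj z hz

theorem of_forall_exists_mem_nhds {f : ι → E → F} {g : E → F} (hK : IsCompact K)
    (h : ∀ z ∈ K, ∃ t ∈ 𝓝 z, CsTendsto l s t f g) : CsTendsto l s K f g := by
  refine hK.induction_on (p := fun t ↦ CsTendsto l s t f g) ?_ ?_ ?_ ?_
  · exact fun ε _ ↦ Eventually.of_forall fun _ z hz ↦ hz.elim
  · exact fun t t' htt' h ↦ h.mono_set htt'
  · intro t t' h h' ε hε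
    filter_upwards [h ε hε, h' ε hε] with b hb hb' z hz
    exact hz.elim (hb z) (hb' z)
  · intro z hz
    obtain ⟨t, ht, h⟩ := h z hz
    exact ⟨t, mem_nhdsWithin_of_mem_nhds ht, h⟩

end CsTendsto

/-- The convergence of the bivector field is known along each vector of the dual frame separately;
this splitting lets `CsTendsto.sum` assemble the results. -/
theorem bracketOf_eq_sum {d r : ℕ} (p : Fin r → Fin r ⊕ Fin d → Fin r ⊕ Fin d → ℝ) :
    bracketOf p = ∑ s, bracketOf (Pi.single s (p s)) := by
  have h : ∀ s t (i j : Fin r), (Pi.single (M := fun _ ↦ Fin r ⊕ Fin d → Fin r ⊕ Fin d → ℝ) s (p s)) t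
      (.inl i) (.inl j) = if t = s then p s (.inl i) (.inl j) else 0 := by
    intro s t i j
    by_cases hst : t = s
    · subst hst; simp
    · simp [hst]
  ext u v t
  simp only [bracketOf, _root_.sum_apply, smul_apply, h]
  simp
  rw [eq_comm, Finset.sum_comm]
  exact Finset.sum_congr rfl fun i _ ↦ Finset.sum_comm

namespace LieAlgebroid

variable {d r : ℕ} {M : Type*} [TopologicalSpace M] [ChartedSpace (Euc d) M]
  {V : M → Type*} [TopologicalSpace (TotalSpace (Euc r) V)]
  [∀ x, AddCommGroup (V x)] [∀ x, Module ℝ (V x)] [∀ x, TopologicalSpace (V x)]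
  [FiberBundle (Euc r) V] [VectorBundle ℝ (Euc r) V]
  [T2Space M] [IsManifold (𝓡 d) ∞ M] [ContMDiffVectorBundle ∞ (Euc r) V (𝓡 d)]
  (A : LieAlgebroid d r M V) {q l : ℕ} {ι : Euc q → M}
  {lam : ∀ z, V (ι z) →ₗ[ℝ] Euc l}

theorem csTendsto_poisson (s : ℕ) (x₀ : M) {K : Set (Euc d × Euc r)} (hK : IsCompact K)
    (hKs : K ⊆ fiberedRange d r V x₀) :
    CsTendsto (A.csNhds s) s K (fun B ↦ B.poisson x₀) (A.poisson x₀) := by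
  intro ε hε
  exact mem_iInf_of_mem x₀ (mem_iInf_of_mem K (mem_iInf_of_mem hK (mem_iInf_of_mem hKs
    (mem_iInf_of_mem ε (mem_iInf_of_mem hε (mem_principal_self _))))))

theorem contDiffAt_poisson {x₀ : M} {z : Euc d × Euc r} (hz : z ∈ fiberedRange d r V x₀) :
    ContDiffAt ℝ ∞ (A.poisson x₀) z :=
  (A.contDiffOn_poisson x₀).contDiffAt ((isOpen_fiberedRange x₀).mem_nhds hz)

variable (hι : IsSmoothEmbedding (𝓡 q) (𝓡 d) ∞ ι)
  (hlam : ∀ x₀ z, ι z ∈ (trivializationAt (Euc r) V x₀).baseSet →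
    ContDiffAt ℝ ∞ (fiberMatrix (r := r) lam x₀) z)

include hι

/-- Restriction to the disc, with a constant fiber coordinate `y`. Taking `y = 0` serves to read the
anchor, and the basis vectors to read the structure functions. -/
theorem csTendsto_poisson_comp (s : ℕ) {x₀ : M} {K : Set (Euc q)} (hK : IsCompact K)
    (hKs : ∀ z ∈ K, ι z ∈ fiberedDomain d r V x₀) (y : Euc r) :
    (∀ B : LieAlgebroid d r M V, ∀ z ∈ K,
      ContDiffAt ℝ ∞ (fun z ↦ B.poisson x₀ (chartAt (Euc d) x₀ (ι z), y)) z) ∧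
    CsTendsto (A.csNhds s) s K (fun B z ↦ B.poisson x₀ (chartAt (Euc d) x₀ (ι z), y))
      (fun z ↦ A.poisson x₀ (chartAt (Euc d) x₀ (ι z), y)) := by
  have hh : ∀ z ∈ K, ContDiffAt ℝ ∞ (fun z ↦ (chartAt (Euc d) x₀ (ι z), y)) z := fun z hz ↦
    (contDiffAt_chart_comp hι (hKs z hz).1).prodMk contDiffAt_const
  have hr : ∀ z ∈ K, (chartAt (Euc d) x₀ (ι z), y) ∈ fiberedRange d r V x₀ := by
    intro z hz
    refine ⟨(chartAt (Euc d) x₀).map_source (hKs z hz).1, ?_⟩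
    rw [(chartAt (Euc d) x₀).left_inv (hKs z hz).1]
    exact hKs z hz
  have hKi : IsCompact ((fun z ↦ (chartAt (Euc d) x₀ (ι z), y)) '' K) :=
    hK.image_of_continuousOn fun z hz ↦ (hh z hz).continuousAt.continuousWithinAt
  have hKr : (fun z ↦ (chartAt (Euc d) x₀ (ι z), y)) '' K ⊆ fiberedRange d r V x₀ := by
    rintro _ ⟨z, hz, rfl⟩
    exact hr z hz
  refine ⟨fun B z hz ↦ ContDiffAt.comp (g := B.poisson x₀) z (B.contDiffAt_poisson (hr z hz))
    (hh z hz), ?_⟩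
  exact CsTendsto.comp_right hK hh (Set.mapsTo_image _ K)
    (Eventually.of_forall fun B z hz ↦ B.contDiffAt_poisson (hKr hz))
    (fun z hz ↦ A.contDiffAt_poisson (hKr hz)) (A.csTendsto_poisson s x₀ hKi hKr)

theorem csTendsto_anc (s : ℕ) {x₀ : M} {K : Set (Euc q)} (hK : IsCompact K)
    (hKs : ∀ z ∈ K, ι z ∈ fiberedDomain d r V x₀) :
    CsTendsto (A.csNhds s) s K (fun B z ↦ B.anc x₀ (ι z)) (fun z ↦ A.anc x₀ (ι z)) := by
  obtain ⟨h1, h2⟩ := A.csTendsto_poisson_comp hι s hK hKs 0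
  have h3 := CsTendsto.comp hK (Eventually.of_forall h1) (h1 A) isOpen_univ (Set.mapsTo_univ _ _)
    contDiff_anchorOf.contDiffOn h2
  have h4 : ∀ B : LieAlgebroid d r M V, ∀ z ∈ K, (fun z ↦ B.anc x₀ (ι z)) =ᶠ[𝓝 z]
      fun z ↦ anchorOf (B.poisson x₀ (chartAt (Euc d) x₀ (ι z), 0)) := by
    intro B z hz
    filter_upwards [eventually_mem_fiberedDomain hι (hKs z hz)] with w hw
    rw [B.anchorOf_poisson x₀ hw.1]
  exact h3.congr_eventually (Eventually.of_forall h4) (h4 A)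

theorem csTendsto_brk (s : ℕ) {x₀ : M} {K : Set (Euc q)} (hK : IsCompact K)
    (hKs : ∀ z ∈ K, ι z ∈ fiberedDomain d r V x₀) :
    CsTendsto (A.csNhds s) s K (fun B z ↦ B.brk x₀ (ι z)) (fun z ↦ A.brk x₀ (ι z)) := by
  have hs : ∀ t : Fin r, ContDiff ℝ ∞ (fun p : Fin r ⊕ Fin d → Fin r ⊕ Fin d → ℝ ↦
      bracketOf (Pi.single (M := fun _ ↦ Fin r ⊕ Fin d → Fin r ⊕ Fin d → ℝ) t p)) := fun t ↦
    contDiff_bracketOf.comp (ContinuousLinearMap.single ℝ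
      (fun _ ↦ Fin r ⊕ Fin d → Fin r ⊕ Fin d → ℝ) t).contDiff
  have h1 := fun t : Fin r ↦ (A.csTendsto_poisson_comp hι s hK hKs (stdBasis r t)).1
  have h2 := fun t : Fin r ↦ (A.csTendsto_poisson_comp hι s hK hKs (stdBasis r t)).2
  have h3 := fun t : Fin r ↦ CsTendsto.comp hK (Eventually.of_forall (h1 t)) (h1 t A) isOpen_univ
    (Set.mapsTo_univ _ _) (hs t).contDiffOn (h2 t)
  have h4 := CsTendsto.sum Finset.univ
    (fun t ↦ Eventually.of_forall fun B z hz ↦ (hs t).contDiffAt.comp z (h1 t B z hz))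
    (fun t z hz ↦ (hs t).contDiffAt.comp z (h1 t A z hz)) h3
  have h5 : ∀ B : LieAlgebroid d r M V, ∀ z ∈ K, (fun z ↦ B.brk x₀ (ι z)) =ᶠ[𝓝 z]
      fun z ↦ ∑ t, bracketOf (Pi.single (M := fun _ ↦ Fin r ⊕ Fin d → Fin r ⊕ Fin d → ℝ) t
        (B.poisson x₀ (chartAt (Euc d) x₀ (ι z), stdBasis r t))) := by
    intro B z hz
    filter_upwards [eventually_mem_fiberedDomain hι (hKs z hz)] with w hw
    rw [← B.bracketOf_poisson x₀ hw.1, bracketOf_eq_sum]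
  exact h4.congr_eventually (Eventually.of_forall h5) (h5 A)

theorem exists_compact_mem_nhds_fiberedDomain (z : Euc q) :
    ∃ K ∈ 𝓝 z, IsCompact K ∧ ∀ w ∈ K, ι w ∈ fiberedDomain d r V (ι z) := by
  obtain ⟨K, hK, hKs, hKc⟩ := local_compact_nhds
    (eventually_mem_fiberedDomain hι (mem_fiberedDomain (d := d) (r := r) (V := V) (ι z)))
  exact ⟨K, hK, hKc, hKs⟩

include hlam

/-- Only the last two components depend on the algebroid, and they enter undifferentiated; the
others are constant along the filter. -/
theorem csTendsto_coordData (s : ℕ) {x₀ : M} {K : Set (Euc q)} (hK : IsCompact K)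
    (hKs : ∀ z ∈ K, ι z ∈ fiberedDomain d r V x₀) :
    CsTendsto (A.csNhds s) s K (fun B ↦ B.coordData lam x₀) (A.coordData lam x₀) := by
  have hιs := contMDiff_of_isSmoothEmbedding hι
  have c1 : ∀ z ∈ K, ContDiffAt ℝ ∞ (fiberMatrix (r := r) lam x₀) z :=
    fun z hz ↦ hlam x₀ z (hKs z hz).2
  have c2 : ∀ z ∈ K, ContDiffAt ℝ ∞ (fderiv ℝ (fiberMatrix (r := r) lam x₀)) z :=
    fun z hz ↦ (c1 z hz).fderiv_right (by simp)
  have c3 : ∀ z ∈ K, ContDiffAt ℝ ∞ (fderiv ℝ (fun w ↦ chartAt (Euc d) x₀ (ι w))) z :=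
    fun z hz ↦ (contDiffAt_chart_comp hι (hKs z hz).1).fderiv_right (by simp)
  have c4 : ∀ B : LieAlgebroid d r M V, ∀ z ∈ K, ContDiffAt ℝ ∞ (fun z ↦ B.anc x₀ (ι z)) z :=
    fun B z hz ↦ ((B.contMDiffAt_anc (hKs z hz)).comp z hιs.contMDiffAt).contDiffAt
  have c5 : ∀ B : LieAlgebroid d r M V, ∀ z ∈ K, ContDiffAt ℝ ∞ (fun z ↦ B.brk x₀ (ι z)) z :=
    fun B z hz ↦ ((B.contMDiffAt_brk (hKs z hz).2).comp z hιs.contMDiffAt).contDiffAt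
  have t4 := CsTendsto.prodMk (Eventually.of_forall c4) (c4 A) (Eventually.of_forall c5) (c5 A)
    (A.csTendsto_anc hι s hK hKs) (A.csTendsto_brk hι s hK hKs)
  have c4' := fun (B : LieAlgebroid d r M V) z hz ↦ (c4 B z hz).prodMk (c5 B z hz)
  have t3 := CsTendsto.prodMk (Eventually.of_forall fun _ ↦ c3) c3 (Eventually.of_forall c4')
    (c4' A) (CsTendsto.const _) t4
  have c3' := fun (B : LieAlgebroid d r M V) z hz ↦ (c3 z hz).prodMk (c4' B z hz)
  have t2 := CsTendsto.prodMk (Eventually.of_forall fun _ ↦ c2) c2 (Eventually.of_forall c3')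
    (c3' A) (CsTendsto.const _) t3
  have c2' := fun (B : LieAlgebroid d r M V) z hz ↦ (c2 z hz).prodMk (c3' B z hz)
  exact CsTendsto.prodMk (Eventually.of_forall fun _ ↦ c1) c1 (Eventually.of_forall c2')
    (c2' A) (CsTendsto.const _) t2

theorem eventually_nondegAt_of_fiberedDomain (s : ℕ) {x₀ : M} {K : Set (Euc q)} (hK : IsCompact K)
    (hKs : ∀ z ∈ K, ι z ∈ fiberedDomain d r V x₀) (hn : ∀ z ∈ K, A.NondegAt lam z) :
    ∀ᶠ B in A.csNhds s, ∀ z ∈ K, B.NondegAt lam z := by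
  filter_upwards [(A.csTendsto_coordData hι hlam s hK hKs).eventually_mapsTo hK
    (fun z hz ↦ A.contDiffAt_coordData hι hlam (hKs z hz)) CoordData.isOpen_nondeg
    fun z hz ↦ (A.nondegAt_iff hι (hKs z hz)).1 (hn z hz)] with B hB z hz
  exact (B.nondegAt_iff hι (hKs z hz)).2 (hB hz)

/-- A compact set is covered by finitely many compact pieces lying each in a single chart, and the
condition is open on each. -/
theorem eventually_nondegAt (s : ℕ) {K : Set (Euc q)} (hK : IsCompact K)
    (hn : ∀ z, A.NondegAt lam z) : ∀ᶠ B in A.csNhds s, ∀ z ∈ K, B.NondegAt lam z := by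
  refine hK.induction_on (p := fun t ↦ ∀ᶠ B in A.csNhds s, ∀ z ∈ t, B.NondegAt lam z) ?_ ?_ ?_ ?_
  · exact Eventually.of_forall fun _ z hz ↦ hz.elim
  · exact fun t t' htt' h ↦ h.mono fun B hB z hz ↦ hB z (htt' hz)
  · intro t t' h h'
    filter_upwards [h, h'] with B hB hB' z hz
    exact hz.elim (hB z) (hB' z)
  · intro z hz
    obtain ⟨t, ht, htc, hts⟩ := exists_compact_mem_nhds_fiberedDomain (r := r) (V := V) hι z
    exact ⟨t, mem_nhdsWithin_of_mem_nhds ht,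
      A.eventually_nondegAt_of_fiberedDomain hι hlam s htc hts fun z _ ↦ hn z⟩

/-- The coefficients of the transversal structure depend continuously on the Lie algebroid
structure, without loss of derivatives. -/
theorem csTendsto_tanc_tbrk (s : ℕ) {K : Set (Euc q)} (hK : IsCompact K)
    (hn : ∀ z, A.NondegAt lam z) :
    CsTendsto (A.csNhds s) s K (fun B z ↦ (B.tanc lam z, B.tbrk lam z))
      (fun z ↦ (A.tanc lam z, A.tbrk lam z)) := by
  refine CsTendsto.of_forall_exists_mem_nhds hK fun z _ ↦ ?_
  obtain ⟨t, ht, htc, hts⟩ := exists_compact_mem_nhds_fiberedDomain (r := r) (V := V) hι z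
  refine ⟨t, ht, ?_⟩
  have h1 := CsTendsto.comp htc (Eventually.of_forall fun B w hw ↦
      B.contDiffAt_coordData hι hlam (hts w hw))
    (fun w hw ↦ A.contDiffAt_coordData hι hlam (hts w hw)) CoordData.isOpen_nondeg
    (fun w hw ↦ (A.nondegAt_iff hι (hts w hw)).1 (hn w))
    (CoordData.contDiffOn_anc.prodMk CoordData.contDiffOn_brk)
    (A.csTendsto_coordData hι hlam s htc hts)
  have h2 : ∀ B : LieAlgebroid d r M V, (∀ w ∈ t, B.NondegAt lam w) → ∀ w ∈ t,
      (fun z ↦ (B.tanc lam z, B.tbrk lam z)) =ᶠ[𝓝 w]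
      fun w ↦ ((B.coordData lam (ι z) w).anc, (B.coordData lam (ι z) w).brk) := by
    intro B hB w hw
    filter_upwards [eventually_mem_fiberedDomain hι (hts w hw),
      (B.isOpen_nondegAt hι hlam).mem_nhds (hB w hw)] with v h1 h2
    rw [B.tanc_eq hι h1 h2, B.tbrk_eq hι hlam h1 h2]
  exact h1.congr_eventually ((A.eventually_nondegAt_of_fiberedDomain hι hlam s htc hts
    fun w _ ↦ hn w).mono h2) (h2 A fun w _ ↦ hn w)

theorem csTendsto_poissonOf (s : ℕ) {K : Set (Euc q)} (hK : IsCompact K) {K' : Set (Euc l)}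
    (hK' : IsCompact K') (hn : ∀ z, A.NondegAt lam z) :
    CsTendsto (A.csNhds s) s (K ×ˢ K')
      (fun B (z : Euc q × Euc l) ↦ poissonOf (B.tanc lam z.1) (B.tbrk lam z.1) z.2)
      (fun z ↦ poissonOf (A.tanc lam z.1) (A.tbrk lam z.1) z.2) := by
  have hsm : ∀ B : LieAlgebroid d r M V, (∀ w ∈ K, B.NondegAt lam w) → ∀ z ∈ K,
      ContDiffAt ℝ ∞ (fun z ↦ (B.tanc lam z, B.tbrk lam z)) z := fun B hB z hz ↦
    (B.contDiffAt_tanc hι hlam (hB z hz)).prodMk (B.contDiffAt_tbrk hι hlam (hB z hz))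
  have hev := (A.eventually_nondegAt hι hlam s hK hn).mono hsm
  have hA := hsm A fun w _ ↦ hn w
  have h1 := CsTendsto.comp_right (hK.prod hK') (h := Prod.fst)
    (fun z _ ↦ contDiff_fst.contDiffAt) (fun z hz ↦ hz.1) hev hA
    (A.csTendsto_tanc_tbrk hι hlam s hK hn)
  have hf : ∀ᶠ B in A.csNhds s, ∀ z ∈ K ×ˢ K',
      ContDiffAt ℝ ∞ (fun z : Euc q × Euc l ↦ (B.tanc lam z.1, B.tbrk lam z.1)) z :=
    hev.mono fun B hB z hz ↦ (hB z.1 hz.1).comp z contDiff_fst.contDiffAt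
  have hg : ∀ z ∈ K ×ˢ K',
      ContDiffAt ℝ ∞ (fun z : Euc q × Euc l ↦ (A.tanc lam z.1, A.tbrk lam z.1)) z :=
    fun z hz ↦ (hA z.1 hz.1).comp z contDiff_fst.contDiffAt
  have h2 := CsTendsto.prodMk hf hg
    (f₂ := fun _ ↦ Prod.snd) (Eventually.of_forall fun _ z _ ↦ contDiff_snd.contDiffAt)
    (fun z _ ↦ contDiff_snd.contDiffAt) h1 (CsTendsto.const _)
  exact CsTendsto.comp (hK.prod hK') (hf.mono fun B hB z hz ↦
      (hB z hz).prodMk contDiff_snd.contDiffAt)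
    (fun z hz ↦ (hg z hz).prodMk contDiff_snd.contDiffAt) isOpen_univ (Set.mapsTo_univ _ _)
    (Ψ := fun p : ((Euc l →L[ℝ] Euc q) × (Euc l →L[ℝ] Euc l →L[ℝ] Euc l)) × Euc l ↦
      poissonOf p.1.1 p.1.2 p.2)
    (contDiff_poissonOf.comp ((contDiff_fst.comp contDiff_fst).prodMk
      ((contDiff_snd.comp contDiff_fst).prodMk contDiff_snd))).contDiffOn h2

end LieAlgebroid

namespace LieAlgebroid

/-! ### The `C^s`-topology over a vector space. -/

section Basis

variable {q l : ℕ}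

theorem poisson_trivial (B : LieAlgebroid q l (Euc q) (Bundle.Trivial (Euc q) (Euc l)))
    (x₀ : Euc q) (z : Euc q × Euc l) :
    B.poisson x₀ z = poissonOf (B.anc x₀ z.1) (B.brk x₀ z.1) z.2 := by
  rw [B.poisson_eq_poissonOf]
  rfl

/-- On a trivial bundle over a vector space, closeness for the `C^s`-topology is closeness on a
large ball. -/
theorem exists_ball_of_eventually_csNhds
    (B : LieAlgebroid q l (Euc q) (Bundle.Trivial (Euc q) (Euc l))) (s : ℕ)
    {P : LieAlgebroid q l (Euc q) (Bundle.Trivial (Euc q) (Euc l)) → Prop}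
    (h : ∀ᶠ B' in B.csNhds s, P B') :
    ∃ R > 0, ∃ ε > 0, ∀ B' : LieAlgebroid q l (Euc q) (Bundle.Trivial (Euc q) (Euc l)),
      (∀ x₀, ∀ z ∈ Metric.closedBall (0 : Euc q) R ×ˢ Metric.closedBall (0 : Euc l) R, ∀ j ≤ s,
        ‖iteratedFDeriv ℝ j (fun w ↦ B'.poisson x₀ w - B.poisson x₀ w) z‖ < ε) → P B' := by
  -- A decreasing sequence of conditions, each imposed for all `x₀` at once, on balls of radius `n +
  -- 1` and with tolerance `1 / (n + 1)`. Every generator of the filter is implied by one of them,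
  -- with `n` beyond both the size of `K` and `1 / ε`.
  set S : ℕ → Set (LieAlgebroid q l (Euc q) (Bundle.Trivial (Euc q) (Euc l))) := fun n ↦
    {B' | ∀ x₀, ∀ z ∈ Metric.closedBall (0 : Euc q) (n + 1) ×ˢ Metric.closedBall (0 : Euc l) (n + 1),
      ∀ j ≤ s, ‖iteratedFDeriv ℝ j (fun w ↦ B'.poisson x₀ w - B.poisson x₀ w) z‖ < 1 / (n + 1 : ℝ)}
    with hS
  have hanti : Antitone S := by
    intro m n hmn B' hB' x₀ z hz j hj
    have hmn' : (m : ℝ) ≤ n := by exact_mod_cast hmn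
    exact (hB' x₀ z (Set.prod_mono (Metric.closedBall_subset_closedBall (by linarith))
      (Metric.closedBall_subset_closedBall (by linarith)) hz) j hj).trans_le
      (one_div_le_one_div_of_le (by positivity) (by linarith))
  have hle : (⨅ n, 𝓟 (S n)) ≤ B.csNhds s := by
    refine le_iInf fun x₀ ↦ le_iInf fun K ↦ le_iInf fun hK ↦ le_iInf fun _ ↦ le_iInf fun ε ↦
      le_iInf fun hε ↦ ?_
    obtain ⟨C, hC⟩ := hK.isBounded.exists_norm_le
    obtain ⟨n, hn⟩ := exists_nat_gt (max C (1 / ε))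
    refine (iInf_le _ n).trans (principal_mono.2 fun B' hB' z hz j hj ↦ ?_)
    have hz' : ‖z‖ ≤ n + 1 := (hC z hz).trans (by linarith [le_max_left C (1 / ε)])
    refine (hB' x₀ z ⟨?_, ?_⟩ j hj).trans ?_
    · simpa using (norm_fst_le z).trans hz'
    · simpa using (norm_snd_le z).trans hz'
    · rw [one_div_lt (by positivity) hε]
      linarith [le_max_right C (1 / ε)]
  have hmem : {B' | P B'} ∈ ⨅ n, 𝓟 (S n) := hle h
  -- The sequence being decreasing, belonging to the infimum of the principal filters means
  -- containing a single `S n`.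
  rw [mem_iInf_of_directed (directed_of_isDirected_le fun m n hmn ↦
    principal_mono.2 (hanti hmn))] at hmem
  obtain ⟨n, hn⟩ := hmem
  exact ⟨n + 1, by positivity, 1 / (n + 1 : ℝ), by positivity, fun B' hB' ↦ hn hB'⟩

end Basis

/-! ### Ranks on the disc, and comparison with the given transversal structure. -/

variable {d r : ℕ} {M : Type*} [TopologicalSpace M] [ChartedSpace (Euc d) M]
  {V : M → Type*} [TopologicalSpace (TotalSpace (Euc r) V)]
  [∀ x, AddCommGroup (V x)] [∀ x, Module ℝ (V x)] [∀ x, TopologicalSpace (V x)]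
  [FiberBundle (Euc r) V] [VectorBundle ℝ (Euc r) V]
  [T2Space M] [IsManifold (𝓡 d) ∞ M] [ContMDiffVectorBundle ∞ (Euc r) V (𝓡 d)]
  {A : LieAlgebroid d r M V} {q l : ℕ} {ι : Euc q → M}

theorem finrank_range_mfderiv (hι : IsSmoothEmbedding (𝓡 q) (𝓡 d) ∞ ι) (z : Euc q) :
    Module.finrank ℝ (LinearMap.range (mfderiv (𝓡 q) (𝓡 d) ι z).toLinearMap) = q := by
  have h := LinearMap.finrank_range_of_inj (f := (mfderiv (𝓡 q) (𝓡 d) ι z).toLinearMap)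
    (mfderiv_injective hι z)
  rw [h]
  exact finrank_euclideanSpace_fin

theorem finrank_anchor_add_of_isCompl (hι : IsSmoothEmbedding (𝓡 q) (𝓡 d) ∞ ι) {z : Euc q}
    (h : IsCompl (LinearMap.range (A.anchor (ι z)))
      (LinearMap.range (mfderiv (𝓡 q) (𝓡 d) ι z).toLinearMap)) :
    Module.finrank ℝ (LinearMap.range (A.anchor (ι z))) + q = d := by
  have hf : FiniteDimensional ℝ (TangentSpace (𝓡 d) (ι z)) :=
    inferInstanceAs (FiniteDimensional ℝ (Euc d))
  have h1 := Submodule.finrank_add_eq_of_isCompl h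
  rw [finrank_range_mfderiv hι z] at h1
  exact h1.trans finrank_euclideanSpace_fin

/-- A vector tangent to the disc and in the image of the anchor is `dι (tanc u)` for some `u`, hence
zero. Surjectivity in `NondegAt`, used on the pairs `(0, t)`, shows that the two subspaces span. -/
theorem isCompl_of_tanc_eq_zero {lam : ∀ z, V (ι z) →ₗ[ℝ] Euc l}
    (hι : IsSmoothEmbedding (𝓡 q) (𝓡 d) ∞ ι) {z : Euc q} (hn : A.NondegAt lam z)
    (h : A.tanc lam z = 0) : IsCompl (LinearMap.range (A.anchor (ι z)))
      (LinearMap.range (mfderiv (𝓡 q) (𝓡 d) ι z).toLinearMap) := by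
  refine ⟨Submodule.disjoint_def.2 ?_, codisjoint_iff.2 (eq_top_iff.2 fun t _ ↦ ?_)⟩
  · rintro _ ⟨v, rfl⟩ ⟨ξ, hξ⟩
    have h1 := (A.eq_lift_of_anchor_eq hι hn (v := v) (ξ := ξ) hξ.symm).2
    rw [h, zero_apply] at h1
    rw [← hξ, h1]
    exact map_zero (mfderiv (𝓡 q) (𝓡 d) ι z)
  · obtain ⟨⟨v, ξ⟩, h1⟩ := hn.surjective (0, t)
    have h2 : A.anchor (ι z) v - mfderiv (𝓡 q) (𝓡 d) ι z ξ = t := congrArg Prod.snd h1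
    rw [← h2]
    exact Submodule.sub_mem_sup ⟨v, rfl⟩ ⟨ξ, rfl⟩

namespace IsTransversalStructure

variable {B : LieAlgebroid q l (Euc q) (Bundle.Trivial (Euc q) (Euc l))}
  {J : ∀ z, Bundle.Trivial (Euc q) (Euc l) z →ₗ[ℝ] V (ι z)} {p : Euc q}
  (hB : A.IsTransversalStructure B ι J p)

include hB

theorem contDiffAt_fib_map {x₀ : M} {z : Euc q}
    (hz : ι z ∈ (trivializationAt (Euc r) V x₀).baseSet) :
    ContDiffAt ℝ ∞ (fun z ↦ toCLM (fib r x₀ (ι z) ∘ₗ (J z : Euc l →ₗ[ℝ] V (ι z)))) z := by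
  refine contDiffAt_toCLM fun u ↦ ?_
  have h1 : ContMDiff (𝓡 q) ((𝓡 d).prod 𝓘(ℝ, Euc r)) ∞
      (fun z ↦ (⟨ι z, J z u⟩ : TotalSpace (Euc r) V)) :=
    hB.contMDiff_map.comp (mkTriv (fun _ : Euc q ↦ u) contDiff_const).contMDiff
  have h2 := (((trivializationAt (Euc r) V x₀).contMDiffAt_iff
    (IB := 𝓡 d) (IM := 𝓡 q) (n := ∞) (f := fun z ↦ (⟨ι z, J z u⟩ : TotalSpace (Euc r) V))
    (x₀ := z) ((trivializationAt (Euc r) V x₀).mem_source.2 hz)).1 h1.contMDiffAt).2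
  refine h2.contDiffAt.congr_of_eventuallyEq ?_
  filter_upwards [(contMDiff_of_isSmoothEmbedding hB.isSmoothEmbedding).continuous.continuousAt
    ((trivializationAt (Euc r) V x₀).open_baseSet.mem_nhds hz)] with w hw
  exact fib_apply hw _

/-- `bracket_eq` requires sections related over the whole disc, not just near `z₀`. Both are
therefore cut off by the same function: `X' = (ψ ∘ ι) u`. -/
theorem exists_extension (z₀ : Euc q) (u : Euc l) :
    ∃ (X : Cₛ^∞⟮𝓡 d; Euc r, V⟯) (X' : TrivSection q l),
      (∀ z, X (ι z) = J z (X' z)) ∧ ∀ᶠ z in 𝓝 z₀, X' z = u := by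
  have hι := hB.isSmoothEmbedding
  have hc := (contMDiff_of_isSmoothEmbedding hι).continuous
  have hb := mem_baseSet_trivializationAt (Euc r) V (ι z₀)
  obtain ⟨ψ, X, hψ, hψ1, hψ0, hX⟩ := exists_section_extension (V := V) (r := r) hι hb
    (c := fun z ↦ fib r (ι z₀) (ι z) (J z u)) (by
      filter_upwards [hc.continuousAt
        ((trivializationAt (Euc r) V (ι z₀)).open_baseSet.mem_nhds hb)] with z hz
      exact (hB.contDiffAt_fib_map hz).clm_apply (contDiffAt_const (c := u)))
  refine ⟨X, mkTriv (fun z ↦ ψ (ι z) • u)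
    (((hψ.comp (contMDiff_of_isSmoothEmbedding hι)).contDiff).smul contDiff_const), fun z ↦ ?_, ?_⟩
  · show X (ι z) = J z (ψ (ι z) • u)
    rw [hX]
    by_cases h : ψ (ι z) = 0
    · rw [h, zero_smul]
      exact ((congrArg (J z) (zero_smul ℝ u)).trans (map_zero (J z))).symm
    · rw [fibSymm_fib (hψ0 _ h)]
      exact (map_smul (J z) (ψ (ι z)) u).symm
  · filter_upwards [hc.continuousAt.eventually hψ1] with z hz
    show ψ (ι z) • u = u
    rw [hz, one_smul]

variable {lam : ∀ z, V (ι z) →ₗ[ℝ] Euc l} (hJ : ∀ z (u : Euc l), lam z (J z u) = u)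
include hJ

/-- Injectivity: a vector of the kernel has its anchor tangent to the disc, so it comes from `J`, on
which `lam` is injective. Surjectivity follows from transversality, after a correction in the range
of `J`. -/
theorem nondegAt (z : Euc q) : A.NondegAt lam z := by
  constructor
  · rintro ⟨v, ξ⟩ ⟨v', ξ'⟩ h
    obtain ⟨h1, h2⟩ := Prod.mk.inj h
    have h3 : A.anchor (ι z) (v - v') = mfderiv (𝓡 q) (𝓡 d) ι z (ξ - ξ') := by
      rw [map_sub (A.anchor (ι z))]
      exact (sub_eq_sub_iff_sub_eq_sub.1 h2).trans
        (map_sub (mfderiv (𝓡 q) (𝓡 d) ι z) ξ ξ').symm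
    obtain ⟨u, hu⟩ : v - v' ∈ LinearMap.range (J z) := by
      rw [hB.range_eq]
      exact ⟨ξ - ξ', h3.symm⟩
    have h4 : u = 0 := by
      have h5 : lam z (v - v') = 0 := by rw [map_sub]; exact sub_eq_zero.2 h1
      rw [← hu, hJ] at h5
      exact h5
    have h6 : v - v' = 0 := by rw [← hu, h4, map_zero]
    rw [h6, map_zero] at h3
    have h7 := mfderiv_injective hB.isSmoothEmbedding z (h3.symm.trans (map_zero _).symm)
    exact Prod.ext (sub_eq_zero.1 h6) (sub_eq_zero.1 h7)
  · rintro ⟨w, t⟩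
    have ht : t ∈ LinearMap.range (A.anchor (ι z)) ⊔
      LinearMap.range (mfderiv (𝓡 q) (𝓡 d) ι z).toLinearMap := by
      rw [hB.transverse]; trivial
    obtain ⟨_, ⟨v, rfl⟩, _, ⟨ξ, rfl⟩, rfl⟩ := Submodule.mem_sup.1 ht
    -- Adding `J z u` to `v` corrects the value of `lam`; its anchor is tangent to the disc and is
    -- compensated by `B.anchor z u`.
    obtain ⟨u, hu⟩ : ∃ u : Euc l, u = w - lam z v := ⟨_, rfl⟩
    refine ⟨(v + J z u, B.anchor z u - ξ), Prod.ext ?_ ?_⟩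
    · show lam z (v + J z u) = w
      rw [map_add, hJ, hu]
      abel
    · calc A.anchor (ι z) (v + J z u) - mfderiv (𝓡 q) (𝓡 d) ι z (B.anchor z u - ξ)
          = (A.anchor (ι z) v + A.anchor (ι z) (J z u)) -
            (mfderiv (𝓡 q) (𝓡 d) ι z (B.anchor z u) - mfderiv (𝓡 q) (𝓡 d) ι z ξ) :=
            congrArg₂ _ (map_add _ _ _) (map_sub (mfderiv (𝓡 q) (𝓡 d) ι z) _ _)
        _ = A.anchor (ι z) v + mfderiv (𝓡 q) (𝓡 d) ι z ξ := by
            rw [hB.anchor_eq]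
            abel

theorem lift_eq (z : Euc q) (u : Euc l) : A.lift lam z u = J z u ∧ A.tanc lam z u = B.anchor z u := by
  have h := A.eq_lift_of_anchor_eq hB.isSmoothEmbedding (hB.nondegAt hJ z)
    (hB.anchor_eq z u).symm
  rw [hJ] at h
  exact ⟨h.1.symm, h.2.symm⟩

theorem tanc_eq_anc (x₀ z : Euc q) : B.anc x₀ z = A.tanc lam z := by
  rw [anc_trivial]
  ext1 u
  exact (hB.lift_eq hJ z u).2.symm

/-- Both are determined by brackets of sections that are constant near `z`. These extend to sections
of `V`, where each bracket is the restriction of that of `A`. -/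
theorem tbrk_eq_brk
    (hlam : ∀ x₀ z, ι z ∈ (trivializationAt (Euc r) V x₀).baseSet →
      ContDiffAt ℝ ∞ (fiberMatrix (r := r) lam x₀) z) (x₀ z : Euc q) :
    B.brk x₀ z = A.tbrk lam z := by
  ext1 u
  ext1 v
  obtain ⟨X, X', hX, hX'⟩ := hB.exists_extension z u
  obtain ⟨Y, Y', hY, hY'⟩ := hB.exists_extension z v
  have hn := hB.nondegAt hJ z
  rw [brk_trivial B x₀ z hX' hY']
  apply A.lift_injective hB.isSmoothEmbedding hn
  rw [(hB.lift_eq hJ z _).1, ← hB.bracket_eq X Y X' Y' hX hY,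
    A.bracket_eq_lift_bracketFun hB.isSmoothEmbedding hlam hn (X' := X') (Y' := Y')
      (Eventually.of_forall fun w ↦ (hX w).trans (hB.lift_eq hJ w _).1.symm)
      (Eventually.of_forall fun w ↦ (hY w).trans (hB.lift_eq hJ w _).1.symm)]
  congr 1
  have h1 : fderiv ℝ (fun z ↦ (X' z : Euc l)) z = 0 := by
    rw [EventuallyEq.fderiv_eq (f := fun _ ↦ u) hX']
    exact fderiv_const_apply u
  have h2 : fderiv ℝ (fun z ↦ (Y' z : Euc l)) z = 0 := by
    rw [EventuallyEq.fderiv_eq (f := fun _ ↦ v) hY']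
    exact fderiv_const_apply v
  refine (?_ : bracketFun (A.tanc lam) (A.tbrk lam) (fun z ↦ X' z) (fun z ↦ Y' z) z = _)
  rw [bracketFun, h1, h2, hX'.self_of_nhds, hY'.self_of_nhds]
  simp

end IsTransversalStructure

end LieAlgebroid

namespace LieAlgebroid

theorem IsSingularityOfOrder.anc_eq_zero {q l : ℕ}
    {B : LieAlgebroid q l (Euc q) (Bundle.Trivial (Euc q) (Euc l))} {k : ℕ} {z : Euc q}
    (h : B.IsSingularityOfOrder k z) : B.anc z z = 0 := by
  -- As `k > 0`, the vanishing jet includes the value of the bivector field, whose mixed entries are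
  -- the components of the anchor.
  have h0 := h.2.1 0 h.1
  have h1 : B.poisson z (z, 0) = 0 := by
    have h2 := congrArg (fun L ↦ L 0) h0
    rw [iteratedFDeriv_zero_apply] at h2
    exact h2
  ext u j
  rw [B.anc_apply]
  refine Finset.sum_eq_zero fun i _ ↦ ?_
  have h3 : B.anchorCoeff z z i j = 0 := congrFun (congrFun h1 (.inl i)) (.inr j)
  rw [h3, zero_mul]

end LieAlgebroid

end AlgebroidStability

end

/-! ### Stability of the leaf. -/

theorem proposition4p2 {d r : ℕ} {M : Type*} [TopologicalSpace M] [T2Space M]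
    [SecondCountableTopology M] [ChartedSpace (AlgebroidStability.Euc d) M]
    [IsManifold (𝓡 d) ∞ M]
    {V : M → Type*} [TopologicalSpace (TotalSpace (AlgebroidStability.Euc r) V)]
    [∀ x, AddCommGroup (V x)] [∀ x, Module ℝ (V x)] [∀ x, TopologicalSpace (V x)]
    [FiberBundle (AlgebroidStability.Euc r) V] [VectorBundle ℝ (AlgebroidStability.Euc r) V]
    [ContMDiffVectorBundle ∞ (AlgebroidStability.Euc r) V (𝓡 d)]
    (A : AlgebroidStability.LieAlgebroid d r M V)
    {n : ℕ} {S : Set M} (hS : A.IsSingularLeaf S n)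
    (hS' : AlgebroidStability.IsEmbeddedSubmanifold d S n)
    {q l : ℕ}
    (B : AlgebroidStability.LieAlgebroid q l (AlgebroidStability.Euc q)
      (Bundle.Trivial (AlgebroidStability.Euc q) (AlgebroidStability.Euc l)))
    (ι : AlgebroidStability.Euc q → M)
    (J : ∀ z, Bundle.Trivial (AlgebroidStability.Euc q) (AlgebroidStability.Euc l) z →ₗ[ℝ] V (ι z))
    (p : AlgebroidStability.Euc q) (hp : ι p ∈ S)
    (hB : A.IsTransversalStructure B ι J p)
    {k : ℕ} (hk : B.IsKStableSingularity k p) :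
    A.IsStableLeaf (2 * k) S n := by
  open AlgebroidStability LieAlgebroid in
  intro U hU hSU
  have hι := hB.isSmoothEmbedding
  have hιc := (contMDiff_of_isSmoothEmbedding hι).continuous
  obtain ⟨lam, hJ, hlam⟩ := exists_smooth_leftInverse (V := V) (r := r) (l := l) hι J
    (fun x₀ z hz ↦ hB.contDiffAt_fib_map hz) hB.injective
  have hn : ∀ z, A.NondegAt lam z := hB.nondegAt hJ
  -- The unit ball keeps the singularity to be found inside the region where the cutoff function is
  -- one.
  have hΩ : ι ⁻¹' U ∩ Metric.ball p 1 ∈ 𝓝 p :=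
    inter_mem (hιc.continuousAt (hU.mem_nhds (hSU hp))) (Metric.ball_mem_nhds p one_pos)
  obtain ⟨R, hR, ε, hε, hRε⟩ := B.exists_ball_of_eventually_csNhds (2 * k) (hk.2 _ hΩ)
  -- The ball of radius `R'` contains both the ball on which closeness to `B` is tested and the unit
  -- ball around `p`.
  set R' := max R (‖p‖ + 1) with hR'
  have hR'0 : 0 < R' := hR.trans_le (le_max_left _ _)
  -- The inner radius exceeds `R'` so that `χ` is one near each point of the closed ball of radius
  -- `R'`. Its support is the closed ball of radius `R' + 2`, over which `A'` has to be
  -- nondegenerate.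
  let χ : ContDiffBump (0 : Euc q) := ⟨R' + 1, R' + 2, by linarith, by linarith⟩
  have hχ1 : ∀ z ∈ Metric.closedBall (0 : Euc q) R', ∀ᶠ w in 𝓝 z, χ w = 1 := by
    intro z hz
    filter_upwards [Metric.ball_mem_nhds z one_pos] with w hw
    refine χ.one_of_mem_closedBall ?_
    rw [mem_closedBall_zero_iff] at hz ⊢
    rw [Metric.mem_ball, dist_eq_norm] at hw
    have := norm_add_le z (w - z)
    rw [add_sub_cancel] at this
    show ‖w‖ ≤ R' + 1
    linarith
  filter_upwards [A.eventually_nondegAt hι hlam (2 * k)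
      (isCompact_closedBall (0 : Euc q) (R' + 2)) hn,
    A.csTendsto_poissonOf hι hlam (2 * k) (isCompact_closedBall (0 : Euc q) R)
      (isCompact_closedBall (0 : Euc l) R) hn ε hε] with A' hA'n hA'
  obtain ⟨B', hB'⟩ := A'.exists_cutoff_algebroid hι hlam (χ := χ) χ.contDiff
    (fun z hz ↦ hA'n z (by rw [χ.tsupport_eq] at hz; exact hz))
  have hclose : ∀ x₀, ∀ z ∈ Metric.closedBall (0 : Euc q) R ×ˢ Metric.closedBall (0 : Euc l) R,
      ∀ j ≤ 2 * k, ‖iteratedFDeriv ℝ j (fun w ↦ B'.poisson x₀ w - B.poisson x₀ w) z‖ < ε := by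
    intro x₀ z hz j hj
    -- Near `z` the cutoff has no effect on `B'`, and `B` is the structure induced by `A`. The
    -- difference is thus the one estimated for the induced bivector fields.
    have h1 : (fun w ↦ B'.poisson x₀ w - B.poisson x₀ w) =ᶠ[𝓝 z]
        fun w ↦ poissonOf (A'.tanc lam w.1) (A'.tbrk lam w.1) w.2 -
          poissonOf (A.tanc lam w.1) (A.tbrk lam w.1) w.2 := by
      have hz1 := hχ1 z.1 (Metric.closedBall_subset_closedBall (le_max_left _ _) hz.1)
      filter_upwards [continuous_fst.continuousAt.eventually hz1.eventually_nhds] with w hw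
      rw [poisson_trivial, poisson_trivial, (hB' w.1 hw x₀).1, (hB' w.1 hw x₀).2,
        hB.tanc_eq_anc hJ, hB.tbrk_eq_brk hJ hlam]
    rw [(h1.iteratedFDeriv ℝ j).eq_of_nhds]
    exact hA' z hz j hj
  obtain ⟨z, ⟨hzU, hzp⟩, hz⟩ := hRε B' hclose
  have hzR : z ∈ Metric.closedBall (0 : Euc q) R' := by
    rw [Metric.mem_ball, dist_eq_norm] at hzp
    have := norm_add_le p (z - p)
    rw [add_sub_cancel] at this
    rw [mem_closedBall_zero_iff]
    exact le_trans (by linarith) (le_max_right R (‖p‖ + 1))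
  have h0 : A'.tanc lam z = 0 := by
    rw [← (hB' z (hχ1 z hzR) z).1]
    exact hz.anc_eq_zero
  have hnz : A'.NondegAt lam z :=
    hA'n z (Metric.closedBall_subset_closedBall (by linarith) hzR)
  -- The ranks of `A'` at `ι z` and of `A` at `ι p` are both `d - q`, and the latter is `n`.
  have h1 := finrank_anchor_add_of_isCompl hι (isCompl_of_tanc_eq_zero hι hnz h0)
  have h2 := finrank_anchor_add_of_isCompl hι hB.isCompl
  rw [hS.1.2 _ hp] at h2
  have h3 : Module.finrank ℝ (LinearMap.range (A'.anchor (ι z))) = n := by omega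
  exact ⟨A'.leaf (ι z), h3 ▸ A'.isLeafOfDim_leaf (ι z), ι z, Relation.ReflTransGen.refl, hzU⟩
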